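/- For $\theta=(\mu,\sigma,\nu,\alpha)$ with $\sigma>0$, $\nu>2$, $\alpha\in(0,1)$ let $$f_t(x;\nu,\mu,\sigma)=\frac{\Gamma(\frac{\nu+1}{2})}{\Gamma(\frac{\nu}{2})\sqrt{\nu\pi}\,\sigma}\Bigl(1+\frac{(x-\mu)^2}{\nu\sigma^2}\Bigr)^{-\frac{\nu+1}{2}},\qquad F_t(r;\nu,\mu,\sigma)=\int_{-\infty}^r f_t(x;\nu,\mu,\sigma)\,dx$$ be the density and the CDF of the Student's $t$ distribution, let $w(p;\alpha)=\exp\bigl(-(-\log p)^{\alpha}\bigr)$ (with $w(0;\alpha)=0$) be the Prelec weighting function, and put $$F_{bw}(r;\theta)=w\bigl(F_t(r;\nu,\mu,\sigma);\alpha\bigr),\qquad f_{bw}(r;\theta)=\frac{\partial}{\partial r}F_{bw}(r;\theta).$$ Theorem (Consistency and Asymptotic Normality). Let $\Theta$ be a compact subset of $\{(\mu,\sigma,\nu,\alpha):\sigma>0,\ \nu>2,\ \alpha\in(0,1)\}\subset\mathbb{R}^4$, let $\theta_0\in\Theta$, and let $R_1,R_2,\dots$ be i.i.d. random variables with CDF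 $F_{bw}(\cdot;\theta_0)$. For every $T\ge 1$ let $\hat\theta_T$ be a (measurable) maximum likelihood estimator, that is, almost surely $\hat\theta_T\in\Theta$ and $\hat\theta_T$ maximizes $\ell_T(\theta)=\sum_{t=1}^T\log f_{bw}(R_t;\theta)$ over $\theta\in\Theta$. Then: 1. $\hat\theta_T\to\theta_0$ in probability as $T\to\infty$. 2. If moreover $\theta_0$ is an interior point of $\Theta$, then $\theta\mapsto\log f_{bw}(r;\theta)$ is twice continuously differentiable near $\theta_0$ for every $r$, the entries of its Hessian at $\theta_0$ are integrable under the density $f_{bw}(\cdot;\theta_0)$, the Fisher information matrix (per observation) $$I(\theta_0)=\mathbb{E}\bigl[-\nabla_\theta^2\log f_{bw}(R_1;\theta_0)\bigr]=-\int_{\mathbb{R}}\nabla_\theta^2\log f_{bw}(r;\theta_0)\,f_{bw}(r;\theta_0)\,dr$$ is positive definite, and $$\sqrt{T}\,(\hat\theta_T-\theta_0)\to N\bigl(0,I(\theta_0)^{-1}\bigr)\quad\text{in distribution.}$$ -/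

import Mathlib

open MeasureTheory ProbabilityTheory Filter Topology

noncomputable section

/-- The density of the Student's t distribution with `ν` degrees of freedom, location `μ` and
scale `σ`. -/
def studentTPDF (ν μ σ x : ℝ) : ℝ :=
  Real.Gamma ((ν + 1) / 2) / (Real.Gamma (ν / 2) * √(ν * Real.pi) * σ)
    * (1 + (x - μ) ^ 2 / (ν * σ ^ 2)) ^ (-((ν + 1) / 2))

/-- The cumulative distribution function `F_t(r; ν, μ, σ)` of the Student's t distribution. -/
def studentTCDF (ν μ σ r : ℝ) : ℝ :=
  ∫ x in Set.Iic r, studentTPDF ν μ σ x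

/-- The Prelec probability weighting function `w(p; α) = exp (-(-log p) ^ α)`, with
`w(0; α) = 0`. -/
def prelecWeight (α p : ℝ) : ℝ :=
  if p ≤ 0 then 0 else Real.exp (-(-Real.log p) ^ α)

/-- Parameter vectors `θ = (μ, σ, ν, α)`, in this order of coordinates. -/
abbrev ParamVec : Type := EuclideanSpace ℝ (Fin 4)

/-- The parameter vectors `(μ, σ, ν, α)` with `σ > 0`, `ν > 2` and `α ∈ (0, 1)`. -/
def admissibleParams : Set ParamVec :=
  {θ | 0 < θ 1 ∧ 2 < θ 2 ∧ 0 < θ 3 ∧ θ 3 < 1}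

/-- The behavioral CDF `F_bw(r; θ) = w(F_t(r; ν, μ, σ); α)`. -/
def behavioralCDF (θ : ParamVec) (r : ℝ) : ℝ :=
  prelecWeight (θ 3) (studentTCDF (θ 2) (θ 0) (θ 1) r)

/-- The behavioral density: the derivative in `r` of the behavioral CDF. -/
def behavioralPDF (θ : ParamVec) (r : ℝ) : ℝ :=
  deriv (behavioralCDF θ) r

/-- The log-likelihood `ℓ_T(θ)` of the sample consisting of the first `T` returns. -/
def logLikelihood (x : ℕ → ℝ) (T : ℕ) (θ : ParamVec) : ℝ :=
  ∑ t ∈ Finset.range T, Real.log (behavioralPDF θ (x t))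

/-- `θhat` is a maximum likelihood estimate over the parameter space `Θ` for the sample
consisting of the first `T` returns. -/
def IsMLE (Θ : Set ParamVec) (x : ℕ → ℝ) (T : ℕ) (θhat : ParamVec) : Prop :=
  θhat ∈ Θ ∧ ∀ θ ∈ Θ, logLikelihood x T θ ≤ logLikelihood x T θhat

/-- The Hessian matrix of a real function of the parameters. -/
def paramHessian (g : ParamVec → ℝ) (θ : ParamVec) : Matrix (Fin 4) (Fin 4) ℝ :=
  Matrix.of fun i j =>
    fderiv ℝ (fderiv ℝ g) θ (EuclideanSpace.single i 1) (EuclideanSpace.single j 1)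

/-- The Hessian in the parameters of the log-likelihood of a single return `r`. -/
def logDensityHessian (θ : ParamVec) (r : ℝ) : Matrix (Fin 4) (Fin 4) ℝ :=
  paramHessian (fun θ' => Real.log (behavioralPDF θ' r)) θ

/-- The Fisher information matrix (of one observation): the expectation, under the
density with parameter `θ`, of minus the Hessian of the log-density. -/
def fisherInformation (θ : ParamVec) : Matrix (Fin 4) (Fin 4) ℝ :=
  Matrix.of fun i j => ∫ r, -logDensityHessian θ r i j * behavioralPDF θ r

end

/-! The proof is the classical one: Wald's argument for consistency, linearisation of the score
equation for normality. What needs work is its regularity conditions: integrable domination of three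
parameter derivatives of the log-density, global identification, and a nonsingular information
matrix.

Write $F$, $f$ for the Student distribution function and density and $L=-\log F$. Then
$F_{bw}=\exp(-L^\alpha)$, and since $1/F=e^L$, $\log f_{bw}=\log\alpha+(\alpha-1)\log
L-L^\alpha+L+\log f$. `DerivBound` is a calculus of estimates $\|D^n_\theta h\|\le C\rho^n w$,
locally uniform in $\theta$ and uniform in $x$, stable under products, `exp`, `log`, inverses and
integration. With $M(x)=1+\log(1+|x|)$ as rate it gives in turn derivatives of $f$, $F$, $1-F$ and
$L$ bounded relative to the functions themselves (`derivBound_tDensity`, `derivBound_tLower`,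
`derivBound_tNegLog`), and then derivatives of $\log f_{bw}$ bounded by powers of $M^3$
(`derivBound_log_behavioralPDF`).

Powers of $M$ are integrable under $f_{bw}$. On the right $f_{bw}$ decays faster than $1/|x|$ by a
power. On the left $f/F$ is only of order $1/|x|$, and the factor $\exp(-L^\alpha)$, a stretched
exponential in $\log|x|$, has to beat the logarithms (`exists_logGrowth_pow_mul_behavioralPDF_le`).

For identification, $L$ grows like $\log|x|$ on the left, so $\alpha$ can be read off from
$\alpha\log L$; then $F$, hence $f$, is known, and its tail exponent and kernel give
$\nu,\mu,\sigma$ (`eq_of_behavioralCDF_eq`). The infinitesimal version is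
`eq_zero_of_fderiv_behavioralCDF_eq_zero`; with the information equality `integral_neg_scoreDeriv`
it makes the information matrix positive definite.

The statistics is in `ae_tendsto_of_maximizes` (Gibbs' inequality, the strong law and a finite
cover) and `tendstoInDistribution_of_estimating_equation`, applied to the score multiplied by the
inverse information, so that the mean derivative is $-\mathrm{id}$. -/

/-! ### A calculus of derivative bounds in the parameter -/

section DerivBounds

open scoped ContDiff

variable {E F G X : Type*} [NormedAddCommGroup E] [NormedSpace ℝ E]
  [NormedAddCommGroup F] [NormedSpace ℝ F] [NormedAddCommGroup G] [NormedSpace ℝ G]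

/-- `DerivBound U n₀ ρ w h`: the functions `h · x` are smooth on `U` and, locally uniformly in `θ`
and uniformly in `x`, the derivatives of order `n ≥ n₀` are bounded by multiples of
`ρ x ^ n * w θ x`. -/
def DerivBound (U : Set E) (n₀ : ℕ) (ρ : X → ℝ) (w : E → X → ℝ) (h : E → X → F) : Prop :=
  (∀ x, ContDiffOn ℝ ∞ (fun θ => h θ x) U) ∧
  ∀ K ⊆ U, IsCompact K → ∀ n, n₀ ≤ n → ∃ C, 0 ≤ C ∧ ∀ θ ∈ K, ∀ x,
    ‖iteratedFDerivWithin ℝ n (fun θ => h θ x) U θ‖ ≤ C * ρ x ^ n * w θ x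

variable {U : Set E} {n₀ : ℕ} {ρ ρ' : X → ℝ} {w w' : E → X → ℝ} {h h' : E → X → F}

namespace DerivBound

lemma congr (H : DerivBound U n₀ ρ w h) (heq : ∀ θ ∈ U, ∀ x, h' θ x = h θ x) :
    DerivBound U n₀ ρ w h' := by
  refine ⟨fun x => (H.1 x).congr fun θ hθ => heq θ hθ x, fun K hK hKc n hn => ?_⟩
  obtain ⟨C, hC, hb⟩ := H.2 K hK hKc n hn
  refine ⟨C, hC, fun θ hθ x => ?_⟩
  rw [iteratedFDerivWithin_congr (fun θ hθ => heq θ hθ x) (hK hθ)]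
  exact hb θ hθ x

lemma of_le (H : DerivBound U n₀ ρ w h) {n₁ : ℕ} (hn : n₀ ≤ n₁) : DerivBound U n₁ ρ w h :=
  ⟨H.1, fun K hK hKc n hn' => H.2 K hK hKc n (hn.trans hn')⟩

lemma mono_weight (H : DerivBound U n₀ ρ w h) (hρ : ∀ x, 0 ≤ ρ x)
    (hw : ∀ K ⊆ U, IsCompact K → ∃ C, 0 ≤ C ∧ ∀ θ ∈ K, ∀ x, w θ x ≤ C * w' θ x) :
    DerivBound U n₀ ρ w' h := by
  refine ⟨H.1, fun K hK hKc n hn => ?_⟩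
  obtain ⟨C, hC, hb⟩ := H.2 K hK hKc n hn
  obtain ⟨C', hC', hb'⟩ := hw K hK hKc
  refine ⟨C * C', by positivity, fun θ hθ x => (hb θ hθ x).trans ?_⟩
  have := hρ x
  calc C * ρ x ^ n * w θ x ≤ C * ρ x ^ n * (C' * w' θ x) := by
        gcongr; exact hb' θ hθ x
    _ = _ := by ring

lemma mono_rate (H : DerivBound U n₀ ρ w h) (hρ : ∀ x, 0 ≤ ρ x) (hρ' : ∀ x, ρ x ≤ ρ' x)
    (hw : ∀ θ ∈ U, ∀ x, 0 ≤ w θ x) : DerivBound U n₀ ρ' w h := by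
  refine ⟨H.1, fun K hK hKc n hn => ?_⟩
  obtain ⟨C, hC, hb⟩ := H.2 K hK hKc n hn
  refine ⟨C, hC, fun θ hθ x => (hb θ hθ x).trans ?_⟩
  have := hρ x
  have := hw θ (hK hθ) x
  gcongr
  exact hρ' x

lemma add (hU : IsOpen U) (H : DerivBound U n₀ ρ w h) (H' : DerivBound U n₀ ρ w h') :
    DerivBound U n₀ ρ w (fun θ x => h θ x + h' θ x) := by
  refine ⟨fun x => (H.1 x).add (H'.1 x), fun K hK hKc n hn => ?_⟩
  obtain ⟨C, hC, hb⟩ := H.2 K hK hKc n hn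
  obtain ⟨C', hC', hb'⟩ := H'.2 K hK hKc n hn
  refine ⟨C + C', by positivity, fun θ hθ x => ?_⟩
  rw [fun_iteratedFDerivWithin_add_apply (((H.1 x).of_le (by exact_mod_cast le_top)) θ (hK hθ))
    (((H'.1 x).of_le (by exact_mod_cast le_top)) θ (hK hθ)) hU.uniqueDiffOn (hK hθ)]
  refine (norm_add_le _ _).trans ?_
  linarith [hb θ hθ x, hb' θ hθ x]

lemma neg (hU : IsOpen U) (H : DerivBound U n₀ ρ w h) :
    DerivBound U n₀ ρ w (fun θ x => - h θ x) := by
  refine ⟨fun x => (H.1 x).neg, fun K hK hKc n hn => ?_⟩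
  obtain ⟨C, hC, hb⟩ := H.2 K hK hKc n hn
  refine ⟨C, hC, fun θ hθ x => ?_⟩
  have := iteratedFDerivWithin_neg_apply (𝕜 := ℝ) (i := n) (f := fun θ => h θ x)
    hU.uniqueDiffOn (hK hθ)
  rw [show (fun θ => - h θ x) = - (fun θ => h θ x) from rfl, this, norm_neg]
  exact hb θ hθ x

lemma sub (hU : IsOpen U) (H : DerivBound U n₀ ρ w h) (H' : DerivBound U n₀ ρ w h') :
    DerivBound U n₀ ρ w (fun θ x => h θ x - h' θ x) := by
  simpa only [sub_eq_add_neg] using H.add hU (H'.neg hU)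

lemma smul {w₁ w₂ : E → X → ℝ} {f : E → X → ℝ} (hU : IsOpen U) (Hf : DerivBound U 0 ρ w₁ f)
    (H : DerivBound U 0 ρ w₂ h) :
    DerivBound U 0 ρ (fun θ x => w₁ θ x * w₂ θ x) (fun θ x => f θ x • h θ x) := by
  refine ⟨fun x => (Hf.1 x).smul (H.1 x), fun K hK hKc n _ => ?_⟩
  choose C hC hb using fun n => Hf.2 K hK hKc n (Nat.zero_le n)
  choose C' hC' hb' using fun n => H.2 K hK hKc n (Nat.zero_le n)
  refine ⟨∑ i ∈ Finset.range (n + 1), (n.choose i : ℝ) * C i * C' (n - i),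
    Finset.sum_nonneg fun i _ => by have := hC i; have := hC' (n - i); positivity,
    fun θ hθ x => ?_⟩
  refine (norm_iteratedFDerivWithin_smul_le (Hf.1 x) (H.1 x) hU.uniqueDiffOn (hK hθ)
    (n := n) (by exact_mod_cast le_top)).trans ?_
  rw [Finset.sum_mul, Finset.sum_mul]
  refine Finset.sum_le_sum fun i hi => ?_
  have hi' : i + (n - i) = n := by have := Finset.mem_range.1 hi; omega
  calc _ ≤ (n.choose i : ℝ) * (C i * ρ x ^ i * w₁ θ x) * (C' (n - i) * ρ x ^ (n - i) * w₂ θ x) := by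
        rw [mul_assoc, mul_assoc]
        exact mul_le_mul_of_nonneg_left (mul_le_mul (hb i θ hθ x) (hb' (n - i) θ hθ x)
          (norm_nonneg _) ((norm_nonneg _).trans (hb i θ hθ x))) (by positivity)
    _ = (n.choose i : ℝ) * C i * C' (n - i) * ρ x ^ (i + (n - i)) * (w₁ θ x * w₂ θ x) := by
        rw [pow_add]; ring
    _ = _ := by rw [hi']

lemma mul {w₁ w₂ : E → X → ℝ} {f g : E → X → ℝ} (hU : IsOpen U) (Hf : DerivBound U 0 ρ w₁ f)
    (H : DerivBound U 0 ρ w₂ g) :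
    DerivBound U 0 ρ (fun θ x => w₁ θ x * w₂ θ x) (fun θ x => f θ x * g θ x) := Hf.smul hU H

/-- A smooth function of the parameter alone. -/
lemma of_contDiffOn {φ : E → F} (hU : IsOpen U) (hφ : ContDiffOn ℝ ∞ φ U) :
    DerivBound U 0 (fun _ : X => 1) (fun _ _ => 1) (fun θ _ => φ θ) := by
  refine ⟨fun _ => hφ, fun K hK hKc n _ => ?_⟩
  have hc : ContinuousOn (fun θ => iteratedFDerivWithin ℝ n φ U θ) K :=
    (hφ.continuousOn_iteratedFDerivWithin (by exact_mod_cast le_top) hU.uniqueDiffOn).mono hK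
  obtain ⟨C, hC⟩ := hKc.exists_bound_of_continuousOn hc
  exact ⟨max C 0, le_max_right _ _, fun θ hθ x => by simpa using Or.inl (hC θ hθ)⟩

/-- The composition rule for `log` controls only positive orders, because the size of a logarithm is
not governed by its derivatives; the order zero bound is supplied separately here. -/
lemma of_succ (H : DerivBound U 1 ρ w h)
    (h0 : ∀ K ⊆ U, IsCompact K → ∃ C, 0 ≤ C ∧ ∀ θ ∈ K, ∀ x, ‖h θ x‖ ≤ C * w θ x) :
    DerivBound U 0 ρ w h := by
  refine ⟨H.1, fun K hK hKc n _ => ?_⟩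
  rcases Nat.eq_zero_or_pos n with rfl | hn
  · simpa using h0 K hK hKc
  · exact H.2 K hK hKc n hn

lemma bound_zero (H : DerivBound U 0 ρ w h) {K : Set E} (hK : K ⊆ U) (hKc : IsCompact K) :
    ∃ C, 0 ≤ C ∧ ∀ θ ∈ K, ∀ x, ‖h θ x‖ ≤ C * w θ x := by
  simpa using H.2 K hK hKc 0 le_rfl

lemma fderivWithin (hU : IsOpen U) (H : DerivBound U 1 ρ w h) :
    DerivBound U 0 ρ (fun θ x => ρ x * w θ x)
      (fun θ x => _root_.fderivWithin ℝ (fun θ => h θ x) U θ) := by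
  refine ⟨fun x => (H.1 x).fderivWithin hU.uniqueDiffOn (by simp), fun K hK hKc n _ => ?_⟩
  obtain ⟨C, hC, hb⟩ := H.2 K hK hKc (n + 1) (by omega)
  refine ⟨C, hC, fun θ hθ x => ?_⟩
  rw [norm_iteratedFDerivWithin_fderivWithin hU.uniqueDiffOn (hK hθ)]
  exact (hb θ hθ x).trans_eq (by ring)

/-- Lets a formula for the derivative, such as $d\log F=F^{-1}dF$, produce a sharper weight than the
composition rules give. -/
lemma of_fderivWithin (hU : IsOpen U) (hs : ∀ x, ContDiffOn ℝ ∞ (fun θ => h θ x) U)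
    (H : DerivBound U 0 ρ (fun θ x => ρ x * w θ x)
      (fun θ x => _root_.fderivWithin ℝ (fun θ => h θ x) U θ)) : DerivBound U 1 ρ w h := by
  refine ⟨hs, fun K hK hKc n hn => ?_⟩
  obtain ⟨n, rfl⟩ := Nat.exists_eq_succ_of_ne_zero (Nat.pos_iff_ne_zero.1 hn)
  obtain ⟨C, hC, hb⟩ := H.2 K hK hKc n (by omega)
  refine ⟨C, hC, fun θ hθ x => ?_⟩
  rw [Nat.succ_eq_add_one, ← norm_iteratedFDerivWithin_fderivWithin hU.uniqueDiffOn (hK hθ)]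
  exact (hb θ hθ x).trans_eq (by ring)

/-- A weight which is itself a rate can be absorbed into the rate for derivatives of
positive order. -/
lemma absorb {M : X → ℝ} (hρ : ∀ x, 0 ≤ ρ x) (hM : ∀ x, 1 ≤ M x)
    (H : DerivBound U 1 ρ (fun _ x => M x) h) :
    DerivBound U 1 (fun x => ρ x * M x) (fun _ _ => 1) h := by
  refine ⟨H.1, fun K hK hKc n hn => ?_⟩
  obtain ⟨C, hC, hb⟩ := H.2 K hK hKc n hn
  refine ⟨C, hC, fun θ hθ x => (hb θ hθ x).trans ?_⟩
  have h1 : M x ≤ M x ^ n := le_self_pow₀ (hM x) (by omega)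
  have := hρ x
  calc C * ρ x ^ n * M x ≤ C * ρ x ^ n * M x ^ n := by gcongr
    _ = _ := by rw [mul_pow]; ring

end DerivBound

/-- Chain rule bound at a fixed value `p` of the inner function. -/
lemma exists_norm_iteratedFDerivWithin_comp_le {φ : ℝ → ℝ} {t : Set ℝ} (ht : IsOpen t)
    (hU : IsOpen U) (hφ : ContDiffOn ℝ ∞ φ t) (p : ℝ) (n : ℕ) :
    ∃ C, 0 ≤ C ∧ ∀ (f : E → ℝ) (θ : E) (D : ℝ), ContDiffOn ℝ ∞ f U → Set.MapsTo f U t → θ ∈ U →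
      f θ = p → (∀ i, 1 ≤ i → i ≤ n → ‖iteratedFDerivWithin ℝ i f U θ‖ ≤ D ^ i) →
      ‖iteratedFDerivWithin ℝ n (φ ∘ f) U θ‖ ≤ C * D ^ n := by
  refine ⟨n.factorial * ∑ i ∈ Finset.range (n + 1), ‖iteratedFDerivWithin ℝ i φ t p‖,
    by positivity, fun f θ D hf hft hθ hp hD => ?_⟩
  refine norm_iteratedFDerivWithin_comp_le hφ hf (by exact_mod_cast le_top) ht.uniqueDiffOn
    hU.uniqueDiffOn hft hθ (fun i hi => ?_) hD
  rw [hp]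
  exact Finset.single_le_sum (f := fun i => ‖iteratedFDerivWithin ℝ i φ t p‖)
    (fun i _ => norm_nonneg _) (Finset.mem_range.2 (by omega))

/-- The Faà di Bruno estimate asks for inner derivatives bounded by $D^i$ with a single $D$, whereas
a `DerivBound` has one constant per order. -/
lemma exists_pow_bound (C : ℕ → ℝ) (hC : ∀ i, 0 ≤ C i) (n : ℕ) :
    ∃ D : ℝ, 0 ≤ D ∧ ∀ i, 1 ≤ i → i ≤ n → C i ≤ D ^ i := by
  have hs : 0 ≤ ∑ i ∈ Finset.range (n + 1), C i := Finset.sum_nonneg fun i _ => hC i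
  refine ⟨1 + ∑ i ∈ Finset.range (n + 1), C i, by positivity, fun i hi hin => ?_⟩
  have h1 : C i ≤ ∑ i ∈ Finset.range (n + 1), C i :=
    Finset.single_le_sum (fun i _ => hC i) (Finset.mem_range.2 (by omega))
  have h2 : 1 + ∑ i ∈ Finset.range (n + 1), C i ≤ (1 + ∑ i ∈ Finset.range (n + 1), C i) ^ i :=
    le_self_pow₀ (by linarith) (by omega)
  linarith

/-- Factoring out the value $e^{f(\theta,x)}$ at the base point leaves the exponential of a function
vanishing there. The outer derivatives are then always taken at $0$, so the constant is uniform in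
$x$, and the extracted factor is the weight. -/
lemma DerivBound.exp {f : E → X → ℝ} (hU : IsOpen U) (hρ : ∀ x, 0 ≤ ρ x)
    (H : DerivBound U 1 ρ (fun _ _ => 1) f) :
    DerivBound U 0 ρ (fun θ x => Real.exp (f θ x)) (fun θ x => Real.exp (f θ x)) := by
  refine ⟨fun x => (H.1 x).exp, fun K hK hKc n _ => ?_⟩
  choose C hC hb using fun n : ℕ => H.2 K hK hKc (n + 1) (by omega)
  obtain ⟨D, hD, hDb⟩ := exists_pow_bound (fun i => C (i - 1)) (fun i => hC _) n
  obtain ⟨A, hA, hAb⟩ := exists_norm_iteratedFDerivWithin_comp_le (E := E) (φ := Real.exp)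
    isOpen_univ hU Real.contDiff_exp.contDiffOn 0 n
  refine ⟨A * D ^ n, by positivity, fun θ hθ x => ?_⟩
  have hf' : ContDiffOn ℝ ∞ (fun θ' => f θ' x - f θ x) U := (H.1 x).sub contDiffOn_const
  have hρx := hρ x
  have key := hAb (fun θ' => f θ' x - f θ x) θ (D * ρ x) hf' (fun _ _ => Set.mem_univ _) (hK hθ)
    (by simp) (fun i hi hin => by
      rw [fun_iteratedFDerivWithin_sub_apply (((H.1 x).of_le (by exact_mod_cast le_top)) θ (hK hθ))
        contDiffWithinAt_const hU.uniqueDiffOn (hK hθ),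
        iteratedFDerivWithin_const_of_ne (by omega)]
      have h1 := hb (i - 1) θ hθ x
      rw [Nat.sub_add_cancel hi] at h1
      simp only [Pi.zero_apply, sub_zero, mul_pow]
      calc _ ≤ _ := h1
        _ ≤ _ := by rw [mul_one]; gcongr; exact hDb i hi hin)
  have hcomp : (fun θ' => Real.exp (f θ' x)) =
      Real.exp (f θ x) • (Real.exp ∘ fun θ' => f θ' x - f θ x) := by
    ext θ'; simp [← Real.exp_add]
  rw [hcomp, iteratedFDerivWithin_const_smul_apply
    ((Real.contDiff_exp.comp_contDiffOn hf').of_le (by exact_mod_cast le_top) θ (hK hθ))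
    hU.uniqueDiffOn (hK hθ), norm_smul, Real.norm_of_nonneg (Real.exp_pos _).le]
  calc _ ≤ Real.exp (f θ x) * (A * (D * ρ x) ^ n) := by gcongr
    _ = _ := by rw [mul_pow]; ring

/-- Dividing by the value at the base point changes `log` by a constant and makes the inner function
equal to $1$ there, so the outer derivatives are uniform in $x$. Relative bounds on $f$ become
absolute bounds on $\log f$. -/
lemma DerivBound.log {f : E → X → ℝ} (hU : IsOpen U) (hρ : ∀ x, 0 ≤ ρ x)
    (hf : ∀ θ ∈ U, ∀ x, 0 < f θ x) (H : DerivBound U 1 ρ f f) :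
    DerivBound U 1 ρ (fun _ _ => 1) (fun θ x => Real.log (f θ x)) := by
  refine ⟨fun x => (H.1 x).log fun θ hθ => (hf θ hθ x).ne', fun K hK hKc n hn => ?_⟩
  choose C hC hb using fun n : ℕ => H.2 K hK hKc (n + 1) (by omega)
  obtain ⟨D, hD, hDb⟩ := exists_pow_bound (fun i => C (i - 1)) (fun i => hC _) n
  obtain ⟨A, hA, hAb⟩ := exists_norm_iteratedFDerivWithin_comp_le (E := E) (φ := Real.log)
    (isOpen_Ioi (a := (0 : ℝ))) hU (fun y hy => (Real.contDiffAt_log.2 hy.ne').contDiffWithinAt) 1 n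
  refine ⟨A * D ^ n, by positivity, fun θ hθ x => ?_⟩
  have hpos := hf θ (hK hθ) x
  have hf' : ContDiffOn ℝ ∞ (fun θ' => (f θ x)⁻¹ * f θ' x) U := contDiffOn_const.mul (H.1 x)
  have hρx := hρ x
  have hmaps : Set.MapsTo (fun θ' => (f θ x)⁻¹ * f θ' x) U (Set.Ioi 0) := fun θ' hθ' =>
    mul_pos (inv_pos.2 hpos) (hf θ' hθ' x)
  have key := hAb (fun θ' => (f θ x)⁻¹ * f θ' x) θ (D * ρ x) hf' hmaps (hK hθ)
    (by simp [hpos.ne']) (fun i hi hin => by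
      have h2 := iteratedFDerivWithin_const_smul_apply (a := (f θ x)⁻¹)
        (((H.1 x).of_le (m := i) (by exact_mod_cast le_top)) θ (hK hθ)) hU.uniqueDiffOn (hK hθ)
      rw [show (fun θ' => (f θ x)⁻¹ * f θ' x) = (f θ x)⁻¹ • (fun θ' => f θ' x) from rfl, h2,
        norm_smul, Real.norm_of_nonneg (inv_pos.2 hpos).le]
      have h1 := hb (i - 1) θ hθ x
      rw [Nat.sub_add_cancel hi] at h1
      simp only [mul_pow]
      calc _ ≤ (f θ x)⁻¹ * (C (i - 1) * ρ x ^ i * f θ x) := by gcongr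
        _ = C (i - 1) * ρ x ^ i := by field_simp
        _ ≤ _ := by gcongr; exact hDb i hi hin)
  have hcomp : Set.EqOn (fun θ' => Real.log (f θ' x))
      (fun θ' => (Real.log ∘ fun θ' => (f θ x)⁻¹ * f θ' x) θ' - (- Real.log (f θ x))) U := by
    intro θ' hθ'
    simp only [Function.comp]
    rw [Real.log_mul (inv_pos.2 hpos).ne' (hf θ' hθ' x).ne', Real.log_inv]
    ring
  have hsm : ContDiffOn ℝ ∞ (Real.log ∘ fun θ' => (f θ x)⁻¹ * f θ' x) U :=
    hf'.log fun θ' hθ' => (hmaps hθ').ne'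
  rw [iteratedFDerivWithin_congr hcomp (hK hθ), fun_iteratedFDerivWithin_sub_apply
    (hsm.of_le (by exact_mod_cast le_top) θ (hK hθ))
        contDiffWithinAt_const hU.uniqueDiffOn (hK hθ),
        iteratedFDerivWithin_const_of_ne (by omega)]
  simp only [Pi.zero_apply, sub_zero]
  calc _ ≤ A * (D * ρ x) ^ n := key
    _ = _ := by rw [mul_pow]; ring

lemma DerivBound.inv {f : E → X → ℝ} (hU : IsOpen U) (hρ : ∀ x, 0 ≤ ρ x)
    (hf : ∀ θ ∈ U, ∀ x, 0 < f θ x) (H : DerivBound U 1 ρ f f) :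
    DerivBound U 0 ρ (fun θ x => (f θ x)⁻¹) (fun θ x => (f θ x)⁻¹) := by
  have H' := ((H.log hU hρ hf).neg hU).exp hU hρ
  have heq : ∀ θ ∈ U, ∀ x, (f θ x)⁻¹ = Real.exp (- Real.log (f θ x)) := fun θ hθ x => by
    rw [Real.exp_neg, Real.exp_log (hf θ hθ x)]
  refine (H'.congr heq).mono_weight hρ fun K hK _ => ⟨1, zero_le_one, fun θ hθ x => ?_⟩
  rw [heq θ (hK hθ) x, one_mul]

end DerivBounds

/-! ### Repeated differentiation under the integral sign -/

section ParametricIntegral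

open scoped ContDiff

variable {E F X : Type*} [NormedAddCommGroup E] [NormedSpace ℝ E]
  [NormedAddCommGroup F] [NormedSpace ℝ F] [MeasurableSpace X]

/-- The derivative in the parameter of a measurable family is measurable. -/
lemma stronglyMeasurable_fderivWithin_param [FiniteDimensional ℝ E] {U : Set E} (hU : IsOpen U)
    {h : E → X → F} (hm : ∀ θ ∈ U, StronglyMeasurable (h θ))
    (hd : ∀ x, DifferentiableOn ℝ (fun θ => h θ x) U) {θ : E} (hθ : θ ∈ U) :
    StronglyMeasurable (fun x => fderivWithin ℝ (fun θ => h θ x) U θ) := by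
  have hdir (v : E) : StronglyMeasurable (fun x => fderivWithin ℝ (fun θ => h θ x) U θ v) := by
    -- Measurability passes to limits of sequences, so the directional derivative is written as a
    -- limit of difference quotients along a sequence of nonzero steps staying in `U`.
    obtain ⟨u, hu0, hu⟩ : ∃ u : ℕ → ℝ, (∀ n, u n ≠ 0 ∧ θ + u n • v ∈ U) ∧
        Tendsto u atTop (𝓝[≠] 0) := by
      have hev : ∀ᶠ t : ℝ in 𝓝[≠] 0, t ≠ 0 ∧ θ + t • v ∈ U := by
        refine (eventually_mem_nhdsWithin).and (nhdsWithin_le_nhds ?_)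
        have : ContinuousAt (fun t : ℝ => θ + t • v) 0 := by fun_prop
        exact this.eventually_mem (by simpa using hU.mem_nhds hθ)
      obtain ⟨u, hu⟩ := exists_seq_tendsto (𝓝[≠] (0 : ℝ))
      obtain ⟨N, hN⟩ := eventually_atTop.1 (hu.eventually hev)
      exact ⟨fun n => u (n + N), fun n => hN _ (by omega), hu.comp (tendsto_add_atTop_nat N)⟩
    refine stronglyMeasurable_of_tendsto (f := fun n x => (u n)⁻¹ • (h (θ + u n • v) x - h θ x))
      atTop (fun n => ((hm _ (hu0 n).2).sub (hm _ hθ)).const_smul _) ?_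
    refine tendsto_pi_nhds.2 fun x => ?_
    have hf : HasFDerivAt (fun θ => h θ x) (fderivWithin ℝ (fun θ => h θ x) U θ) θ :=
      ((hd x θ hθ).hasFDerivWithinAt).hasFDerivAt (hU.mem_nhds hθ)
    have := (hf.hasLineDerivAt v).tendsto_slope_zero
    exact this.comp hu
  let b := Module.finBasis ℝ E
  have heq : (fun x => fderivWithin ℝ (fun θ => h θ x) U θ) = fun x => ∑ i,
      (LinearMap.toContinuousLinearMap (b.coord i)).smulRight
        (fderivWithin ℝ (fun θ => h θ x) U θ (b i)) := by
    ext x v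
    conv_lhs => rw [← b.sum_repr v, map_sum]
    simp
  rw [heq]
  refine Finset.stronglyMeasurable_fun_sum _ fun i _ => ?_
  have hc : Continuous fun y : F => (LinearMap.toContinuousLinearMap (b.coord i)).smulRight y :=
    (ContinuousLinearMap.smulRightL ℝ E F (LinearMap.toContinuousLinearMap (b.coord i))).continuous
  exact hc.comp_stronglyMeasurable (hdir (b i))

lemma stronglyMeasurable_iteratedFDerivWithin_param [FiniteDimensional ℝ E] {U : Set E}
    (hU : IsOpen U) {h : E → X → F} (hm : ∀ θ ∈ U, StronglyMeasurable (h θ))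
    (hd : ∀ x, ContDiffOn ℝ ∞ (fun θ => h θ x) U) (n : ℕ) {θ : E} (hθ : θ ∈ U) :
    StronglyMeasurable (fun x => iteratedFDerivWithin ℝ n (fun θ => h θ x) U θ) := by
  induction n generalizing θ with
  | zero =>
    simp only [iteratedFDerivWithin_zero_eq_comp, Function.comp_def]
    exact (LinearIsometryEquiv.continuous _).comp_stronglyMeasurable (hm θ hθ)
  | succ n ih =>
    simp only [iteratedFDerivWithin_succ_eq_comp_left, Function.comp_def]
    refine (LinearIsometryEquiv.continuous _).comp_stronglyMeasurable ?_
    exact stronglyMeasurable_fderivWithin_param hU (fun θ hθ => ih hθ)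
      (fun x => (hd x).differentiableOn_iteratedFDerivWithin
        (by exact_mod_cast WithTop.coe_lt_top _) hU.uniqueDiffOn) hθ

/-- Repeated differentiation under the integral sign. -/
theorem hasFTaylorSeriesUpToOn_integral [FiniteDimensional ℝ E] {U : Set E} (hU : IsOpen U)
    {μ : Measure X} {h : E → X → F} (hm : ∀ θ ∈ U, StronglyMeasurable (h θ))
    (hd : ∀ x, ContDiffOn ℝ ∞ (fun θ => h θ x) U)
    (hb : ∀ K ⊆ U, IsCompact K → ∀ n : ℕ, ∃ b : X → ℝ, Integrable b μ ∧ ∀ θ ∈ K, ∀ x,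
      ‖iteratedFDerivWithin ℝ n (fun θ => h θ x) U θ‖ ≤ b x) :
    HasFTaylorSeriesUpToOn ∞ (fun θ => ∫ x, h θ x ∂μ)
      (fun θ n => ∫ x, iteratedFDerivWithin ℝ n (fun θ => h θ x) U θ ∂μ) U := by
  have hmeas (n : ℕ) (θ) (hθ : θ ∈ U) := stronglyMeasurable_iteratedFDerivWithin_param hU hm hd n hθ
  have hint (n : ℕ) (θ) (hθ : θ ∈ U) :
      Integrable (fun x => iteratedFDerivWithin ℝ n (fun θ => h θ x) U θ) μ := by
    obtain ⟨b, hbi, hb⟩ := hb {θ} (by simpa using hθ) isCompact_singleton n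
    exact hbi.mono' (hmeas n θ hθ).aestronglyMeasurable (ae_of_all _ fun x => hb θ rfl x)
  refine (hasFTaylorSeriesUpToOn_top_iff' le_rfl).2 ⟨fun θ hθ => ?_, fun n θ hθ => ?_⟩
  · have := (continuousMultilinearCurryFin0 ℝ E F).toContinuousLinearEquiv.integral_comp_comm
      (μ := μ) (fun x => iteratedFDerivWithin ℝ 0 (fun θ => h θ x) U θ)
    exact this.symm
  -- A closed ball is a compact neighbourhood, so a single integrable function dominates the
  -- derivatives of order `n + 1` near `θ`.
  · obtain ⟨r, hr, hrU⟩ := Metric.nhds_basis_closedBall.mem_iff.1 (hU.mem_nhds hθ)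
    obtain ⟨b, hbi, hb⟩ := hb _ hrU (isCompact_closedBall θ r) (n + 1)
    have hdiff (x : X) := (hd x).differentiableOn_iteratedFDerivWithin (m := n)
        (by exact_mod_cast WithTop.coe_lt_top _) hU.uniqueDiffOn
    have key := hasFDerivAt_integral_of_dominated_of_fderiv_le (μ := μ) (𝕜 := ℝ) (x₀ := θ)
      (F := fun θ x => iteratedFDerivWithin ℝ n (fun θ => h θ x) U θ)
      (F' := fun θ x => fderivWithin ℝ (iteratedFDerivWithin ℝ n (fun θ => h θ x) U) U θ)
      (bound := b)
      (Metric.closedBall_mem_nhds θ hr)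
      (eventually_of_mem (hU.mem_nhds hθ) fun θ hθ => (hmeas n θ hθ).aestronglyMeasurable)
      (hint n θ hθ)
      (stronglyMeasurable_fderivWithin_param hU (hmeas n) hdiff hθ).aestronglyMeasurable
      (ae_of_all _ fun x θ' hθ' => by
        rw [norm_fderivWithin_iteratedFDerivWithin]
        exact hb θ' hθ' x) hbi
      (ae_of_all _ fun x θ' hθ' =>
        (hdiff x θ' (hrU hθ')).hasFDerivWithinAt.hasFDerivAt (hU.mem_nhds (hrU hθ')))
    let I : (E [×(n + 1)]→L[ℝ] F) ≃L[ℝ] (E →L[ℝ] E [×n]→L[ℝ] F) :=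
      (continuousMultilinearCurryLeftEquiv ℝ (fun _ : Fin (n + 1) => E) F).toContinuousLinearEquiv
    have heq := ContinuousLinearEquiv.integral_comp_comm (𝕜 := ℝ)
      (E := E [×(n + 1)]→L[ℝ] F) (F := E →L[ℝ] E [×n]→L[ℝ] F) I (μ := μ) (fun x => iteratedFDerivWithin ℝ (n + 1) (fun θ => h θ x) U θ)
    refine (key.congr_fderiv ?_).hasFDerivWithinAt
    exact heq

end ParametricIntegral

/-! ### Derivative bounds for parametric integrals -/

section ParametricIntegral

open scoped ContDiff

variable {E X Y : Type*} [NormedAddCommGroup E] [NormedSpace ℝ E] [MeasurableSpace X]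

lemma iteratedFDerivWithin_integral [FiniteDimensional ℝ E] {U : Set E} (hU : IsOpen U) {μ : Measure X} {h : E → X → ℝ}
    (hm : ∀ θ ∈ U, StronglyMeasurable (h θ)) (hd : ∀ x, ContDiffOn ℝ ∞ (fun θ => h θ x) U)
    (hb : ∀ K ⊆ U, IsCompact K → ∀ n : ℕ, ∃ b : X → ℝ, Integrable b μ ∧ ∀ θ ∈ K, ∀ x,
      ‖iteratedFDerivWithin ℝ n (fun θ => h θ x) U θ‖ ≤ b x) (n : ℕ) {θ : E} (hθ : θ ∈ U) :
    iteratedFDerivWithin ℝ n (fun θ => ∫ x, h θ x ∂μ) U θ =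
      ∫ x, iteratedFDerivWithin ℝ n (fun θ => h θ x) U θ ∂μ :=
  ((hasFTaylorSeriesUpToOn_integral hU hm hd hb).eq_iteratedFDerivWithin_of_uniqueDiffOn
    (by exact_mod_cast le_top) hU.uniqueDiffOn hθ).symm

lemma DerivBound.exists_integrable_bound {U : Set E} {μ : Measure X} {h : E → X → ℝ}
    {ρ : X → ℝ} {w : E → X → ℝ} (H : DerivBound U 0 ρ w h)
    (hb : ∀ K ⊆ U, IsCompact K → ∀ n : ℕ, ∃ b : X → ℝ, Integrable b μ ∧
      ∀ θ ∈ K, ∀ x, ρ x ^ n * w θ x ≤ b x) :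
    ∀ K ⊆ U, IsCompact K → ∀ n : ℕ, ∃ b : X → ℝ, Integrable b μ ∧ ∀ θ ∈ K, ∀ x,
      ‖iteratedFDerivWithin ℝ n (fun θ => h θ x) U θ‖ ≤ b x := by
  intro K hK hKc n
  obtain ⟨b, hbi, hb⟩ := hb K hK hKc n
  obtain ⟨C, hC, hCb⟩ := H.2 K hK hKc n (Nat.zero_le n)
  refine ⟨fun x => C * b x, hbi.const_mul C, fun θ hθ x => (hCb θ hθ x).trans ?_⟩
  rw [mul_assoc]
  exact mul_le_mul_of_nonneg_left (hb θ hθ x) hC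

/-- Derivative bounds pass to integrals over a family of sets. -/
lemma DerivBound.setIntegral [FiniteDimensional ℝ E] {U : Set E} (hU : IsOpen U) {μ : Measure X} {h : E → X → ℝ}
    {ρ : X → ℝ} {w : E → X → ℝ} {σ : Y → ℝ} {W : E → Y → ℝ} {S : Y → Set X}
    (H : DerivBound U 0 ρ w h) (hm : ∀ θ ∈ U, StronglyMeasurable (h θ))
    (hint : ∀ θ ∈ U, ∀ n : ℕ, Integrable (fun x => ρ x ^ n * w θ x) μ)
    (hb : ∀ K ⊆ U, IsCompact K → ∀ n : ℕ, ∃ b : X → ℝ, Integrable b μ ∧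
      ∀ θ ∈ K, ∀ x, ρ x ^ n * w θ x ≤ b x)
    (hS : ∀ K ⊆ U, IsCompact K → ∀ n : ℕ, ∃ C, 0 ≤ C ∧
      ∀ θ ∈ K, ∀ y, ∫ x in S y, ρ x ^ n * w θ x ∂μ ≤ C * (σ y ^ n * W θ y)) :
    DerivBound U 0 σ W (fun θ y => ∫ x in S y, h θ x ∂μ) := by
  have hb' (y : Y) := H.exists_integrable_bound (μ := μ.restrict (S y)) fun K hK hKc n => by
    obtain ⟨b, hbi, hb⟩ := hb K hK hKc n
    exact ⟨b, hbi.integrableOn, hb⟩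
  refine ⟨fun y => (hasFTaylorSeriesUpToOn_integral hU hm H.1 (hb' y)).contDiffOn,
    fun K hK hKc n _ => ?_⟩
  obtain ⟨C, hC, hCb⟩ := H.2 K hK hKc n (Nat.zero_le n)
  obtain ⟨C', hC', hSb⟩ := hS K hK hKc n
  refine ⟨C * C', by positivity, fun θ hθ y => ?_⟩
  rw [iteratedFDerivWithin_integral hU hm H.1 (hb' y) n (hK hθ)]
  refine (norm_integral_le_of_norm_le (g := fun x => C * (ρ x ^ n * w θ x))
    (((hint θ (hK hθ) n).integrableOn).const_mul C)
    (ae_of_all _ fun x => (hCb θ hθ x).trans_eq (by ring))).trans ?_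
  rw [integral_const_mul]
  calc _ ≤ C * (C' * (σ y ^ n * W θ y)) := mul_le_mul_of_nonneg_left (hSb θ hθ y) hC
    _ = _ := by ring

end ParametricIntegral

/-! ### Student's density: normalisation and kernel -/

section StudentT

open scoped ContDiff

/-- The complex Gamma function is holomorphic on the right half-plane, hence smooth, and the real
one is its restriction. -/
lemma Real.contDiffOn_Gamma_Ioi : ContDiffOn ℝ ∞ Real.Gamma (Set.Ioi 0) := by
  intro s hs
  have hopen : IsOpen {z : ℂ | 0 < z.re} := isOpen_lt continuous_const Complex.continuous_re
  have hd : DifferentiableOn ℂ Complex.Gamma {z : ℂ | 0 < z.re} := fun z hz =>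
    (Complex.differentiableAt_Gamma z fun m h => by
      have h' : 0 < z.re := hz
      rw [h] at h'
      have : (0 : ℝ) ≤ m := m.cast_nonneg
      simp at h'
      linarith).differentiableWithinAt
  have hc : ContDiffAt ℂ ∞ Complex.Gamma (s : ℂ) :=
    (hd.analyticOnNhd hopen (s : ℂ) (by simpa using hs)).contDiffAt
  have := hc.real_of_complex
  simpa [Complex.Gamma_ofReal] using this.contDiffWithinAt

lemma isOpen_admissibleParams : IsOpen admissibleParams := by
  have h (i : Fin 4) : Continuous fun θ : ParamVec => θ i := by fun_prop
  exact (isOpen_lt continuous_const (h 1)).inter ((isOpen_lt continuous_const (h 2)).inter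
    ((isOpen_lt continuous_const (h 3)).inter (isOpen_lt (h 3) continuous_const)))

lemma exists_param_bounds {K : Set ParamVec} (hK : K ⊆ admissibleParams) (hKc : IsCompact K) :
    ∃ B : ℝ, 1 ≤ B ∧ ∀ θ ∈ K, |θ 0| ≤ B ∧ θ 1 ≤ B ∧ B⁻¹ ≤ θ 1 ∧ θ 2 ≤ B ∧ B⁻¹ ≤ θ 3 ∧
      B⁻¹ ≤ 1 - θ 3 := by
  have key (φ : ParamVec → ℝ) (hφ : ContinuousOn φ K) : ∃ C, 0 ≤ C ∧ ∀ θ ∈ K, |φ θ| ≤ C := by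
    obtain ⟨C, hC⟩ := hKc.exists_bound_of_continuousOn hφ
    exact ⟨max C 0, le_max_right _ _, fun θ hθ => (hC θ hθ).trans (le_max_left _ _)⟩
  have h (i : Fin 4) : Continuous fun θ : ParamVec => θ i := by fun_prop
  obtain ⟨C0, h0, b0⟩ := key (fun θ => θ 0) (h 0).continuousOn
  obtain ⟨C1, h1, b1⟩ := key (fun θ => θ 1) (h 1).continuousOn
  obtain ⟨C2, h2, b2⟩ := key (fun θ => θ 2) (h 2).continuousOn
  obtain ⟨C3, h3, b3⟩ := key (fun θ => (θ 1)⁻¹) ((h 1).continuousOn.inv₀ fun θ hθ => (hK hθ).1.ne')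
  obtain ⟨C4, h4, b4⟩ := key (fun θ => (θ 3)⁻¹)
    ((h 3).continuousOn.inv₀ fun θ hθ => (hK hθ).2.2.1.ne')
  obtain ⟨C5, h5, b5⟩ := key (fun θ => (1 - θ 3)⁻¹)
    ((continuous_const.sub (h 3)).continuousOn.inv₀ fun θ hθ => (sub_pos.2 (hK hθ).2.2.2).ne')
  have inv (y C : ℝ) (hy : 0 < y) (hC : 0 ≤ C) (hb : |y⁻¹| ≤ C) :
      (1 + C0 + C1 + C2 + C3 + C4 + C5)⁻¹ ≤ y ∨ 1 + C0 + C1 + C2 + C3 + C4 + C5 < C := by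
    by_contra! hcon
    have : y⁻¹ ≤ C := (le_abs_self _).trans hb
    have h6 := inv_anti₀ (inv_pos.2 hy) (this.trans hcon.2)
    rw [inv_inv] at h6
    linarith [hcon.1]
  refine ⟨1 + C0 + C1 + C2 + C3 + C4 + C5, by linarith, fun θ hθ => ⟨?_, ?_, ?_, ?_, ?_, ?_⟩⟩
  · linarith [b0 θ hθ]
  · linarith [b1 θ hθ, le_abs_self (θ 1)]
  · rcases inv _ _ (hK hθ).1 h3 (b3 θ hθ) with h | h <;> linarith
  · linarith [b2 θ hθ, le_abs_self (θ 2)]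
  · rcases inv _ _ (hK hθ).2.2.1 h4 (b4 θ hθ) with h | h <;> linarith
  · rcases inv _ _ (sub_pos.2 (hK hθ).2.2.2) h5 (b5 θ hθ) with h | h <;> linarith

/-- The slowly growing function `1 + log (1 + |x|)`. -/
noncomputable def logGrowth (x : ℝ) : ℝ := 1 + Real.log (1 + |x|)

lemma one_le_logGrowth (x : ℝ) : 1 ≤ logGrowth x := by
  have := Real.log_nonneg (le_add_of_nonneg_right (abs_nonneg x) : (1 : ℝ) ≤ 1 + |x|)
  unfold logGrowth; linarith

lemma logGrowth_nonneg (x : ℝ) : 0 ≤ logGrowth x := zero_le_one.trans (one_le_logGrowth x)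

lemma logGrowth_neg (x : ℝ) : logGrowth (-x) = logGrowth x := by simp [logGrowth]

lemma continuous_logGrowth : Continuous logGrowth := by
  unfold logGrowth
  exact continuous_const.add ((by fun_prop : Continuous fun x : ℝ => 1 + |x|).log
    fun x => by positivity)

/-- The integral of the kernel of Student's t density. -/
lemma integral_one_add_sq_div_rpow {a p m : ℝ} (ha : 0 < a) (hp : 1 / 2 < p) :
    ∫ x : ℝ, (1 + (x - m) ^ 2 / a) ^ (-p) = √(Real.pi * a) * Real.Gamma (p - 1 / 2) / Real.Gamma p := by
  have hp0 : 0 < p := by linarith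
  have hG := Real.Gamma_pos_of_pos hp0
  have hG' : 0 < Real.Gamma (p - 1 / 2) := Real.Gamma_pos_of_pos (by linarith)
  rw [integral_sub_right_eq_self (fun x : ℝ => (1 + x ^ 2 / a) ^ (-p)) m]
  have hpos (x : ℝ) : 0 < 1 + x ^ 2 / a := by positivity
  have hgam (b q : ℝ) (hb : 0 < b) (hq : 0 < q) :
      ∫⁻ s in Set.Ioi (0 : ℝ), ENNReal.ofReal (s ^ (q - 1) * Real.exp (-(b * s))) =
        ENNReal.ofReal ((1 / b) ^ q * Real.Gamma q) := by
    rw [← Real.integral_rpow_mul_exp_neg_mul_Ioi hq hb, ofReal_integral_eq_lintegral_ofReal]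
    · refine Integrable.of_integral_ne_zero ?_
      rw [Real.integral_rpow_mul_exp_neg_mul_Ioi hq hb]
      have := Real.Gamma_pos_of_pos hq
      positivity
    · refine (ae_restrict_iff' measurableSet_Ioi).2 (ae_of_all _ fun s hs => ?_)
      have : 0 < s := hs
      simp only [Pi.zero_apply]; positivity
  have hgauss (s : ℝ) (hs : 0 < s) : ∫⁻ x : ℝ, ENNReal.ofReal (Real.exp (-(s / a) * x ^ 2)) =
      ENNReal.ofReal (√(Real.pi * a) * s ^ (-(1 / 2) : ℝ)) := by
    rw [← ofReal_integral_eq_lintegral_ofReal (integrable_exp_neg_mul_sq (by positivity))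
      (ae_of_all _ fun x => (Real.exp_pos _).le), integral_gaussian]
    congr 1
    rw [show Real.pi / (s / a) = (Real.pi * a) * s⁻¹ by field_simp, Real.sqrt_mul (by positivity),
      Real.rpow_neg hs.le, ← Real.sqrt_eq_rpow, Real.sqrt_inv]
  -- Gamma mixture of Gaussians: $\Gamma(p)(1+x^2/a)^{-p}=\int_0^\infty s^{p-1}e^{-(1+x^2/a)s}\,ds$.
  -- Tonelli allows integrating in $x$ first, which is Gaussian and contributes $\sqrt{\pi
  -- a}\,s^{-1/2}$. Lower integrals avoid any prior integrability.
  have hkey : ∫⁻ x : ℝ, ENNReal.ofReal ((1 + x ^ 2 / a) ^ (-p) * Real.Gamma p) =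
      ENNReal.ofReal (√(Real.pi * a) * Real.Gamma (p - 1 / 2)) := by
    have h1 (x : ℝ) : ENNReal.ofReal ((1 + x ^ 2 / a) ^ (-p) * Real.Gamma p) =
        ∫⁻ s in Set.Ioi (0 : ℝ), ENNReal.ofReal (s ^ (p - 1) * Real.exp (-((1 + x ^ 2 / a) * s))) := by
      rw [hgam _ _ (hpos x) hp0, one_div, Real.inv_rpow (hpos x).le, Real.rpow_neg (hpos x).le]
    simp_rw [h1]
    rw [lintegral_lintegral_swap (by
      refine Measurable.aemeasurable ?_
      unfold Function.uncurry
      fun_prop)]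
    have h2 : ∀ s ∈ Set.Ioi (0 : ℝ),
        ∫⁻ x : ℝ, ENNReal.ofReal (s ^ (p - 1) * Real.exp (-((1 + x ^ 2 / a) * s))) =
        ENNReal.ofReal √(Real.pi * a) *
          ENNReal.ofReal (s ^ (p - 1 / 2 - 1) * Real.exp (-(1 * s))) := by
      intro s hs
      have hs : 0 < s := hs
      have h3 (x : ℝ) : s ^ (p - 1) * Real.exp (-((1 + x ^ 2 / a) * s)) =
          (s ^ (p - 1) * Real.exp (-(1 * s))) * Real.exp (-(s / a) * x ^ 2) := by
        rw [mul_assoc, ← Real.exp_add]; congr 2; field_simp; ring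
      simp_rw [h3]
      have h4 : 0 ≤ s ^ (p - 1) * Real.exp (-(1 * s)) := by positivity
      simp_rw [ENNReal.ofReal_mul h4]
      rw [lintegral_const_mul _ (by fun_prop), hgauss s hs, ← ENNReal.ofReal_mul h4,
        ← ENNReal.ofReal_mul (by positivity)]
      congr 1
      rw [show p - 1 / 2 - 1 = (p - 1) + (-(1 / 2)) by ring, Real.rpow_add hs]
      ring
    rw [setLIntegral_congr_fun measurableSet_Ioi h2, lintegral_const_mul _ (by fun_prop),
      hgam 1 _ one_pos (by linarith), ← ENNReal.ofReal_mul (by positivity)]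
    simp
  have hint : ∫ x : ℝ, (1 + x ^ 2 / a) ^ (-p) * Real.Gamma p = √(Real.pi * a) * Real.Gamma (p - 1 / 2) := by
    rw [integral_eq_lintegral_of_nonneg_ae (ae_of_all _ fun x => by
      have := hpos x; simp only [Pi.zero_apply]; positivity)
      (Measurable.aestronglyMeasurable (by fun_prop)), hkey, ENNReal.toReal_ofReal (by positivity)]
  rw [integral_mul_const] at hint
  rw [eq_div_iff hG.ne', hint]

/-- Student's t density with parameters collected in a vector. -/
noncomputable def tDensity (θ : ParamVec) (x : ℝ) : ℝ := studentTPDF (θ 2) (θ 0) (θ 1) x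

lemma tDensity_pos {θ : ParamVec} (hθ : θ ∈ admissibleParams) (x : ℝ) : 0 < tDensity θ x := by
  obtain ⟨h1, h2, -⟩ := hθ
  have h2' : 0 < θ 2 := by linarith
  have := Real.Gamma_pos_of_pos (by linarith : 0 < (θ 2 + 1) / 2)
  have := Real.Gamma_pos_of_pos (by linarith : 0 < θ 2 / 2)
  have := Real.pi_pos
  unfold tDensity studentTPDF
  positivity

lemma integral_tDensity {θ : ParamVec} (hθ : θ ∈ admissibleParams) : ∫ x, tDensity θ x = 1 := by
  obtain ⟨h1, h2, -⟩ := hθ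
  have h2' : 0 < θ 2 := by linarith
  have hA := Real.Gamma_pos_of_pos (by linarith : 0 < (θ 2 + 1) / 2)
  have hB := Real.Gamma_pos_of_pos (by linarith : 0 < θ 2 / 2)
  have := Real.pi_pos
  unfold tDensity studentTPDF
  rw [integral_const_mul, integral_one_add_sq_div_rpow (by positivity) (by linarith)]
  rw [show (θ 2 + 1) / 2 - 1 / 2 = θ 2 / 2 by ring,
    show Real.pi * (θ 2 * θ 1 ^ 2) = (θ 2 * Real.pi) * θ 1 ^ 2 by ring,
    Real.sqrt_mul (x := θ 2 * Real.pi) (by positivity), Real.sqrt_sq h1.le]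
  field_simp

lemma continuous_tDensity {θ : ParamVec} (hθ : θ ∈ admissibleParams) : Continuous (tDensity θ) := by
  obtain ⟨h1, h2, -⟩ := hθ
  have h2' : 0 < θ 2 := by linarith
  unfold tDensity studentTPDF
  refine continuous_const.mul (Continuous.rpow_const (by fun_prop) fun x => Or.inl ?_)
  positivity

/-- The Bochner integral of a non-integrable function is $0$ by convention, so the value $1$ already
forces integrability. -/
lemma integrable_tDensity {θ : ParamVec} (hθ : θ ∈ admissibleParams) : Integrable (tDensity θ) :=
  Integrable.of_integral_ne_zero (by rw [integral_tDensity hθ]; exact one_ne_zero)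

/-- The kernel `1 + (x - μ)² / (ν σ²)`. -/
noncomputable def tKernel (θ : ParamVec) (x : ℝ) : ℝ := 1 + (x - θ 0) ^ 2 / (θ 2 * θ 1 ^ 2)

/-- The logarithm of the normalising constant of Student's t density. -/
noncomputable def tLogConst (θ : ParamVec) : ℝ :=
  Real.log (Real.Gamma ((θ 2 + 1) / 2)) - Real.log (Real.Gamma (θ 2 / 2))
    - Real.log (θ 2 * Real.pi) / 2 - Real.log (θ 1)

lemma one_le_tKernel {θ : ParamVec} (hθ : θ ∈ admissibleParams) (x : ℝ) : 1 ≤ tKernel θ x := by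
  obtain ⟨h1, h2, -⟩ := hθ
  have h2' : 0 < θ 2 := by linarith
  have : 0 ≤ (x - θ 0) ^ 2 / (θ 2 * θ 1 ^ 2) := by positivity
  unfold tKernel
  linarith

lemma log_tDensity {θ : ParamVec} (hθ : θ ∈ admissibleParams) (x : ℝ) :
    Real.log (tDensity θ x) = tLogConst θ - (θ 2 + 1) / 2 * Real.log (tKernel θ x) := by
  have hk := one_le_tKernel hθ x
  obtain ⟨h1, h2, -⟩ := hθ
  have h2' : 0 < θ 2 := by linarith
  have hA := Real.Gamma_pos_of_pos (by linarith : 0 < (θ 2 + 1) / 2)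
  have hB := Real.Gamma_pos_of_pos (by linarith : 0 < θ 2 / 2)
  have := Real.pi_pos
  unfold tDensity studentTPDF
  change Real.log (_ * tKernel θ x ^ _) = _
  have hs : √(θ 2 * Real.pi) ≠ 0 := by positivity
  rw [Real.log_mul (by positivity) (by positivity), Real.log_div hA.ne' (by positivity),
    Real.log_mul (by positivity) h1.ne', Real.log_mul hB.ne' hs, Real.log_rpow (by linarith),
    Real.log_sqrt (by positivity)]
  unfold tLogConst
  ring

/-- The kernel is comparable with $(1+|x|)^2$ uniformly on compact parameter sets; the logarithmic
form serves for upper and lower bounds alike. -/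
lemma exists_abs_log_tKernel_sub_le {K : Set ParamVec} (hK : K ⊆ admissibleParams)
    (hKc : IsCompact K) :
    ∃ C, 0 ≤ C ∧ ∀ θ ∈ K, ∀ x, |Real.log (tKernel θ x) - 2 * Real.log (1 + |x|)| ≤ C := by
  obtain ⟨B, hB, hBd⟩ := exists_param_bounds hK hKc
  -- Dictated by the lower comparison $(1+|x|)^2\le 2+2x^2\le 2+4(x-\mu)^2+4B^2$ with $(x-\mu)^2\le
  -- B^4(k-1)$, where $k$ is the kernel; it also covers the upper one.
  set A : ℝ := 2 + 4 * B ^ 2 + 4 * B ^ 4 with hA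
  have hA1 : 1 ≤ A := by nlinarith [sq_nonneg B, sq_nonneg (B ^ 2)]
  refine ⟨Real.log A, Real.log_nonneg hA1, fun θ hθ x => ?_⟩
  have hk := one_le_tKernel (hK hθ) x
  obtain ⟨b0, b1, b1', b2, -⟩ := hBd θ hθ
  obtain ⟨h1, h2, -⟩ := hK hθ
  have h2' : 0 < θ 2 := by linarith
  have hs : 0 < θ 2 * θ 1 ^ 2 := by positivity
  have hx : 0 < 1 + |x| := by positivity
  have b0' : θ 0 ^ 2 ≤ B ^ 2 := sq_le_sq' (by linarith [(abs_le.1 b0).1]) (abs_le.1 b0).2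
  have hsU : θ 2 * θ 1 ^ 2 ≤ B ^ 4 := by
    calc θ 2 * θ 1 ^ 2 ≤ B * B ^ 2 := by gcongr
      _ = B ^ 3 := by ring
      _ ≤ B ^ 4 := pow_le_pow_right₀ hB (by norm_num)
  have hsL : 1 / B ^ 2 ≤ θ 2 * θ 1 ^ 2 := by
    calc 1 / B ^ 2 = 1 * (B⁻¹) ^ 2 := by rw [one_mul, inv_pow, one_div]
      _ ≤ θ 2 * θ 1 ^ 2 := by gcongr; linarith
  have hq : (x - θ 0) ^ 2 / (θ 2 * θ 1 ^ 2) ≤ (x - θ 0) ^ 2 * B ^ 2 := by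
    rw [div_le_iff₀ hs, mul_assoc]
    have : 1 ≤ B ^ 2 * (θ 2 * θ 1 ^ 2) := by
      rw [div_le_iff₀ (by positivity)] at hsL; linarith
    nlinarith [sq_nonneg (x - θ 0)]
  have hup : tKernel θ x ≤ A * (1 + |x|) ^ 2 := by
    have hx2 : x ^ 2 ≤ (1 + |x|) ^ 2 := by rw [← sq_abs]; gcongr; linarith
    have h1x : 1 ≤ (1 + |x|) ^ 2 := one_le_pow₀ (by linarith [abs_nonneg x])
    have hm : (x - θ 0) ^ 2 ≤ 2 * x ^ 2 + 2 * B ^ 2 := by nlinarith [sq_nonneg (x + θ 0)]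
    have hB2 : 1 ≤ B ^ 2 := one_le_pow₀ hB
    calc tKernel θ x ≤ 1 + (2 * x ^ 2 + 2 * B ^ 2) * B ^ 2 := by
          unfold tKernel; nlinarith
      _ ≤ (1 + |x|) ^ 2 + (2 * (1 + |x|) ^ 2 + 2 * B ^ 2 * (1 + |x|) ^ 2) * B ^ 2 := by
          have : 2 * B ^ 2 ≤ 2 * B ^ 2 * (1 + |x|) ^ 2 := le_mul_of_one_le_right (by positivity) h1x
          gcongr
      _ ≤ A * (1 + |x|) ^ 2 := by rw [hA]; nlinarith [sq_nonneg (B ^ 2), mul_nonneg (sq_nonneg B) (sq_nonneg (1 + |x|)), mul_nonneg (sq_nonneg (B ^ 2)) (sq_nonneg (1 + |x|))]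
  have hlow : (1 + |x|) ^ 2 ≤ A * tKernel θ x := by
    have hz : (x - θ 0) ^ 2 ≤ B ^ 4 * (tKernel θ x - 1) := by
      have : (x - θ 0) ^ 2 = (θ 2 * θ 1 ^ 2) * (tKernel θ x - 1) := by
        unfold tKernel; field_simp; ring
      rw [this]
      exact mul_le_mul_of_nonneg_right hsU (by linarith)
    have hxx : (1 + |x|) ^ 2 ≤ 2 + 2 * x ^ 2 := by
      rw [← sq_abs x]; nlinarith [sq_nonneg (1 - |x|)]
    have hm : x ^ 2 ≤ 2 * (x - θ 0) ^ 2 + 2 * B ^ 2 := by nlinarith [sq_nonneg (x - 2 * θ 0)]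
    nlinarith [sq_nonneg B, sq_nonneg (B ^ 2), mul_nonneg (sq_nonneg B) (by linarith : 0 ≤ tKernel θ x - 1)]
  have hk0 : 0 < tKernel θ x := by linarith
  have e1 := Real.log_le_log hk0 hup
  have e2 := Real.log_le_log (by positivity) hlow
  rw [Real.log_mul (by positivity) (by positivity), Real.log_pow] at e1
  rw [Real.log_mul (by positivity) (by positivity), Real.log_pow] at e2
  push_cast at e1 e2
  rw [abs_le]; constructor <;> linarith

end StudentT

/-! ### Parameter derivatives and power bounds of Student's density -/

section StudentTBounds

open scoped ContDiff

lemma exists_abs_le_of_continuousOn {K : Set ParamVec} (hKc : IsCompact K) {φ : ParamVec → ℝ}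
    (hφ : ContinuousOn φ K) : ∃ C, 0 ≤ C ∧ ∀ θ ∈ K, |φ θ| ≤ C := by
  obtain ⟨C, hC⟩ := hKc.exists_bound_of_continuousOn hφ
  exact ⟨max C 0, le_max_right _ _, fun θ hθ => (hC θ hθ).trans (le_max_left _ _)⟩

lemma contDiffOn_coord (i : Fin 4) (s : Set ParamVec) : ContDiffOn ℝ ∞ (fun θ : ParamVec => θ i) s :=
  (by fun_prop : ContDiff ℝ ∞ fun θ : ParamVec => θ i).contDiffOn

lemma contDiffOn_tLogConst : ContDiffOn ℝ ∞ tLogConst admissibleParams := by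
  have h1 (θ : ParamVec) (hθ : θ ∈ admissibleParams) : 0 < θ 1 := hθ.1
  have h2 (θ : ParamVec) (hθ : θ ∈ admissibleParams) : 0 < θ 2 := by linarith [hθ.2.1]
  have c2 := contDiffOn_coord 2 admissibleParams
  have hG (g : ParamVec → ℝ) (hg : ContDiffOn ℝ ∞ g admissibleParams)
      (hpos : ∀ θ ∈ admissibleParams, 0 < g θ) :
      ContDiffOn ℝ ∞ (fun θ => Real.log (Real.Gamma (g θ))) admissibleParams :=
    (Real.contDiffOn_Gamma_Ioi.comp hg hpos).log fun θ hθ =>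
      (Real.Gamma_pos_of_pos (hpos θ hθ)).ne'
  refine (((hG _ ((c2.add contDiffOn_const).div_const 2) fun θ hθ => ?_).sub
    (hG _ (c2.div_const 2) fun θ hθ => ?_)).sub
    (((c2.mul contDiffOn_const).log fun θ hθ => ?_).div_const 2)).sub
    ((contDiffOn_coord 1 _).log fun θ hθ => (h1 θ hθ).ne')
  · have := h2 θ hθ; positivity
  · have := h2 θ hθ; positivity
  · have := h2 θ hθ; have := Real.pi_pos; positivity

lemma derivBound_const_param {X : Type*} (c : X → ℝ) (U : Set ParamVec) :
    DerivBound U 0 (fun _ => 1) (fun _ x => |c x|) (fun (_ : ParamVec) x => c x) := by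
  refine ⟨fun x => contDiffOn_const, fun K _ _ n _ => ⟨1, zero_le_one, fun θ _ x => ?_⟩⟩
  rcases Nat.eq_zero_or_pos n with rfl | hn
  · simp
  · rw [iteratedFDerivWithin_const_of_ne (by omega)]; simp

/-- The kernel is a quadratic polynomial in `x` with coefficients smooth in the parameters, so each
derivative is $O((1+|x|)^2)$, which is again comparable with the kernel. -/
lemma derivBound_tKernel :
    DerivBound admissibleParams 0 (fun _ => 1) tKernel tKernel := by
  have hU := isOpen_admissibleParams
  have h1 (θ : ParamVec) (hθ : θ ∈ admissibleParams) : 0 < θ 1 := hθ.1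
  have h2 (θ : ParamVec) (hθ : θ ∈ admissibleParams) : 0 < θ 2 := by linarith [hθ.2.1]
  have ha : ContDiffOn ℝ ∞ (fun θ : ParamVec => (θ 2 * θ 1 ^ 2)⁻¹) admissibleParams :=
    (((contDiffOn_coord 2 _).mul ((contDiffOn_coord 1 _).pow 2))).inv fun θ hθ => by
      have := h1 θ hθ; have := h2 θ hθ; positivity
  have c0 := contDiffOn_coord 0 admissibleParams
  have key (c : ℝ → ℝ) (hc : ∀ x, |c x| ≤ (1 + |x|) ^ 2) (φ : ParamVec → ℝ)
      (hφ : ContDiffOn ℝ ∞ φ admissibleParams) :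
      DerivBound admissibleParams 0 (fun _ => 1) (fun _ x => (1 + |x|) ^ 2)
        (fun θ x => c x * φ θ) := by
    refine ((derivBound_const_param c _).mul hU (DerivBound.of_contDiffOn hU hφ)).mono_weight
      (fun _ => zero_le_one) fun K _ _ => ⟨1, zero_le_one, fun θ _ x => ?_⟩
    rw [mul_one, one_mul]; exact hc x
  have hsum := ((key (fun x => x ^ 2) (fun x => by
      rw [abs_of_nonneg (sq_nonneg x), ← sq_abs]; gcongr; linarith) _ ha).add hU
    (key (fun x => x) (fun x => by nlinarith [abs_nonneg x]) _
      ((contDiffOn_const (c := (-2 : ℝ))).mul (c0.mul ha)))).add hU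
    (key (fun x => 1) (fun x => by simp only [abs_one]; nlinarith [abs_nonneg x]) _
      ((contDiffOn_const (c := (1 : ℝ))).add ((c0.pow 2).mul ha)))
  refine (hsum.congr fun θ hθ x => ?_).mono_weight (fun _ => zero_le_one) fun K hK hKc => ?_
  · unfold tKernel; field_simp; ring
  · obtain ⟨C, hC, hb⟩ := exists_abs_log_tKernel_sub_le hK hKc
    refine ⟨Real.exp C, (Real.exp_pos _).le, fun θ hθ x => ?_⟩
    have hk : 0 < tKernel θ x := zero_lt_one.trans_le (one_le_tKernel (hK hθ) x)
    have h := (abs_le.1 (hb θ hθ x)).1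
    have hx : 0 < 1 + |x| := by positivity
    rw [← Real.log_le_log_iff (by positivity) (by positivity), Real.log_mul (by positivity) hk.ne',
      Real.log_exp, Real.log_pow]
    push_cast
    linarith

/-- Positive derivatives of the log-kernel are bounded, since those of the kernel are bounded
relative to it. The logarithmic weight comes from order zero and from the product with $(\nu+1)/2$,
whose derivative leaves the log-kernel undifferentiated. -/
lemma derivBound_one_log_tDensity_aux :
    DerivBound admissibleParams 0 (fun _ => 1) (fun _ x => logGrowth x)
      (fun θ x => Real.log (tDensity θ x)) := by
  have hU := isOpen_admissibleParams
  have hw : ∀ K ⊆ admissibleParams, IsCompact K →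
      ∃ C, 0 ≤ C ∧ ∀ θ ∈ K, ∀ x, (1 : ℝ) ≤ C * logGrowth x := fun K _ _ =>
    ⟨1, zero_le_one, fun θ _ x => by rw [one_mul]; exact one_le_logGrowth x⟩
  have hlog : DerivBound admissibleParams 0 (fun _ => 1) (fun _ x => logGrowth x)
      (fun θ x => Real.log (tKernel θ x)) := by
    refine DerivBound.of_succ (((derivBound_tKernel.of_le zero_le_one).log hU
      (fun _ => zero_le_one) fun θ hθ x => zero_lt_one.trans_le (one_le_tKernel hθ x)).mono_weight
      (fun _ => zero_le_one) hw) fun K hK hKc => ?_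
    obtain ⟨C, hC, hb⟩ := exists_abs_log_tKernel_sub_le hK hKc
    refine ⟨C + 2, by positivity, fun θ hθ x => ?_⟩
    have h1 := abs_le.1 (hb θ hθ x)
    have h2 := one_le_logGrowth x
    have h3 : Real.log (1 + |x|) = logGrowth x - 1 := by unfold logGrowth; ring
    rw [Real.norm_eq_abs, abs_le]
    constructor <;> nlinarith [h1.1, h1.2]
  have hA : DerivBound admissibleParams 0 (fun _ => 1) (fun _ x => logGrowth x)
      (fun θ (_ : ℝ) => tLogConst θ) :=
    (DerivBound.of_contDiffOn hU contDiffOn_tLogConst).mono_weight (fun _ => zero_le_one) hw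
  have hB := (DerivBound.of_contDiffOn (X := ℝ) hU
    (((contDiffOn_coord 2 admissibleParams).add (contDiffOn_const (c := (1 : ℝ)))).div_const 2)).mul
      hU hlog
  simp only [one_mul] at hB
  exact (hA.sub hU hB).congr fun θ hθ x => log_tDensity hθ x

/-- The logarithmic weight is moved into the rate because the rule for `exp` requires weight $1$. -/
lemma derivBound_log_tDensity :
    DerivBound admissibleParams 1 logGrowth (fun _ _ => 1)
      (fun θ x => Real.log (tDensity θ x)) := by
  simpa only [one_mul] using (derivBound_one_log_tDensity_aux.of_le zero_le_one).absorb
    (fun _ => zero_le_one) one_le_logGrowth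

lemma derivBound_tDensity :
    DerivBound admissibleParams 0 logGrowth tDensity tDensity := by
  have heq : ∀ θ ∈ admissibleParams, ∀ x, tDensity θ x = Real.exp (Real.log (tDensity θ x)) :=
    fun θ hθ x => (Real.exp_log (tDensity_pos hθ x)).symm
  refine ((derivBound_log_tDensity.exp isOpen_admissibleParams logGrowth_nonneg).congr
    heq).mono_weight logGrowth_nonneg fun K hK _ => ⟨1, zero_le_one, fun θ hθ x => ?_⟩
  rw [one_mul, ← heq θ (hK hθ) x]

lemma exists_abs_log_tDensity_le {K : Set ParamVec} (hK : K ⊆ admissibleParams)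
    (hKc : IsCompact K) :
    ∃ C, 0 ≤ C ∧ ∀ θ ∈ K, ∀ x,
      |Real.log (tDensity θ x) + (θ 2 + 1) * Real.log (1 + |x|)| ≤ C := by
  obtain ⟨C, hC, hb⟩ := exists_abs_log_tKernel_sub_le hK hKc
  obtain ⟨A, hA, hAb⟩ := exists_abs_le_of_continuousOn hKc (contDiffOn_tLogConst.continuousOn.mono hK)
  obtain ⟨B, hB, hBb⟩ := exists_abs_le_of_continuousOn hKc (φ := fun θ => (θ 2 + 1) / 2)
    (by fun_prop)
  refine ⟨A + B * C, by positivity, fun θ hθ x => ?_⟩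
  rw [log_tDensity (hK hθ), show tLogConst θ - (θ 2 + 1) / 2 * Real.log (tKernel θ x) +
    (θ 2 + 1) * Real.log (1 + |x|) = tLogConst θ - (θ 2 + 1) / 2 *
      (Real.log (tKernel θ x) - 2 * Real.log (1 + |x|)) by ring]
  refine (abs_sub _ _).trans ?_
  rw [abs_mul]
  exact add_le_add (hAb θ hθ) (mul_le_mul (hBb θ hθ) (hb θ hθ x) (abs_nonneg _) hB)

/-- Two-sided power bounds for Student's t density. -/
lemma exists_tDensity_bounds {K : Set ParamVec} (hK : K ⊆ admissibleParams) (hKc : IsCompact K) :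
    ∃ C, 1 ≤ C ∧ ∀ θ ∈ K, ∀ x, C⁻¹ * (1 + |x|) ^ (-(θ 2 + 1)) ≤ tDensity θ x ∧
      tDensity θ x ≤ C * (1 + |x|) ^ (-(θ 2 + 1)) := by
  obtain ⟨C, hC, hb⟩ := exists_abs_log_tDensity_le hK hKc
  refine ⟨Real.exp C, Real.one_le_exp hC, fun θ hθ x => ?_⟩
  have h := abs_le.1 (hb θ hθ x)
  have hx : 0 < 1 + |x| := by positivity
  rw [← Real.exp_neg, ← Real.exp_log (tDensity_pos (hK hθ) x), Real.rpow_def_of_pos hx,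
    ← Real.exp_add, ← Real.exp_add, Real.exp_le_exp, Real.exp_le_exp]
  constructor <;> nlinarith [h.1, h.2]

/-- Logarithmic factors lose against a power. -/
lemma exists_logGrowth_pow_mul_le (n : ℕ) {a : ℝ} (ha : 0 < a) :
    ∃ C, 0 ≤ C ∧ ∀ y x : ℝ, |y| ≤ |x| →
      logGrowth x ^ n * (1 + |y|) ^ a ≤ C * (logGrowth y ^ n * (1 + |x|) ^ a) := by
  obtain ⟨C, hC, hb⟩ : ∃ C, 0 ≤ C ∧ ∀ t : ℝ, 1 ≤ t → (1 + Real.log t) ^ n ≤ C * t ^ a := by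
    rcases Nat.eq_zero_or_pos n with rfl | hn
    · exact ⟨1, zero_le_one, fun t ht => by simpa using Real.one_le_rpow ht ha.le⟩
    have hn' : (0 : ℝ) < n := by exact_mod_cast hn
    have he : 0 < a / n := by positivity
    refine ⟨(1 + 1 / (a / n)) ^ n, by positivity, fun t ht => ?_⟩
    have h0 : 0 ≤ Real.log t := Real.log_nonneg ht
    have h1 := Real.log_le_rpow_div (by linarith : 0 ≤ t) he
    have h2 : 1 ≤ t ^ (a / n) := Real.one_le_rpow ht he.le
    calc (1 + Real.log t) ^ n ≤ ((1 + 1 / (a / n)) * t ^ (a / n)) ^ n := by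
          gcongr
          calc 1 + Real.log t ≤ t ^ (a / n) + t ^ (a / n) / (a / n) := add_le_add h2 h1
            _ = _ := by ring
      _ = _ := by
          rw [mul_pow, ← Real.rpow_mul_natCast (by linarith), div_mul_cancel₀ _ hn'.ne']
  refine ⟨C, hC, fun y x hyx => ?_⟩
  have hy : 0 < 1 + |y| := by positivity
  have hx : 0 < 1 + |x| := by positivity
  -- Everything depends on this ratio: passing from `y` to `x` multiplies `logGrowth` by at most
  -- $1+\log t$, whose powers are bounded by a multiple of $t^a$.
  set t := (1 + |x|) / (1 + |y|) with ht
  have ht1 : 1 ≤ t := by rw [ht, le_div_iff₀ hy]; linarith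
  have htx : 1 + |x| = t * (1 + |y|) := by rw [ht]; field_simp
  have hlt : 0 ≤ Real.log t := Real.log_nonneg ht1
  have h1 : logGrowth x ≤ logGrowth y * (1 + Real.log t) := by
    have : logGrowth x = logGrowth y + Real.log t := by
      unfold logGrowth; rw [htx, Real.log_mul (by linarith) hy.ne']; ring
    rw [this]; nlinarith [one_le_logGrowth y]
  have := logGrowth_nonneg x
  have := logGrowth_nonneg y
  calc logGrowth x ^ n * (1 + |y|) ^ a ≤ (logGrowth y * (1 + Real.log t)) ^ n * (1 + |y|) ^ a := by
        gcongr
    _ = logGrowth y ^ n * (1 + Real.log t) ^ n * (1 + |y|) ^ a := by rw [mul_pow]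
    _ ≤ logGrowth y ^ n * (C * t ^ a) * (1 + |y|) ^ a := by gcongr; exact hb t ht1
    _ = _ := by rw [htx, Real.mul_rpow (by linarith) hy.le]; ring

lemma integral_Iic_one_add_abs_rpow {s r : ℝ} (hs : 0 < s) (hr : r ≤ 0) :
    IntegrableOn (fun x : ℝ => (1 + |x|) ^ (-(s + 1))) (Set.Iic r) ∧
      ∫ x in Set.Iic r, (1 + |x|) ^ (-(s + 1)) = (1 + |r|) ^ (-s) / s := by
  have hd (x : ℝ) (hx : x ∈ Set.Iio r) :
      HasDerivAt (fun x : ℝ => (1 - x) ^ (-s) / s) ((1 + |x|) ^ (-(s + 1))) x := by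
    have hx : x < r := hx
    have hpos : (1 : ℝ) - x ≠ 0 := by linarith
    have h1 : HasDerivAt (fun x : ℝ => 1 - x) (-1) x := by
      simpa using (hasDerivAt_id x).const_sub 1
    have h2 := (h1.rpow_const (p := -s) (Or.inl hpos)).div_const s
    refine h2.congr_deriv ?_
    rw [abs_of_nonpos (by linarith : x ≤ 0), show -s - 1 = -(s + 1) by ring,
      show 1 + -x = 1 - x by ring]
    field_simp
  have ht : Tendsto (fun x : ℝ => (1 - x) ^ (-s) / s) atBot (𝓝 0) := by
    have h1 : Tendsto (fun x : ℝ => 1 - x) atBot atTop :=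
      tendsto_atTop_add_const_left _ _ tendsto_neg_atBot_atTop
    simpa using ((tendsto_rpow_neg_atTop hs).comp h1).div_const s
  have hc : ContinuousWithinAt (fun x : ℝ => (1 - x) ^ (-s) / s) (Set.Iic r) r := by
    refine ContinuousAt.continuousWithinAt ?_
    have : (1 : ℝ) - r ≠ 0 := by linarith
    fun_prop (disch := simp [this])
  have hi : IntegrableOn (fun x : ℝ => (1 + |x|) ^ (-(s + 1))) (Set.Iic r) :=
    (integrable_one_add_norm (E := ℝ) (μ := volume) (r := s + 1) (by simpa using hs)).integrableOn
  refine ⟨hi, ?_⟩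
  rw [integral_Iic_of_hasDerivAt_of_tendsto hc hd hi ht, abs_of_nonpos hr]
  simp [sub_eq_add_neg]

end StudentTBounds

/-! ### The two tails of Student's distribution -/

section StudentTTails

open scoped ContDiff

/-- The lower tail `F_t` of Student's t distribution. -/
noncomputable def tLower (θ : ParamVec) (r : ℝ) : ℝ := ∫ x in Set.Iic r, tDensity θ x

/-- The upper tail `1 - F_t` of Student's t distribution. -/
noncomputable def tUpper (θ : ParamVec) (r : ℝ) : ℝ := ∫ x in Set.Ioi r, tDensity θ x

lemma tLower_add_tUpper {θ : ParamVec} (hθ : θ ∈ admissibleParams) (r : ℝ) :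
    tLower θ r + tUpper θ r = 1 := by
  rw [← integral_tDensity hθ, tLower, tUpper, ← Set.compl_Iic]
  exact integral_add_compl measurableSet_Iic (integrable_tDensity hθ)

lemma tLower_pos {θ : ParamVec} (hθ : θ ∈ admissibleParams) (r : ℝ) : 0 < tLower θ r := by
  refine (setIntegral_pos_iff_support_of_nonneg_ae
    (ae_of_all _ fun x => (tDensity_pos hθ x).le) (integrable_tDensity hθ).integrableOn).2 ?_
  rw [show Function.support (tDensity θ) = Set.univ from
    Set.eq_univ_of_forall fun x => (tDensity_pos hθ x).ne']
  simp

lemma tUpper_pos {θ : ParamVec} (hθ : θ ∈ admissibleParams) (r : ℝ) : 0 < tUpper θ r := by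
  refine (setIntegral_pos_iff_support_of_nonneg_ae
    (ae_of_all _ fun x => (tDensity_pos hθ x).le) (integrable_tDensity hθ).integrableOn).2 ?_
  rw [show Function.support (tDensity θ) = Set.univ from
    Set.eq_univ_of_forall fun x => (tDensity_pos hθ x).ne']
  simp

lemma tLower_mono {θ : ParamVec} (hθ : θ ∈ admissibleParams) : Monotone (tLower θ) := fun _ _ h =>
  setIntegral_mono_set (integrable_tDensity hθ).integrableOn
    (ae_of_all _ fun x => (tDensity_pos hθ x).le) (Set.Iic_subset_Iic.2 h).eventuallyLE

/-- Reflection of the location parameter. -/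
noncomputable def reflectLoc (θ : ParamVec) : ParamVec := !₂[-θ 0, θ 1, θ 2, θ 3]

lemma continuous_reflectLoc : Continuous reflectLoc := by
  unfold reflectLoc
  refine (PiLp.continuous_toLp 2 _).comp (continuous_pi fun i => ?_)
  fin_cases i <;> simp <;> fun_prop

lemma reflectLoc_mem {θ : ParamVec} (hθ : θ ∈ admissibleParams) :
    reflectLoc θ ∈ admissibleParams := hθ

lemma tDensity_reflectLoc (θ : ParamVec) (x : ℝ) : tDensity (reflectLoc θ) x = tDensity θ (-x) := by
  have : (-x - θ 0) ^ 2 = (x + θ 0) ^ 2 := by ring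
  simp [tDensity, studentTPDF, reflectLoc, this]

lemma setIntegral_Ioi_reflectLoc (θ : ParamVec) (n : ℕ) (r : ℝ) :
    ∫ x in Set.Ioi r, logGrowth x ^ n * tDensity θ x =
      ∫ x in Set.Iic (-r), logGrowth x ^ n * tDensity (reflectLoc θ) x := by
  simp_rw [tDensity_reflectLoc]
  conv_rhs => enter [2, x]; rw [← logGrowth_neg]
  rw [integral_comp_neg_Iic (-r) (fun x => logGrowth x ^ n * tDensity θ x), neg_neg]

lemma tUpper_eq_tLower (θ : ParamVec) (r : ℝ) : tUpper θ r = tLower (reflectLoc θ) (-r) := by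
  simpa [tUpper, tLower] using setIntegral_Ioi_reflectLoc θ 0 r

/-- One power of $1+|x|$ pays for all the logarithms, and what remains has exponent $-\nu<-2$. The
bound is free of the parameters, as domination requires. -/
lemma exists_logGrowth_pow_mul_tDensity_le {K : Set ParamVec} (hK : K ⊆ admissibleParams)
    (hKc : IsCompact K) (n : ℕ) :
    ∃ C, 0 ≤ C ∧ ∀ θ ∈ K, ∀ x, logGrowth x ^ n * tDensity θ x ≤ C * (1 + |x|) ^ (-2 : ℝ) := by
  obtain ⟨C, hC, hb⟩ := exists_tDensity_bounds hK hKc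
  obtain ⟨A, hA, hAb⟩ := exists_logGrowth_pow_mul_le n one_pos
  refine ⟨A * C, by positivity, fun θ hθ x => ?_⟩
  have h1 := hAb 0 x (by simp)
  simp only [logGrowth, abs_zero, add_zero, Real.log_one, one_pow, one_mul, mul_one,
    Real.rpow_one] at h1
  have hx : 1 ≤ 1 + |x| := by linarith [abs_nonneg x]
  have hf := (tDensity_pos (hK hθ) x).le
  calc logGrowth x ^ n * tDensity θ x ≤ (A * (1 + |x|)) * (C * (1 + |x|) ^ (-(θ 2 + 1))) :=
        mul_le_mul h1 (hb θ hθ x).2 hf (by positivity)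
    _ = A * C * (1 + |x|) ^ (1 + -(θ 2 + 1)) := by
        rw [Real.rpow_add (by linarith), Real.rpow_one]; ring
    _ ≤ _ := by
        gcongr
        linarith [(hK hθ).2.1]

lemma integrable_one_add_abs_rpow_neg_two : Integrable (fun x : ℝ => (1 + |x|) ^ (-2 : ℝ)) := by
  simpa using integrable_one_add_norm (E := ℝ) (μ := volume) (r := 2) (by simp)

lemma integrable_logGrowth_pow_mul_tDensity {θ : ParamVec} (hθ : θ ∈ admissibleParams) (n : ℕ) :
    Integrable fun x => logGrowth x ^ n * tDensity θ x := by
  obtain ⟨C, hC, hb⟩ := exists_logGrowth_pow_mul_tDensity_le (K := {θ}) (by simpa using hθ)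
    isCompact_singleton n
  refine (integrable_one_add_abs_rpow_neg_two.const_mul C).mono'
    ((continuous_logGrowth.pow n).mul (continuous_tDensity hθ)).aestronglyMeasurable
    (ae_of_all _ fun x => ?_)
  have := tDensity_pos hθ x
  have := logGrowth_nonneg x
  rw [Real.norm_of_nonneg (by positivity)]
  exact hb θ rfl x

/-- Lower bound for the lower tail. -/
lemma exists_le_tLower {K : Set ParamVec} (hK : K ⊆ admissibleParams) (hKc : IsCompact K) :
    ∃ C, 1 ≤ C ∧ ∀ θ ∈ K, ∀ r ≤ 0, (1 + |r|) ^ (-θ 2) ≤ C * tLower θ r := by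
  obtain ⟨C, hC, hb⟩ := exists_tDensity_bounds hK hKc
  obtain ⟨B, hB, hBd⟩ := exists_param_bounds hK hKc
  refine ⟨C * B, one_le_mul_of_one_le_of_one_le hC hB, fun θ hθ r hr => ?_⟩
  have h2 : 0 < θ 2 := by linarith [(hK hθ).2.1]
  obtain ⟨hi, he⟩ := integral_Iic_one_add_abs_rpow h2 hr
  have h1 : C⁻¹ * ((1 + |r|) ^ (-θ 2) / θ 2) ≤ tLower θ r := by
    rw [← he, ← integral_const_mul]
    exact setIntegral_mono (hi.const_mul _) (integrable_tDensity (hK hθ)).integrableOn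
      fun x => (hb θ hθ x).1
  have hp : 0 < (1 + |r|) ^ (-θ 2) := by positivity
  calc (1 + |r|) ^ (-θ 2) = C * θ 2 * (C⁻¹ * ((1 + |r|) ^ (-θ 2) / θ 2)) := by field_simp
    _ ≤ C * θ 2 * tLower θ r := by gcongr
    _ ≤ C * B * tLower θ r := by
        have := tLower_pos (hK hθ) r
        gcongr; exact (hBd θ hθ).2.2.2.1

/-- Upper bound for moments of the lower tail. -/
lemma exists_setIntegral_Iic_le_rpow {K : Set ParamVec} (hK : K ⊆ admissibleParams)
    (hKc : IsCompact K) (n : ℕ) :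
    ∃ C, 0 ≤ C ∧ ∀ θ ∈ K, ∀ r ≤ 0, ∫ x in Set.Iic r, logGrowth x ^ n * tDensity θ x ≤
      C * (logGrowth r ^ n * (1 + |r|) ^ (-θ 2)) := by
  obtain ⟨C, hC, hb⟩ := exists_tDensity_bounds hK hKc
  obtain ⟨A, hA, hAb⟩ := exists_logGrowth_pow_mul_le n one_pos
  refine ⟨A * C, by positivity, fun θ hθ r hr => ?_⟩
  have h2 := (hK hθ).2.1
  have hr1 : 0 < 1 + |r| := by positivity
  have hMr := logGrowth_nonneg r
  -- The exponent is lowered by one because a factor $(1+|x|)/(1+|r|)$ is spent on the logarithms;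
  -- the denominator returns the lost power of $1+|r|$. Since $\nu>2$, the resulting divisor $\nu-1$
  -- is at least $1$.
  obtain ⟨hi, he⟩ := integral_Iic_one_add_abs_rpow (s := θ 2 - 1) (by linarith) hr
  have hbound : ∀ x ∈ Set.Iic r, logGrowth x ^ n * tDensity θ x ≤
      (A * C * logGrowth r ^ n * (1 + |r|)⁻¹) * (1 + |x|) ^ (-(θ 2 - 1 + 1)) := by
    intro x hx
    have hx : x ≤ r := hx
    have h3 := hAb r x (by rw [abs_of_nonpos hr, abs_of_nonpos (hx.trans hr)]; linarith)
    simp only [Real.rpow_one] at h3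
    have hx1 : 0 < 1 + |x| := by positivity
    have h4 : logGrowth x ^ n ≤ A * (logGrowth r ^ n * (1 + |x|)) * (1 + |r|)⁻¹ := by
      rw [← div_eq_mul_inv, le_div_iff₀ hr1]; exact h3
    calc _ ≤ (A * (logGrowth r ^ n * (1 + |x|)) * (1 + |r|)⁻¹) * (C * (1 + |x|) ^ (-(θ 2 + 1))) :=
          mul_le_mul h4 (hb θ hθ x).2 (tDensity_pos (hK hθ) x).le (by positivity)
      _ = (A * C * logGrowth r ^ n * (1 + |r|)⁻¹) * ((1 + |x|) ^ (1 : ℝ) * (1 + |x|) ^ (-(θ 2 + 1))) := by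
          rw [Real.rpow_one]; ring
      _ = _ := by rw [← Real.rpow_add hx1]; congr 2; ring
  calc ∫ x in Set.Iic r, logGrowth x ^ n * tDensity θ x
      ≤ ∫ x in Set.Iic r, (A * C * logGrowth r ^ n * (1 + |r|)⁻¹) * (1 + |x|) ^ (-(θ 2 - 1 + 1)) :=
        setIntegral_mono_on (integrable_logGrowth_pow_mul_tDensity (hK hθ) n).integrableOn
          (hi.const_mul _) measurableSet_Iic hbound
    _ = A * C * logGrowth r ^ n * ((1 + |r|) ^ (-1 : ℝ) * (1 + |r|) ^ (-(θ 2 - 1))) / (θ 2 - 1) := by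
        rw [integral_const_mul, he, Real.rpow_neg_one]; ring
    _ = A * C * (logGrowth r ^ n * (1 + |r|) ^ (-θ 2)) / (θ 2 - 1) := by
        rw [← Real.rpow_add hr1, show -1 + -(θ 2 - 1) = -θ 2 by ring]; ring
    _ ≤ _ := div_le_self (by positivity) (by linarith)

lemma exists_inv_le_tLower_zero {K : Set ParamVec} (hK : K ⊆ admissibleParams)
    (hKc : IsCompact K) :
    ∃ C, 1 ≤ C ∧ ∀ θ ∈ K, ∀ r, 0 ≤ r → 1 ≤ C * tLower θ r := by
  obtain ⟨C, hC, hb⟩ := exists_le_tLower hK hKc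
  refine ⟨C, hC, fun θ hθ r hr => ?_⟩
  have := hb θ hθ 0 le_rfl
  simp only [abs_zero, add_zero, Real.one_rpow] at this
  exact this.trans (mul_le_mul_of_nonneg_left (tLower_mono (hK hθ) hr) (by linarith))

/-- Logarithmic factors can be evaluated at the endpoint of a power tail. For `r ≤ 0` both sides are
compared with $(1+|r|)^{-\nu}$; for `0 ≤ r` the integral is bounded and the lower tail is bounded
below. This carries relative derivative bounds from the density to its distribution function. -/
lemma exists_setIntegral_Iic_le {K : Set ParamVec} (hK : K ⊆ admissibleParams)
    (hKc : IsCompact K) (n : ℕ) :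
    ∃ C, 0 ≤ C ∧ ∀ θ ∈ K, ∀ r, ∫ x in Set.Iic r, logGrowth x ^ n * tDensity θ x ≤
      C * (logGrowth r ^ n * tLower θ r) := by
  obtain ⟨C₁, hC₁, h₁⟩ := exists_setIntegral_Iic_le_rpow hK hKc n
  obtain ⟨C₂, hC₂, h₂⟩ := exists_le_tLower hK hKc
  obtain ⟨C₃, hC₃, h₃⟩ := exists_inv_le_tLower_zero hK hKc
  obtain ⟨C₄, hC₄, h₄⟩ := exists_logGrowth_pow_mul_tDensity_le hK hKc n
  set I := ∫ x : ℝ, (1 + |x|) ^ (-2 : ℝ)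
  have hI : 0 ≤ I := integral_nonneg fun x => by positivity
  refine ⟨C₁ * C₂ + C₄ * I * C₃, by positivity, fun θ hθ r => ?_⟩
  have hM := logGrowth_nonneg r
  have hF := tLower_pos (hK hθ) r
  rcases le_total r 0 with hr | hr
  · calc _ ≤ C₁ * (logGrowth r ^ n * (C₂ * tLower θ r)) :=
          (h₁ θ hθ r hr).trans (by gcongr; exact h₂ θ hθ r hr)
      _ = C₁ * C₂ * (logGrowth r ^ n * tLower θ r) := by ring
      _ ≤ _ := by gcongr; linarith [(by positivity : 0 ≤ C₄ * I * C₃)]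
  · calc _ ≤ ∫ x, logGrowth x ^ n * tDensity θ x :=
          setIntegral_le_integral (integrable_logGrowth_pow_mul_tDensity (hK hθ) n)
            (ae_of_all _ fun x => mul_nonneg (pow_nonneg (logGrowth_nonneg x) n)
              (tDensity_pos (hK hθ) x).le)
      _ ≤ ∫ x : ℝ, C₄ * (1 + |x|) ^ (-2 : ℝ) :=
          integral_mono (integrable_logGrowth_pow_mul_tDensity (hK hθ) n)
            (integrable_one_add_abs_rpow_neg_two.const_mul C₄) (h₄ θ hθ)
      _ = C₄ * I * 1 := by rw [integral_const_mul, mul_one]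
      _ ≤ C₄ * I * (C₃ * tLower θ r) := by gcongr; exact h₃ θ hθ r hr
      _ ≤ C₄ * I * C₃ * (1 * tLower θ r) := by rw [one_mul, mul_assoc (C₄ * I)]
      _ ≤ C₄ * I * C₃ * (logGrowth r ^ n * tLower θ r) := by
          gcongr; exact one_le_pow₀ (one_le_logGrowth r)
      _ ≤ _ := by gcongr; linarith [(by positivity : 0 ≤ C₁ * C₂)]

/-- Reflection at the origin exchanges the tails and negates the location, which preserves
compactness of the parameter set. -/
lemma exists_setIntegral_Ioi_le {K : Set ParamVec} (hK : K ⊆ admissibleParams)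
    (hKc : IsCompact K) (n : ℕ) :
    ∃ C, 0 ≤ C ∧ ∀ θ ∈ K, ∀ r, ∫ x in Set.Ioi r, logGrowth x ^ n * tDensity θ x ≤
      C * (logGrowth r ^ n * tUpper θ r) := by
  obtain ⟨C, hC, hb⟩ := exists_setIntegral_Iic_le (K := reflectLoc '' K)
    (Set.image_subset_iff.2 fun θ hθ => reflectLoc_mem (hK hθ)) (hKc.image continuous_reflectLoc) n
  refine ⟨C, hC, fun θ hθ r => ?_⟩
  rw [setIntegral_Ioi_reflectLoc, tUpper_eq_tLower, ← logGrowth_neg r]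
  exact hb _ (Set.mem_image_of_mem _ hθ) (-r)

lemma derivBound_tLower_tUpper_aux (S : ℝ → Set ℝ) (hS : ∀ K ⊆ admissibleParams, IsCompact K →
      ∀ n : ℕ, ∃ C, 0 ≤ C ∧ ∀ θ ∈ K, ∀ r, ∫ x in S r, logGrowth x ^ n * tDensity θ x ≤
      C * (logGrowth r ^ n * ∫ x in S r, tDensity θ x)) :
    DerivBound admissibleParams 0 logGrowth (fun θ r => ∫ x in S r, tDensity θ x)
      (fun θ r => ∫ x in S r, tDensity θ x) :=
  derivBound_tDensity.setIntegral isOpen_admissibleParams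
    (fun θ hθ => (continuous_tDensity hθ).stronglyMeasurable)
    (fun θ hθ n => integrable_logGrowth_pow_mul_tDensity hθ n)
    (fun K hK hKc n => by
      obtain ⟨C, _, hb⟩ := exists_logGrowth_pow_mul_tDensity_le hK hKc n
      exact ⟨_, integrable_one_add_abs_rpow_neg_two.const_mul C, hb⟩) hS

lemma derivBound_tLower : DerivBound admissibleParams 0 logGrowth tLower tLower :=
  derivBound_tLower_tUpper_aux Set.Iic fun _ hK hKc n => exists_setIntegral_Iic_le hK hKc n

lemma derivBound_tUpper : DerivBound admissibleParams 0 logGrowth tUpper tUpper :=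
  derivBound_tLower_tUpper_aux Set.Ioi fun _ hK hKc n => exists_setIntegral_Ioi_le hK hKc n

/-- Two-sided bounds for the upper tail on the right half-line. -/
lemma exists_tUpper_bounds {K : Set ParamVec} (hK : K ⊆ admissibleParams) (hKc : IsCompact K) :
    ∃ C, 1 ≤ C ∧ ∀ θ ∈ K, (∀ r, 0 ≤ r → (1 + |r|) ^ (-θ 2) ≤ C * tUpper θ r) ∧
      ∀ r ≤ 0, 1 ≤ C * tUpper θ r := by
  have hK' : reflectLoc '' K ⊆ admissibleParams :=
    Set.image_subset_iff.2 fun θ hθ => reflectLoc_mem (hK hθ)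
  have hKc' := hKc.image continuous_reflectLoc
  obtain ⟨C₁, hC₁, h₁⟩ := exists_le_tLower hK' hKc'
  obtain ⟨C₂, hC₂, h₂⟩ := exists_inv_le_tLower_zero hK' hKc'
  refine ⟨max C₁ C₂, hC₁.trans (le_max_left _ _), fun θ hθ => ⟨fun r hr => ?_, fun r hr => ?_⟩⟩
  all_goals have hpos := tLower_pos (hK' (Set.mem_image_of_mem _ hθ)) (-r)
  all_goals rw [tUpper_eq_tLower]
  · have := h₁ _ (Set.mem_image_of_mem _ hθ) (-r) (by linarith)
    rw [abs_neg] at this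
    exact this.trans (mul_le_mul_of_nonneg_right (le_max_left _ _) hpos.le)
  · have := h₂ _ (Set.mem_image_of_mem _ hθ) (-r) (by linarith)
    exact this.trans (mul_le_mul_of_nonneg_right (le_max_right _ _) hpos.le)

end StudentTTails

/-! ### The function `-log F` and the behavioral log-density -/

section NegLog

open scoped ContDiff

/-- `-log F_t`. -/
noncomputable def tNegLog (θ : ParamVec) (r : ℝ) : ℝ := -Real.log (tLower θ r)

lemma tLower_lt_one {θ : ParamVec} (hθ : θ ∈ admissibleParams) (r : ℝ) : tLower θ r < 1 := by
  linarith [tLower_add_tUpper hθ r, tUpper_pos hθ r]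

lemma tNegLog_pos {θ : ParamVec} (hθ : θ ∈ admissibleParams) (r : ℝ) : 0 < tNegLog θ r :=
  neg_pos.2 (Real.log_neg (tLower_pos hθ r) (tLower_lt_one hθ r))

lemma tUpper_le_tNegLog {θ : ParamVec} (hθ : θ ∈ admissibleParams) (r : ℝ) :
    tUpper θ r ≤ tNegLog θ r := by
  have := Real.log_le_sub_one_of_pos (tLower_pos hθ r)
  unfold tNegLog
  linarith [tLower_add_tUpper hθ r]

lemma exp_neg_tNegLog {θ : ParamVec} (hθ : θ ∈ admissibleParams) (r : ℝ) :
    Real.exp (-tNegLog θ r) = tLower θ r := by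
  rw [tNegLog, neg_neg, Real.exp_log (tLower_pos hθ r)]

/-- Since $F=1-(1-F)$, positive-order derivatives of $F$ are those of the upper tail up to sign,
hence small on the right, where `derivBound_tLower` gives no decay. -/
lemma derivBound_one_tLower : DerivBound admissibleParams 1 logGrowth tUpper tLower := by
  have hU := isOpen_admissibleParams
  have hc : DerivBound admissibleParams 1 logGrowth tUpper (fun (_ : ParamVec) (_ : ℝ) => (1 : ℝ)) := by
    refine ⟨fun x => contDiffOn_const, fun K hK _ n hn => ⟨0, le_rfl, fun θ hθ x => ?_⟩⟩
    rw [iteratedFDerivWithin_const_of_ne (by omega)]; simp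
  exact (hc.sub hU (derivBound_tUpper.of_le zero_le_one)).congr fun θ hθ r => by
    linarith [tLower_add_tUpper hθ r]

/-- Where $F\le 1/2$, $L\ge\log 2$, so bounded relative derivatives of $F$ suffice. Where $F\ge
1/2$, the derivatives are controlled by $F^{-1}(1-F)\le 2(1-F)\le 2L$. Both regimes are needed
because $L$ tends to $0$ on the right. -/
lemma derivBound_tNegLog : DerivBound admissibleParams 0 logGrowth tNegLog tNegLog := by
  have hU := isOpen_admissibleParams
  have hlog := (derivBound_tLower.of_le zero_le_one).log hU logGrowth_nonneg
    fun θ hθ r => tLower_pos hθ r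
  have hinv := (derivBound_tLower.of_le zero_le_one).inv hU logGrowth_nonneg
    fun θ hθ r => tLower_pos hθ r
  -- Obtained from $d\log F=F^{-1}\,dF$, with the upper-tail bound used for $dF$.
  have hlog' : DerivBound admissibleParams 1 logGrowth (fun θ r => (tLower θ r)⁻¹ * tUpper θ r)
      (fun θ r => Real.log (tLower θ r)) := by
    refine DerivBound.of_fderivWithin hU hlog.1 (((hinv.smul hU
      (derivBound_one_tLower.fderivWithin hU)).congr fun θ hθ r => ?_).mono_weight logGrowth_nonneg
      fun K _ _ => ⟨1, zero_le_one, fun θ _ r => by rw [one_mul]; exact le_of_eq (by ring)⟩)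
    exact fderivWithin.log ((derivBound_tLower.1 r).differentiableOn (by simp) θ hθ)
      (tLower_pos hθ r).ne' (hU.uniqueDiffOn θ hθ)
  refine DerivBound.of_succ (DerivBound.neg hU ⟨hlog.1, fun K hK hKc n hn => ?_⟩)
    fun K hK _ => ⟨1, zero_le_one, fun θ hθ r => ?_⟩
  · obtain ⟨C₁, hC₁, h₁⟩ := hlog.2 K hK hKc n hn
    obtain ⟨C₂, hC₂, h₂⟩ := hlog'.2 K hK hKc n hn
    refine ⟨2 * C₁ + 2 * C₂, by positivity, fun θ hθ r => ?_⟩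
    have hM : 0 ≤ logGrowth r ^ n := pow_nonneg (logGrowth_nonneg r) n
    have hF := tLower_pos (hK hθ) r
    have hL := tNegLog_pos (hK hθ) r
    rcases le_total (tLower θ r) (1 / 2) with h | h
    · have h3 : 1 / 2 ≤ tNegLog θ r := by
        have h4 := Real.log_le_log hF h
        have h5 := Real.log_two_gt_d9
        rw [one_div, Real.log_inv] at h4
        unfold tNegLog; linarith
      calc _ ≤ C₁ * logGrowth r ^ n * 1 := h₁ θ hθ r
        _ ≤ C₁ * logGrowth r ^ n * (2 * tNegLog θ r) := by gcongr; linarith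
        _ ≤ _ := by
          have : 0 ≤ C₂ * logGrowth r ^ n * tNegLog θ r := by positivity
          linarith
    · have h3 : (tLower θ r)⁻¹ * tUpper θ r ≤ 2 * tNegLog θ r := by
        have h4 : (tLower θ r)⁻¹ ≤ 2 := by
          rw [inv_le_comm₀ hF two_pos]; linarith
        exact mul_le_mul h4 (tUpper_le_tNegLog (hK hθ) r) (tUpper_pos (hK hθ) r).le two_pos.le
      calc _ ≤ C₂ * logGrowth r ^ n * ((tLower θ r)⁻¹ * tUpper θ r) := h₂ θ hθ r
        _ ≤ C₂ * logGrowth r ^ n * (2 * tNegLog θ r) := by gcongr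
        _ ≤ _ := by
          have : 0 ≤ C₁ * logGrowth r ^ n * tNegLog θ r := by positivity
          linarith
  · have := tNegLog_pos (hK hθ) r
    rw [one_mul]
    exact (Real.norm_of_nonneg this.le).le

/-- On the left half-line, `-log F_t` is comparable with `logGrowth`. -/
lemma exists_tNegLog_left {K : Set ParamVec} (hK : K ⊆ admissibleParams) (hKc : IsCompact K) :
    ∃ C, 1 ≤ C ∧ ∀ θ ∈ K, ∀ r ≤ 0, tNegLog θ r ≤ C * logGrowth r ∧
      logGrowth r ≤ C * tNegLog θ r := by
  obtain ⟨C₁, hC₁, h₁⟩ := exists_le_tLower hK hKc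
  obtain ⟨C₂, hC₂, h₂⟩ := exists_setIntegral_Iic_le_rpow hK hKc 0
  obtain ⟨C₃, hC₃, h₃⟩ := exists_tUpper_bounds hK hKc
  obtain ⟨B, hB, hBd⟩ := exists_param_bounds hK hKc
  refine ⟨(B + Real.log C₁) + (C₃ * (1 + C₂) + 1), ?_, fun θ hθ r hr => ?_⟩
  · have := Real.log_nonneg hC₁
    have : 0 ≤ C₃ * (1 + C₂) := by positivity
    linarith
  have h2 := (hK hθ).2.1
  have hx : 0 < 1 + |r| := by positivity
  have hF := tLower_pos (hK hθ) r
  have hM := one_le_logGrowth r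
  have hMl : Real.log (1 + |r|) = logGrowth r - 1 := by unfold logGrowth; ring
  have hlC := Real.log_nonneg hC₁
  have hLC : 1 ≤ C₃ * tNegLog θ r := ((h₃ θ hθ).2 r hr).trans (by
    gcongr; exact tUpper_le_tNegLog (hK hθ) r)
  have hL := tNegLog_pos (hK hθ) r
  constructor
  · have e := Real.log_le_log (by positivity) (h₁ θ hθ r hr)
    rw [Real.log_rpow hx, Real.log_mul (by positivity) hF.ne', hMl] at e
    have e2 : tNegLog θ r ≤ Real.log C₁ + θ 2 * (logGrowth r - 1) := by
      unfold tNegLog; linarith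
    have e3 : θ 2 * (logGrowth r - 1) ≤ B * (logGrowth r - 1) :=
      mul_le_mul_of_nonneg_right (hBd θ hθ).2.2.2.1 (by linarith)
    have e4 : 0 ≤ C₃ * (1 + C₂) * logGrowth r := by positivity
    nlinarith
  · have h5 := h₂ θ hθ r hr
    simp only [pow_zero, one_mul] at h5
    change tLower θ r ≤ _ at h5
    have hC₂' : 0 < 1 + C₂ := by positivity
    have e := Real.log_le_log hF (h5.trans (by gcongr; linarith :
      C₂ * (1 + |r|) ^ (-θ 2) ≤ (1 + C₂) * (1 + |r|) ^ (-θ 2)))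
    rw [Real.log_mul hC₂'.ne' (by positivity), Real.log_rpow hx, hMl] at e
    have e1 := Real.log_le_sub_one_of_pos hC₂'
    have e2 : θ 2 * (logGrowth r - 1) ≤ tNegLog θ r + C₂ := by unfold tNegLog; linarith
    have e3 : logGrowth r - 1 ≤ θ 2 * (logGrowth r - 1) := by nlinarith
    have e4 : 0 ≤ (B + Real.log C₁) * tNegLog θ r := by positivity
    nlinarith

/-- On the right half-line, `-log F_t` decays like a power. -/
lemma exists_tNegLog_right {K : Set ParamVec} (hK : K ⊆ admissibleParams) (hKc : IsCompact K) :
    ∃ C, 1 ≤ C ∧ ∀ θ ∈ K, ∀ r, 0 ≤ r → tNegLog θ r ≤ C ∧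
      (1 + |r|) ^ (-θ 2) ≤ C * tNegLog θ r := by
  obtain ⟨C₁, hC₁, h₁⟩ := exists_inv_le_tLower_zero hK hKc
  obtain ⟨C₂, hC₂, h₂⟩ := exists_tUpper_bounds hK hKc
  refine ⟨C₁ + C₂, by linarith, fun θ hθ r hr => ⟨?_, ?_⟩⟩
  · have e := Real.log_le_log one_pos (h₁ θ hθ r hr)
    rw [Real.log_mul (by positivity) (tLower_pos (hK hθ) r).ne', Real.log_one] at e
    have := Real.log_le_sub_one_of_pos (by linarith : 0 < C₁)
    unfold tNegLog; linarith
  · refine ((h₂ θ hθ).1 r hr).trans (mul_le_mul (by linarith) (tUpper_le_tNegLog (hK hθ) r)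
      (tUpper_pos (hK hθ) r).le (by linarith))

lemma exists_tNegLog_le {K : Set ParamVec} (hK : K ⊆ admissibleParams) (hKc : IsCompact K) :
    ∃ C, 1 ≤ C ∧ ∀ θ ∈ K, ∀ r, tNegLog θ r ≤ C * logGrowth r := by
  obtain ⟨C₁, hC₁, h₁⟩ := exists_tNegLog_left hK hKc
  obtain ⟨C₂, hC₂, h₂⟩ := exists_tNegLog_right hK hKc
  refine ⟨C₁ + C₂, by linarith, fun θ hθ r => ?_⟩
  have hM := one_le_logGrowth r
  rcases le_total r 0 with hr | hr
  · nlinarith [(h₁ θ hθ r hr).1]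
  · nlinarith [(h₂ θ hθ r hr).1]

/-- On the left $L$ is comparable with `logGrowth`, so its logarithm is much smaller; on the right
$L\ge C^{-1}(1+|r|)^{-\nu}$, so $\log L$ falls at most logarithmically. -/
lemma exists_abs_log_tNegLog_le {K : Set ParamVec} (hK : K ⊆ admissibleParams)
    (hKc : IsCompact K) :
    ∃ C, 0 ≤ C ∧ ∀ θ ∈ K, ∀ r, |Real.log (tNegLog θ r)| ≤ C * logGrowth r := by
  obtain ⟨C₁, hC₁, h₁⟩ := exists_tNegLog_left hK hKc
  obtain ⟨C₂, hC₂, h₂⟩ := exists_tNegLog_right hK hKc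
  obtain ⟨C₃, hC₃, h₃⟩ := exists_tNegLog_le hK hKc
  obtain ⟨B, hB, hBd⟩ := exists_param_bounds hK hKc
  refine ⟨C₁ + C₂ + C₃ + B, by linarith, fun θ hθ r => abs_le.2 ⟨?_, ?_⟩⟩
  · have hM := one_le_logGrowth r
    have hL := tNegLog_pos (hK hθ) r
    have hMl : Real.log (1 + |r|) = logGrowth r - 1 := by unfold logGrowth; ring
    have l1 := Real.log_le_sub_one_of_pos (by linarith : 0 < C₁)
    have l2 := Real.log_le_sub_one_of_pos (by linarith : 0 < C₂)
    rcases le_total r 0 with hr | hr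
    · have e := Real.log_le_log one_pos (hM.trans (h₁ θ hθ r hr).2)
      rw [Real.log_mul (by positivity) hL.ne', Real.log_one] at e
      nlinarith
    · have e := Real.log_le_log (by positivity) (h₂ θ hθ r hr).2
      rw [Real.log_rpow (by positivity), Real.log_mul (by positivity) hL.ne', hMl] at e
      have e3 : θ 2 * (logGrowth r - 1) ≤ B * (logGrowth r - 1) :=
        mul_le_mul_of_nonneg_right (hBd θ hθ).2.2.2.1 (by linarith)
      nlinarith
  · have hM := one_le_logGrowth r
    have e := Real.log_le_sub_one_of_pos (tNegLog_pos (hK hθ) r)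
    nlinarith [h₃ θ hθ r]

lemma derivBound_log_tNegLog_one : DerivBound admissibleParams 1 logGrowth (fun _ _ => 1)
    (fun θ r => Real.log (tNegLog θ r)) :=
  (derivBound_tNegLog.of_le zero_le_one).log isOpen_admissibleParams logGrowth_nonneg
    fun _ hθ r => tNegLog_pos hθ r

lemma one_weight_le_logGrowth (K : Set ParamVec) :
      ∃ C, 0 ≤ C ∧ ∀ θ ∈ K, ∀ x, (1 : ℝ) ≤ C * logGrowth x :=
  ⟨1, zero_le_one, fun θ _ x => by rw [one_mul]; exact one_le_logGrowth x⟩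

lemma derivBound_log_tNegLog : DerivBound admissibleParams 0 logGrowth (fun _ r => logGrowth r)
    (fun θ r => Real.log (tNegLog θ r)) :=
  DerivBound.of_succ (derivBound_log_tNegLog_one.mono_weight logGrowth_nonneg
    fun K _ _ => one_weight_le_logGrowth K) fun _ hK hKc => exists_abs_log_tNegLog_le hK hKc

/-- The exponent `(-log F_t) ^ α` in the Prelec weighting. -/
noncomputable def prelecExponent (θ : ParamVec) (r : ℝ) : ℝ :=
  Real.exp (θ 3 * Real.log (tNegLog θ r))

lemma prelecExponent_pos (θ : ParamVec) (r : ℝ) : 0 < prelecExponent θ r := Real.exp_pos _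

lemma prelecExponent_eq {θ : ParamVec} (hθ : θ ∈ admissibleParams) (r : ℝ) :
    prelecExponent θ r = tNegLog θ r ^ θ 3 := by
  rw [prelecExponent, Real.rpow_def_of_pos (tNegLog_pos hθ r), mul_comm]

lemma prelecExponent_le {θ : ParamVec} (hθ : θ ∈ admissibleParams) (r : ℝ) :
    prelecExponent θ r ≤ 1 + tNegLog θ r := by
  rw [prelecExponent_eq hθ]
  have hL := tNegLog_pos hθ r
  rcases le_total (tNegLog θ r) 1 with h | h
  · linarith [Real.rpow_le_one hL.le h hθ.2.2.1.le]
  · have := Real.rpow_le_rpow_of_exponent_le h hθ.2.2.2.le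
    rw [Real.rpow_one] at this
    linarith

/-- The explicit logarithm of the behavioral density. -/
noncomputable def logBehavioral (θ : ParamVec) (r : ℝ) : ℝ :=
  Real.log (θ 3) + (θ 3 - 1) * Real.log (tNegLog θ r) - prelecExponent θ r + tNegLog θ r
    + Real.log (tDensity θ r)

/-- All summands except $L^\alpha$ have rate `logGrowth`. The squared rate is forced by
$\exp(\alpha\log L)$, since differentiating in $\alpha$ brings down $\log L$, itself of logarithmic
size. -/
lemma derivBound_logBehavioral : DerivBound admissibleParams 0 (fun r => logGrowth r * logGrowth r)
    (fun _ r => logGrowth r) logBehavioral := by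
  have hU := isOpen_admissibleParams
  have hM2 (r : ℝ) : 0 ≤ logGrowth r * logGrowth r := mul_self_nonneg _
  have hM (r : ℝ) : logGrowth r ≤ logGrowth r * logGrowth r :=
    le_mul_of_one_le_left (logGrowth_nonneg r) (one_le_logGrowth r)
  have hone (r : ℝ) : 1 ≤ logGrowth r * logGrowth r := (one_le_logGrowth r).trans (hM r)
  have c3 := contDiffOn_coord 3 admissibleParams
  have hparam (φ : ParamVec → ℝ) (hφ : ContDiffOn ℝ ∞ φ admissibleParams) :
      DerivBound admissibleParams 0 logGrowth (fun _ _ => 1) (fun θ (_ : ℝ) => φ θ) :=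
    (DerivBound.of_contDiffOn hU hφ).mono_rate (fun _ => zero_le_one) one_le_logGrowth
      fun _ _ _ => zero_le_one
  have hprod (φ : ParamVec → ℝ) (hφ : ContDiffOn ℝ ∞ φ admissibleParams) :
      DerivBound admissibleParams 0 logGrowth (fun _ r => logGrowth r)
        (fun θ r => φ θ * Real.log (tNegLog θ r)) := by
    simpa only [one_mul] using (hparam φ hφ).mul hU derivBound_log_tNegLog
  have hraise {h : ParamVec → ℝ → ℝ} (H : DerivBound admissibleParams 0 logGrowth
      (fun _ r => logGrowth r) h) : DerivBound admissibleParams 0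
        (fun r => logGrowth r * logGrowth r) (fun _ r => logGrowth r) h :=
    H.mono_rate logGrowth_nonneg hM fun _ _ r => logGrowth_nonneg r
  have hexp : DerivBound admissibleParams 0 (fun r => logGrowth r * logGrowth r)
      (fun _ r => logGrowth r) prelecExponent := by
    -- The weight produced by `exp` is $L^\alpha$ itself, and $L^\alpha\le 1+L$ brings it back to
    -- logarithmic size.
    refine ((((hprod _ c3).of_le zero_le_one).absorb logGrowth_nonneg one_le_logGrowth).exp
      hU hM2).mono_weight hM2 fun K hK hKc => ?_
    obtain ⟨C, hC, hb⟩ := exists_tNegLog_le hK hKc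
    refine ⟨1 + C, by positivity, fun θ hθ r => ?_⟩
    have := prelecExponent_le (hK hθ) r
    unfold prelecExponent at this
    nlinarith [hb θ hθ r, one_le_logGrowth r]
  have hL : DerivBound admissibleParams 0 logGrowth (fun _ r => logGrowth r) tNegLog :=
    derivBound_tNegLog.mono_weight logGrowth_nonneg fun K hK hKc => by
      obtain ⟨C, hC, hb⟩ := exists_tNegLog_le hK hKc
      exact ⟨C, by linarith, hb⟩
  have hα : DerivBound admissibleParams 0 logGrowth (fun _ r => logGrowth r)
      (fun θ (_ : ℝ) => Real.log (θ 3)) :=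
    (hparam _ (c3.log fun θ hθ => hθ.2.2.1.ne')).mono_weight logGrowth_nonneg
      fun K _ _ => one_weight_le_logGrowth K
  have hf : DerivBound admissibleParams 0 logGrowth (fun _ r => logGrowth r)
      (fun θ x => Real.log (tDensity θ x)) :=
    derivBound_one_log_tDensity_aux.mono_rate (fun _ => zero_le_one) one_le_logGrowth
      fun _ _ r => logGrowth_nonneg r
  exact (((((hraise hα).add hU (hraise (hprod _ (c3.sub contDiffOn_const)))).sub hU hexp).add hU
    (hraise hL)).add hU (hraise hf))

end NegLog

/-! ### The behavioral density, its tails and its mass -/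

section Behavioral

open scoped ContDiff

lemma hasDerivAt_tLower {θ : ParamVec} (hθ : θ ∈ admissibleParams) (r : ℝ) :
    HasDerivAt (tLower θ) (tDensity θ r) r := by
  have hi := integrable_tDensity hθ
  have h1 := (intervalIntegral.integral_hasDerivAt_right (a := 0) (b := r) hi.intervalIntegrable
    ((continuous_tDensity hθ).stronglyMeasurableAtFilter _ _)
    (continuous_tDensity hθ).continuousAt).const_add (tLower θ 0)
  refine h1.congr_of_eventuallyEq (Eventually.of_forall fun u => ?_)
  simp only [tLower]
  rw [← intervalIntegral.integral_Iic_sub_Iic hi.integrableOn hi.integrableOn]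
  ring

lemma behavioralCDF_eq {θ : ParamVec} (hθ : θ ∈ admissibleParams) (r : ℝ) :
    behavioralCDF θ r = Real.exp (-prelecExponent θ r) := by
  rw [prelecExponent_eq hθ]
  have h : studentTCDF (θ 2) (θ 0) (θ 1) r = tLower θ r := rfl
  rw [behavioralCDF, prelecWeight, h, if_neg (tLower_pos hθ r).not_ge]
  rfl

lemma hasDerivAt_tNegLog {θ : ParamVec} (hθ : θ ∈ admissibleParams) (r : ℝ) :
    HasDerivAt (tNegLog θ) (-(tDensity θ r / tLower θ r)) r :=
  ((hasDerivAt_tLower hθ r).log (tLower_pos hθ r).ne').neg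

/-- The chain rule gives $e^{-L^\alpha}\alpha L^{\alpha-1}f/F$; writing $1/F=e^L$ turns it into the
exponential of a sum. -/
lemma hasDerivAt_behavioralCDF {θ : ParamVec} (hθ : θ ∈ admissibleParams) (r : ℝ) :
    HasDerivAt (behavioralCDF θ) (Real.exp (logBehavioral θ r)) r := by
  have hL := tNegLog_pos hθ r
  have hα := hθ.2.2.1
  have h1 := ((((hasDerivAt_tNegLog hθ r).log hL.ne').const_mul (θ 3)).exp.neg).exp
  have h2 : HasDerivAt (behavioralCDF θ) _ r :=
    h1.congr_of_eventuallyEq (Eventually.of_forall fun u => behavioralCDF_eq hθ u)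
  refine h2.congr_deriv ?_
  change Real.exp (-prelecExponent θ r) * _ = _
  have e1 : logBehavioral θ r = Real.log (θ 3) + θ 3 * Real.log (tNegLog θ r) +
      -Real.log (tNegLog θ r) + -prelecExponent θ r + tNegLog θ r + Real.log (tDensity θ r) := by
    unfold logBehavioral; ring
  rw [e1]
  simp only [Real.exp_add]
  rw [Real.exp_log hα, Real.exp_neg (Real.log (tNegLog θ r)), Real.exp_log hL,
    Real.exp_log (tDensity_pos hθ r), tNegLog, Real.exp_neg (Real.log (tLower θ r)),
    Real.exp_log (tLower_pos hθ r)]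
  field_simp

lemma behavioralPDF_eq {θ : ParamVec} (hθ : θ ∈ admissibleParams) (r : ℝ) :
    behavioralPDF θ r = Real.exp (logBehavioral θ r) := (hasDerivAt_behavioralCDF hθ r).deriv

lemma behavioralPDF_pos {θ : ParamVec} (hθ : θ ∈ admissibleParams) (r : ℝ) :
    0 < behavioralPDF θ r := by rw [behavioralPDF_eq hθ]; exact Real.exp_pos _

lemma log_behavioralPDF {θ : ParamVec} (hθ : θ ∈ admissibleParams) (r : ℝ) :
    Real.log (behavioralPDF θ r) = logBehavioral θ r := by
  rw [behavioralPDF_eq hθ, Real.log_exp]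

lemma continuous_logBehavioral {θ : ParamVec} (hθ : θ ∈ admissibleParams) :
    Continuous (logBehavioral θ) := by
  have hL : Continuous (tNegLog θ) :=
    continuous_iff_continuousAt.2 fun r => (hasDerivAt_tNegLog hθ r).continuousAt
  have hlL : Continuous fun r => Real.log (tNegLog θ r) := hL.log fun r => (tNegLog_pos hθ r).ne'
  have hlf : Continuous fun r => Real.log (tDensity θ r) :=
    (continuous_tDensity hθ).log fun r => (tDensity_pos hθ r).ne'
  have hE : Continuous (prelecExponent θ) := (hlL.const_mul (θ 3)).rexp
  unfold logBehavioral
  fun_prop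

lemma continuous_behavioralPDF {θ : ParamVec} (hθ : θ ∈ admissibleParams) :
    Continuous (behavioralPDF θ) := by
  rw [funext (behavioralPDF_eq hθ)]
  exact (continuous_logBehavioral hθ).rexp

/-- The cube is the squared rate of `derivBound_logBehavioral` times its logarithmic weight,
absorbed into the rate. -/
lemma derivBound_log_behavioralPDF :
    DerivBound admissibleParams 1 (fun r => logGrowth r ^ 3) (fun _ _ => 1)
      (fun θ r => Real.log (behavioralPDF θ r)) := by
  have h := ((derivBound_logBehavioral.of_le zero_le_one).absorb
    (fun r => mul_self_nonneg (logGrowth r)) one_le_logGrowth).congr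
      (fun θ hθ r => log_behavioralPDF hθ r)
  simpa only [pow_succ, pow_zero, one_mul] using h

lemma exists_abs_log_behavioralPDF_le {K : Set ParamVec} (hK : K ⊆ admissibleParams)
    (hKc : IsCompact K) :
    ∃ C, 0 ≤ C ∧ ∀ θ ∈ K, ∀ r, |Real.log (behavioralPDF θ r)| ≤ C * logGrowth r := by
  obtain ⟨C, hC, hb⟩ := derivBound_logBehavioral.bound_zero hK hKc
  exact ⟨C, hC, fun θ hθ r => by rw [log_behavioralPDF (hK hθ)]; exact hb θ hθ r⟩

lemma derivBound_behavioralPDF :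
    DerivBound admissibleParams 0 (fun r => logGrowth r ^ 3) behavioralPDF behavioralPDF := by
  have hM (r : ℝ) : 0 ≤ logGrowth r ^ 3 := pow_nonneg (logGrowth_nonneg r) 3
  have heq : ∀ θ ∈ admissibleParams, ∀ r, behavioralPDF θ r =
      Real.exp (Real.log (behavioralPDF θ r)) :=
    fun θ hθ r => (Real.exp_log (behavioralPDF_pos hθ r)).symm
  refine ((derivBound_log_behavioralPDF.exp isOpen_admissibleParams hM).congr
    heq).mono_weight hM fun K hK _ => ⟨1, zero_le_one, fun θ hθ r => ?_⟩
  rw [one_mul, ← heq θ (hK hθ) r]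

/-- An integrable envelope which decays only slightly faster than `1 / |x|`. -/
noncomputable def logEnvelope (x : ℝ) : ℝ := ((1 + |x|) * logGrowth x ^ 2)⁻¹

/-- On the half-line the primitive is $-1/(1+\log(1+x))$, which converges at infinity; the resulting
nonzero integral yields integrability. -/
lemma integrable_logEnvelope : Integrable logEnvelope := by
  set f : ℝ → ℝ := fun x => ((1 + x) * (1 + Real.log (1 + x)) ^ 2)⁻¹ with hf
  have hd (x : ℝ) (hx : x ∈ Set.Ioi (0 : ℝ)) :
      HasDerivAt (fun x : ℝ => -(1 + Real.log (1 + x))⁻¹) (f x) x := by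
    have hx : 0 < x := hx
    have hlog : 0 ≤ Real.log (1 + x) := Real.log_nonneg (by linarith)
    have h1 : HasDerivAt (fun x : ℝ => 1 + Real.log (1 + x)) (1 + x)⁻¹ x := by
      have := (((hasDerivAt_id x).const_add 1).log (by simp; linarith)).const_add 1
      simpa using this
    have h2 := (h1.inv (by linarith)).neg
    refine h2.congr_deriv ?_
    rw [hf]
    field_simp
  have ht : Tendsto (fun x : ℝ => -(1 + Real.log (1 + x))⁻¹) atTop (𝓝 0) := by
    have h1 : Tendsto (fun x : ℝ => 1 + Real.log (1 + x)) atTop atTop :=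
      tendsto_atTop_add_const_left _ _ (Real.tendsto_log_atTop.comp
        (tendsto_atTop_add_const_left _ _ tendsto_id))
    simpa using h1.inv_tendsto_atTop.neg
  have hc : ContinuousWithinAt (fun x : ℝ => -(1 + Real.log (1 + x))⁻¹) (Set.Ici 0) 0 := by
    refine ContinuousAt.continuousWithinAt ?_
    have : ContinuousAt (fun x : ℝ => 1 + Real.log (1 + x)) 0 :=
      continuousAt_const.add ((continuousAt_const.add continuousAt_id).log (by simp))
    exact (this.inv₀ (by simp)).neg
  have hpos : ∀ x ∈ Set.Ioi (0 : ℝ), 0 ≤ f x := fun x hx => by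
    have hx : 0 < x := hx
    simp only [hf]; positivity
  have hval := integral_Ioi_of_hasDerivAt_of_nonneg hc hd hpos ht
  have habs : (fun x => f |x|) = logEnvelope := by
    ext x; simp only [hf, logEnvelope, logGrowth]
  rw [← habs]
  refine Integrable.of_integral_ne_zero ?_
  rw [integral_comp_abs, hval]
  simp

lemma logEnvelope_pos (x : ℝ) : 0 < logEnvelope x := by
  have := one_le_logGrowth x
  unfold logEnvelope
  positivity

/-- Applied with `m = logGrowth r`: the Prelec factor $\exp(-cM^b)$ dominates every power of $M$,
however small $b$ is. It suffices to take the term of order $k\ge n/b$ of the exponential series. -/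
lemma exists_pow_mul_exp_neg_rpow_le (n : ℕ) {b c : ℝ} (hb : 0 < b) (hc : 0 < c) :
    ∃ C, 0 ≤ C ∧ ∀ m : ℝ, 1 ≤ m → m ^ n ≤ C * Real.exp (c * m ^ b) := by
  obtain ⟨k, hk⟩ := exists_nat_ge (n / b)
  refine ⟨k.factorial / c ^ k, by positivity, fun m hm => ?_⟩
  have h1 : m ^ n ≤ (m ^ b) ^ k := by
    rw [← Real.rpow_natCast, ← Real.rpow_mul_natCast (by linarith)]
    exact Real.rpow_le_rpow_of_exponent_le hm (by rwa [div_le_iff₀' hb] at hk)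
  have h2 := Real.pow_div_factorial_le_exp (x := c * m ^ b) (by positivity) k
  rw [mul_pow, div_le_iff₀ (by positivity)] at h2
  calc m ^ n ≤ (m ^ b) ^ k := h1
    _ ≤ Real.exp (c * m ^ b) * k.factorial / c ^ k := by
        rw [le_div_iff₀ (by positivity)]; linarith
    _ = _ := by ring

/-- Left tail of the behavioral log-density. -/
lemma exists_logBehavioral_left_le {K : Set ParamVec} (hK : K ⊆ admissibleParams)
    (hKc : IsCompact K) :
    ∃ b c C : ℝ, 0 < b ∧ 0 < c ∧ ∀ θ ∈ K, ∀ r ≤ 0,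
      logBehavioral θ r ≤ C - Real.log (1 + |r|) - c * logGrowth r ^ b := by
  obtain ⟨C₁, hC₁, h₁⟩ := exists_tNegLog_left hK hKc
  obtain ⟨C₂, hC₂, h₂⟩ := exists_le_tLower hK hKc
  obtain ⟨C₃, hC₃, h₃⟩ := exists_abs_log_tDensity_le hK hKc
  obtain ⟨B, hB, hBd⟩ := exists_param_bounds hK hKc
  -- `B⁻¹` is a uniform lower bound for $\alpha$, and `C₁` compares $L$ with `logGrowth`;
  -- $C_1^\alpha\le C_1$ because $\alpha<1$.
  refine ⟨B⁻¹, C₁⁻¹, Real.log C₁ + Real.log C₂ + C₃, by positivity, by positivity,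
    fun θ hθ r hr => ?_⟩
  have hL := tNegLog_pos (hK hθ) r
  have hM := one_le_logGrowth r
  obtain ⟨h1, h2, h3, h4⟩ := hK hθ
  have hlC := Real.log_nonneg hC₁
  have e1 : Real.log (θ 3) ≤ 0 := Real.log_nonpos h3.le h4.le
  have e2 : (θ 3 - 1) * Real.log (tNegLog θ r) ≤ Real.log C₁ := by
    have e := Real.log_le_log one_pos (hM.trans (h₁ θ hθ r hr).2)
    rw [Real.log_mul (by positivity) hL.ne', Real.log_one] at e
    nlinarith
  have e3 : C₁⁻¹ * logGrowth r ^ B⁻¹ ≤ prelecExponent θ r := by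
    rw [prelecExponent_eq (hK hθ)]
    have a1 : logGrowth r ^ B⁻¹ ≤ logGrowth r ^ θ 3 :=
      Real.rpow_le_rpow_of_exponent_le hM (hBd θ hθ).2.2.2.2.1
    have a2 : logGrowth r ^ θ 3 ≤ (C₁ * tNegLog θ r) ^ θ 3 :=
      Real.rpow_le_rpow (by linarith) (h₁ θ hθ r hr).2 h3.le
    rw [Real.mul_rpow (by linarith) hL.le] at a2
    have a3 : C₁ ^ θ 3 ≤ C₁ := by
      simpa using Real.rpow_le_rpow_of_exponent_le hC₁ h4.le
    have a4 : 0 ≤ tNegLog θ r ^ θ 3 := by positivity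
    rw [inv_mul_le_iff₀ (by linarith)]
    nlinarith
  -- The term $\nu\log(1+|r|)$ cancels against the exponent $-(\nu+1)$ of the Student density,
  -- leaving exactly $-\log(1+|r|)$.
  have e4 : tNegLog θ r ≤ Real.log C₂ + θ 2 * Real.log (1 + |r|) := by
    have e := Real.log_le_log (by positivity) (h₂ θ hθ r hr)
    rw [Real.log_rpow (by positivity), Real.log_mul (by positivity) (tLower_pos (hK hθ) r).ne'] at e
    unfold tNegLog; linarith
  have e5 := (abs_le.1 (h₃ θ hθ r)).2
  unfold logBehavioral
  linarith

/-- Right tail of the behavioral log-density. -/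
lemma exists_logBehavioral_right_le {K : Set ParamVec} (hK : K ⊆ admissibleParams)
    (hKc : IsCompact K) :
    ∃ b C : ℝ, 0 < b ∧ ∀ θ ∈ K, ∀ r, 0 ≤ r →
      logBehavioral θ r ≤ C - Real.log (1 + |r|) - b * Real.log (1 + |r|) := by
  obtain ⟨C₁, hC₁, h₁⟩ := exists_tNegLog_right hK hKc
  obtain ⟨C₃, hC₃, h₃⟩ := exists_abs_log_tDensity_le hK hKc
  obtain ⟨B, hB, hBd⟩ := exists_param_bounds hK hKc
  refine ⟨B⁻¹, Real.log C₁ + C₁ + C₃, by positivity, fun θ hθ r hr => ?_⟩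
  have hL := tNegLog_pos (hK hθ) r
  have hb := (hBd θ hθ).2.2.2.2.1
  obtain ⟨h1, h2, h3, h4⟩ := hK hθ
  have hlC := Real.log_nonneg hC₁
  have hlr : 0 ≤ Real.log (1 + |r|) := Real.log_nonneg (by linarith [abs_nonneg r])
  have e1 : Real.log (θ 3) ≤ 0 := Real.log_nonpos h3.le h4.le
  have e2 : (θ 3 - 1) * Real.log (tNegLog θ r) ≤
      Real.log C₁ + (1 - θ 3) * (θ 2 * Real.log (1 + |r|)) := by
    have e := Real.log_le_log (by positivity) (h₁ θ hθ r hr).2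
    rw [Real.log_rpow (by positivity), Real.log_mul (by positivity) hL.ne'] at e
    nlinarith
  have e3 := (prelecExponent_pos θ r).le
  have e4 := (h₁ θ hθ r hr).1
  have e5 := (abs_le.1 (h₃ θ hθ r)).2
  -- The exponents add up to $(1-\alpha)\nu-(\nu+1)=-1-\alpha\nu$, and $\alpha\nu\ge\alpha\ge
  -- B^{-1}$.
  have e6 : B⁻¹ * Real.log (1 + |r|) ≤ θ 3 * θ 2 * Real.log (1 + |r|) := by
    gcongr; nlinarith
  unfold logBehavioral
  nlinarith

/-- The domination used in every later exchange of derivative and integral. Both tail bounds have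
the form $1/(1+|r|)$ times a factor that outweighs all logarithms. -/
lemma exists_logGrowth_pow_mul_behavioralPDF_le {K : Set ParamVec} (hK : K ⊆ admissibleParams)
    (hKc : IsCompact K) (n : ℕ) :
    ∃ C, 0 ≤ C ∧ ∀ θ ∈ K, ∀ r, logGrowth r ^ n * behavioralPDF θ r ≤ C * logEnvelope r := by
  obtain ⟨b, c, C₁, hb, hc, h₁⟩ := exists_logBehavioral_left_le hK hKc
  obtain ⟨b', C₂, hb', h₂⟩ := exists_logBehavioral_right_le hK hKc
  -- Two more logarithms than required, to create the squared logarithm in the envelope.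
  obtain ⟨A₁, hA₁, hl₁⟩ := exists_pow_mul_exp_neg_rpow_le (n + 2) hb hc
  obtain ⟨A₂, hA₂, hl₂⟩ := exists_logGrowth_pow_mul_le (n + 2) hb'
  have hfac (θ : ParamVec) (hθ : θ ∈ K) (r A C d : ℝ) (hA : 0 ≤ A)
      (h : logBehavioral θ r ≤ C - Real.log (1 + |r|) - d)
      (hd : logGrowth r ^ (n + 2) ≤ A * Real.exp d) :
      logGrowth r ^ n * behavioralPDF θ r ≤ Real.exp C * A * logEnvelope r := by
    have hM := one_le_logGrowth r
    have hr : 0 < 1 + |r| := by positivity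
    have h1 : behavioralPDF θ r ≤ Real.exp C * (1 + |r|)⁻¹ * (Real.exp d)⁻¹ := by
      rw [behavioralPDF_eq (hK hθ)]
      refine (Real.exp_le_exp.2 h).trans_eq ?_
      rw [Real.exp_sub, Real.exp_sub, Real.exp_log hr]
      field_simp
    calc _ ≤ logGrowth r ^ n * (Real.exp C * (1 + |r|)⁻¹ * (Real.exp d)⁻¹) := by gcongr
      _ = (Real.exp C * (1 + |r|)⁻¹ * (Real.exp d)⁻¹ * (logGrowth r ^ 2)⁻¹) *
          logGrowth r ^ (n + 2) := by rw [pow_add]; field_simp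
      _ ≤ (Real.exp C * (1 + |r|)⁻¹ * (Real.exp d)⁻¹ * (logGrowth r ^ 2)⁻¹) *
          (A * Real.exp d) := by gcongr
      _ = _ := by unfold logEnvelope; rw [mul_inv]; field_simp
  refine ⟨Real.exp C₁ * A₁ + Real.exp C₂ * A₂, by positivity, fun θ hθ r => ?_⟩
  have hE := (logEnvelope_pos r).le
  rcases le_total r 0 with hr | hr
  · refine (hfac θ hθ r A₁ C₁ _ hA₁ (h₁ θ hθ r hr) (hl₁ _ (one_le_logGrowth r))).trans ?_
    gcongr
    linarith [(by positivity : 0 ≤ Real.exp C₂ * A₂)]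
  · refine (hfac θ hθ r A₂ C₂ _ hA₂ (h₂ θ hθ r hr) ?_).trans ?_
    · have := hl₂ 0 r (by simp)
      simp only [abs_zero, add_zero, Real.one_rpow, mul_one] at this
      rw [show logGrowth 0 = 1 by simp [logGrowth], one_pow, one_mul,
        Real.rpow_def_of_pos (by positivity)] at this
      rwa [mul_comm b']
    · gcongr
      linarith [(by positivity : 0 ≤ Real.exp C₁ * A₁)]

lemma integrable_logGrowth_pow_mul_behavioralPDF {θ : ParamVec} (hθ : θ ∈ admissibleParams)
    (n : ℕ) : Integrable fun r => logGrowth r ^ n * behavioralPDF θ r := by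
  obtain ⟨C, hC, hb⟩ := exists_logGrowth_pow_mul_behavioralPDF_le (K := {θ}) (by simpa using hθ)
    isCompact_singleton n
  refine (integrable_logEnvelope.const_mul C).mono'
    ((continuous_logGrowth.pow n).mul (continuous_behavioralPDF hθ)).aestronglyMeasurable
    (ae_of_all _ fun x => ?_)
  have := behavioralPDF_pos hθ x
  have := logGrowth_nonneg x
  rw [Real.norm_of_nonneg (by positivity)]
  exact hb θ rfl x

lemma integrable_behavioralPDF {θ : ParamVec} (hθ : θ ∈ admissibleParams) :
    Integrable (behavioralPDF θ) := by
  simpa using integrable_logGrowth_pow_mul_behavioralPDF hθ 0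

lemma tendsto_tLower_atTop {θ : ParamVec} (hθ : θ ∈ admissibleParams) :
    Tendsto (tLower θ) atTop (𝓝 1) := by
  rw [← integral_tDensity hθ]
  exact (aecover_Iic tendsto_id).integral_tendsto_of_countably_generated (integrable_tDensity hθ)

lemma tendsto_tLower_atBot {θ : ParamVec} (hθ : θ ∈ admissibleParams) :
    Tendsto (tLower θ) atBot (𝓝[>] 0) := by
  have h : Tendsto (tUpper θ) atBot (𝓝 1) := by
    rw [← integral_tDensity hθ]
    exact (aecover_Ioi tendsto_id).integral_tendsto_of_countably_generated (integrable_tDensity hθ)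
  have h2 : Tendsto (tLower θ) atBot (𝓝 0) := by
    have := h.const_sub 1
    rw [sub_self] at this
    exact this.congr fun r => by linarith [tLower_add_tUpper hθ r]
  exact tendsto_nhdsWithin_iff.2 ⟨h2, Eventually.of_forall fun r => tLower_pos hθ r⟩

lemma tendsto_behavioralCDF_atTop {θ : ParamVec} (hθ : θ ∈ admissibleParams) :
    Tendsto (behavioralCDF θ) atTop (𝓝 1) := by
  have h1 : Tendsto (tNegLog θ) atTop (𝓝 0) := by
    have := ((tendsto_tLower_atTop hθ).log one_ne_zero).neg
    rw [Real.log_one, neg_zero] at this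
    exact this
  have h2 := (h1.rpow_const (p := θ 3) (Or.inr hθ.2.2.1.le)).neg.rexp
  rw [Real.zero_rpow hθ.2.2.1.ne', neg_zero, Real.exp_zero] at h2
  exact h2.congr fun r => by rw [behavioralCDF_eq hθ, prelecExponent_eq hθ]

lemma tendsto_behavioralCDF_atBot {θ : ParamVec} (hθ : θ ∈ admissibleParams) :
    Tendsto (behavioralCDF θ) atBot (𝓝 0) := by
  have h1 : Tendsto (tNegLog θ) atBot atTop :=
    tendsto_neg_atBot_atTop.comp (Real.tendsto_log_nhdsGT_zero.comp (tendsto_tLower_atBot hθ))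
  have h2 := Real.tendsto_exp_neg_atTop_nhds_zero.comp ((tendsto_rpow_atTop hθ.2.2.1).comp h1)
  exact h2.congr fun r => by
    simp only [Function.comp]
    rw [behavioralCDF_eq hθ, prelecExponent_eq hθ]

lemma hasDerivAt_behavioralCDF' {θ : ParamVec} (hθ : θ ∈ admissibleParams) (r : ℝ) :
    HasDerivAt (behavioralCDF θ) (behavioralPDF θ r) r := by
  rw [behavioralPDF_eq hθ]; exact hasDerivAt_behavioralCDF hθ r

lemma setIntegral_Iic_behavioralPDF {θ : ParamVec} (hθ : θ ∈ admissibleParams) (r : ℝ) :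
    ∫ x in Set.Iic r, behavioralPDF θ x = behavioralCDF θ r := by
  rw [integral_Iic_of_hasDerivAt_of_tendsto
    (hasDerivAt_behavioralCDF' hθ r).continuousAt.continuousWithinAt
    (fun x _ => hasDerivAt_behavioralCDF' hθ x) (integrable_behavioralPDF hθ).integrableOn
    (tendsto_behavioralCDF_atBot hθ), sub_zero]

lemma integral_behavioralPDF {θ : ParamVec} (hθ : θ ∈ admissibleParams) :
    ∫ x, behavioralPDF θ x = 1 := by
  rw [integral_of_hasDerivAt_of_tendsto (hasDerivAt_behavioralCDF' hθ)
    (integrable_behavioralPDF hθ) (tendsto_behavioralCDF_atBot hθ)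
    (tendsto_behavioralCDF_atTop hθ), sub_zero]

end Behavioral

/-! ### Global identification and Gibbs' inequality -/

section Identification

open scoped ContDiff

lemma tendsto_logGrowth_atBot : Tendsto logGrowth atBot atTop :=
  tendsto_atTop_add_const_left _ _ (Real.tendsto_log_atTop.comp
    (tendsto_atTop_add_const_left _ _ tendsto_abs_atBot_atTop))

/-- A linear function of an unbounded quantity which is bounded above has nonpositive slope. -/
lemma nonpos_of_mul_le_of_tendsto {ι : Type*} {l : Filter ι} [l.NeBot] {u : ι → ℝ} {a C : ℝ}
    (hu : Tendsto u l atTop) (h : ∀ᶠ i in l, a * u i ≤ C) : a ≤ 0 := by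
  by_contra! ha
  obtain ⟨i, h1, h2⟩ := (h.and ((hu.const_mul_atTop ha).eventually_gt_atTop C)).exists
  linarith

/-- The tail exponent determines $\nu$. The kernels are then proportional, and both have minimum
$1$, so they coincide; the point where the value is $1$ gives $\mu$, one further value gives
$\sigma$. -/
lemma eq_of_tDensity_eq {θ₁ θ₂ : ParamVec} (h₁ : θ₁ ∈ admissibleParams)
    (h₂ : θ₂ ∈ admissibleParams) (h : ∀ x, tDensity θ₁ x = tDensity θ₂ x) :
    θ₁ 0 = θ₂ 0 ∧ θ₁ 1 = θ₂ 1 ∧ θ₁ 2 = θ₂ 2 := by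
  have hν : θ₁ 2 = θ₂ 2 := by
    obtain ⟨C, hC, hb⟩ := exists_abs_log_tDensity_le (K := {θ₁, θ₂})
      (by rintro θ (rfl | rfl) <;> assumption) (by simp)
    have key : ∀ x, |(θ₁ 2 - θ₂ 2) * Real.log (1 + |x|)| ≤ 2 * C := fun x => by
      have a1 := abs_le.1 (hb θ₁ (by simp) x)
      have a2 := abs_le.1 (hb θ₂ (by simp) x)
      rw [h x] at a1
      rw [abs_le]; constructor <;> linarith [a1.1, a1.2, a2.1, a2.2]
    have ht : Tendsto (fun x : ℝ => Real.log (1 + |x|)) atBot atTop :=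
      Real.tendsto_log_atTop.comp (tendsto_atTop_add_const_left _ _ tendsto_abs_atBot_atTop)
    have l1 := nonpos_of_mul_le_of_tendsto ht (Eventually.of_forall fun x => (abs_le.1 (key x)).2)
    have l2 := nonpos_of_mul_le_of_tendsto (a := θ₂ 2 - θ₁ 2) (C := 2 * C) ht
      (Eventually.of_forall fun x => by linarith [(abs_le.1 (key x)).1])
    linarith
  have hk1 (x : ℝ) := one_le_tKernel h₁ x
  have hk2 (x : ℝ) := one_le_tKernel h₂ x
  have hp : 0 < (θ₂ 2 + 1) / 2 := by linarith [h₂.2.1]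
  obtain ⟨k, hk, hD⟩ : ∃ k : ℝ, 0 < k ∧ ∀ x, tKernel θ₁ x = k * tKernel θ₂ x := by
    refine ⟨Real.exp ((tLogConst θ₁ - tLogConst θ₂) / ((θ₂ 2 + 1) / 2)), Real.exp_pos _,
      fun x => ?_⟩
    have e := congrArg Real.log (h x)
    rw [log_tDensity h₁, log_tDensity h₂, hν] at e
    have e2 : Real.log (tKernel θ₁ x) = (tLogConst θ₁ - tLogConst θ₂) / ((θ₂ 2 + 1) / 2) +
        Real.log (tKernel θ₂ x) := by
      rw [div_add' _ _ _ hp.ne', eq_div_iff hp.ne']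
      linarith
    rw [← Real.exp_log (zero_lt_one.trans_le (hk1 x)), e2, Real.exp_add,
      Real.exp_log (zero_lt_one.trans_le (hk2 x))]
  have e1 : tKernel θ₁ (θ₁ 0) = 1 := by simp [tKernel]
  have e2 : tKernel θ₂ (θ₂ 0) = 1 := by simp [tKernel]
  have hk1' : k = 1 := by
    have a1 := hD (θ₁ 0)
    have a2 := hD (θ₂ 0)
    rw [e1] at a1
    rw [e2] at a2
    refine le_antisymm ?_ ?_
    · nlinarith [hk2 (θ₁ 0)]
    · linarith [hk1 (θ₂ 0)]
  subst hk1'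
  simp only [one_mul] at hD
  have s1 : 0 < θ₁ 2 * θ₁ 1 ^ 2 := mul_pos (by linarith [h₁.2.1]) (pow_pos h₁.1 2)
  have s2 : 0 < θ₂ 2 * θ₂ 1 ^ 2 := mul_pos (by linarith [h₂.2.1]) (pow_pos h₂.1 2)
  have hμ : θ₁ 0 = θ₂ 0 := by
    have a := hD (θ₁ 0)
    rw [e1, tKernel] at a
    have : (θ₁ 0 - θ₂ 0) ^ 2 / (θ₂ 2 * θ₂ 1 ^ 2) = 0 := by linarith
    rw [div_eq_zero_iff] at this
    have := this.resolve_right s2.ne'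
    have := pow_eq_zero_iff two_ne_zero |>.1 this
    linarith
  refine ⟨hμ, ?_, hν⟩
  have a := hD (θ₁ 0 + 1)
  simp only [tKernel, hμ, add_sub_cancel_left, one_pow, add_right_inj] at a
  have a' : θ₁ 2 * θ₁ 1 ^ 2 = θ₂ 2 * θ₂ 1 ^ 2 := by
    rwa [one_div, one_div, inv_inj] at a
  rw [hν] at a'
  have hν0 : θ₂ 2 ≠ 0 := by linarith [h₂.2.1]
  exact (pow_left_inj₀ h₁.1.le h₂.1.le two_ne_zero).1 (mul_left_cancel₀ hν0 a')

/-- Equality of the exponents says $\alpha_1\log L_1=\alpha_2\log L_2$, while on the left both $\log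
L_i$ equal the logarithm of `logGrowth` up to a bounded error. Since that is unbounded, the slopes
compare. -/
lemma prelec_alpha_le {θ₁ θ₂ : ParamVec} (h₁ : θ₁ ∈ admissibleParams)
    (h₂ : θ₂ ∈ admissibleParams) (h : ∀ r, prelecExponent θ₁ r = prelecExponent θ₂ r) :
    θ₁ 3 ≤ θ₂ 3 := by
  obtain ⟨C, hC, hb⟩ := exists_tNegLog_left (K := {θ₁, θ₂})
      (by rintro θ (rfl | rfl) <;> assumption) (by simp)
  have ht : Tendsto (fun r => Real.log (logGrowth r)) atBot atTop :=
    Real.tendsto_log_atTop.comp tendsto_logGrowth_atBot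
  have hlC := Real.log_nonneg hC
  have := nonpos_of_mul_le_of_tendsto (a := θ₁ 3 - θ₂ 3) (C := θ₁ 3 * Real.log C + θ₂ 3 * Real.log C)
    ht ((eventually_le_atBot 0).mono fun r hr => ?_)
  · linarith
  have hM := one_le_logGrowth r
  have L1 := tNegLog_pos h₁ r
  have L2 := tNegLog_pos h₂ r
  have e1 := Real.log_le_log (by linarith) (hb θ₁ (by simp) r hr).2
  have e2 := Real.log_le_log L2 (hb θ₂ (by simp) r hr).1
  rw [Real.log_mul (by linarith) (by linarith)] at e1 e2
  have e3 := Real.exp_injective (h r)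
  nlinarith [h₁.2.2.1, h₂.2.2.1]

/-- The behavioral CDF determines the parameters. -/
lemma eq_of_behavioralCDF_eq {θ₁ θ₂ : ParamVec} (h₁ : θ₁ ∈ admissibleParams)
    (h₂ : θ₂ ∈ admissibleParams) (h : ∀ r, behavioralCDF θ₁ r = behavioralCDF θ₂ r) :
    θ₁ = θ₂ := by
  have hE (r : ℝ) : prelecExponent θ₁ r = prelecExponent θ₂ r := by
    have := h r
    rw [behavioralCDF_eq h₁, behavioralCDF_eq h₂] at this
    exact neg_injective (Real.exp_injective this)
  have hα : θ₁ 3 = θ₂ 3 := le_antisymm (prelec_alpha_le h₁ h₂ hE)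
    (prelec_alpha_le h₂ h₁ fun r => (hE r).symm)
  have hF : tLower θ₁ = tLower θ₂ := by
    ext r
    have e := Real.exp_injective (hE r)
    rw [hα] at e
    have e2 := Real.log_injOn_pos (tNegLog_pos h₁ r) (tNegLog_pos h₂ r)
      (mul_left_cancel₀ h₂.2.2.1.ne' e)
    rw [← exp_neg_tNegLog h₁, ← exp_neg_tNegLog h₂, e2]
  have hf (x : ℝ) : tDensity θ₁ x = tDensity θ₂ x :=
    (hF ▸ hasDerivAt_tLower h₁ x).unique (hasDerivAt_tLower h₂ x)
  obtain ⟨e0, e1, e2⟩ := eq_of_tDensity_eq h₁ h₂ hf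
  ext i
  fin_cases i <;> assumption

/-- Strict Gibbs inequality. -/
lemma integral_log_behavioralPDF_lt {θ θ₀ : ParamVec} (hθ : θ ∈ admissibleParams)
    (hθ₀ : θ₀ ∈ admissibleParams) (hne : θ ≠ θ₀) :
    ∫ r, Real.log (behavioralPDF θ r) * behavioralPDF θ₀ r <
      ∫ r, Real.log (behavioralPDF θ₀ r) * behavioralPDF θ₀ r := by
  have hint {θ' : ParamVec} (hθ' : θ' ∈ admissibleParams) :
      Integrable fun r => Real.log (behavioralPDF θ' r) * behavioralPDF θ₀ r := by
    obtain ⟨C, hC, hb⟩ := exists_abs_log_behavioralPDF_le (K := {θ'}) (by simpa using hθ')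
      isCompact_singleton
    refine ((integrable_logGrowth_pow_mul_behavioralPDF hθ₀ 1).const_mul C).mono'
      (((continuous_behavioralPDF hθ').log fun r => (behavioralPDF_pos hθ' r).ne').mul
        (continuous_behavioralPDF hθ₀)).aestronglyMeasurable (ae_of_all _ fun r => ?_)
    have := behavioralPDF_pos hθ₀ r
    rw [norm_mul, Real.norm_eq_abs, Real.norm_of_nonneg this.le, pow_one, ← mul_assoc]
    gcongr
    exact hb θ' rfl r
  by_contra! hcon
  -- With $u=f_\theta/f_{\theta_0}$ this is $f_{\theta_0}(u-1-\log u)\ge0$. As both densities have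
  -- mass $1$, its integral is minus the difference of the expected log-densities; if that
  -- difference is nonnegative, then $u=1$ almost everywhere.
  set φ : ℝ → ℝ := fun r => behavioralPDF θ r - behavioralPDF θ₀ r -
    (Real.log (behavioralPDF θ r) - Real.log (behavioralPDF θ₀ r)) * behavioralPDF θ₀ r with hφ
  have hφeq (r : ℝ) : φ r = behavioralPDF θ₀ r * (behavioralPDF θ r / behavioralPDF θ₀ r - 1 -
      Real.log (behavioralPDF θ r / behavioralPDF θ₀ r)) := by
    have h0 := behavioralPDF_pos hθ₀ r
    have h1 := behavioralPDF_pos hθ r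
    rw [Real.log_div h1.ne' h0.ne', hφ]
    field_simp
  have hφ0 (r : ℝ) : 0 ≤ φ r := by
    rw [hφeq]
    have h0 := behavioralPDF_pos hθ₀ r
    have h1 := behavioralPDF_pos hθ r
    have := Real.log_le_sub_one_of_pos (div_pos h1 h0)
    exact mul_nonneg h0.le (by linarith)
  have hφi : Integrable φ := by
    refine ((integrable_behavioralPDF hθ).sub (integrable_behavioralPDF hθ₀)).sub ?_
    simp_rw [sub_mul]
    exact (hint hθ).sub (hint hθ₀)
  have hval : ∫ r, φ r = -((∫ r, Real.log (behavioralPDF θ r) * behavioralPDF θ₀ r) -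
      ∫ r, Real.log (behavioralPDF θ₀ r) * behavioralPDF θ₀ r) := by
    have i1 : Integrable fun r => behavioralPDF θ r - behavioralPDF θ₀ r :=
      (integrable_behavioralPDF hθ).sub (integrable_behavioralPDF hθ₀)
    have i2 : Integrable fun r => Real.log (behavioralPDF θ r) * behavioralPDF θ₀ r -
        Real.log (behavioralPDF θ₀ r) * behavioralPDF θ₀ r := (hint hθ).sub (hint hθ₀)
    simp only [hφ, sub_mul]
    rw [integral_sub i1 i2, integral_sub (integrable_behavioralPDF hθ)
      (integrable_behavioralPDF hθ₀), integral_sub (hint hθ) (hint hθ₀),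
      integral_behavioralPDF hθ, integral_behavioralPDF hθ₀]
    ring
  have hz : ∫ r, φ r = 0 := le_antisymm (by linarith) (integral_nonneg hφ0)
  have hae := (integral_eq_zero_iff_of_nonneg hφ0 hφi).1 hz
  have hpdf : behavioralPDF θ =ᵐ[volume] behavioralPDF θ₀ := by
    filter_upwards [hae] with r hr
    have h0 := behavioralPDF_pos hθ₀ r
    have h1 := behavioralPDF_pos hθ r
    rw [hφeq, Pi.zero_apply] at hr
    have hr := (mul_eq_zero.1 hr).resolve_left h0.ne'
    by_contra hne'
    have := Real.log_lt_sub_one_of_pos (div_pos h1 h0) (by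
      rw [Ne, div_eq_one_iff_eq h0.ne']; exact hne')
    linarith
  refine hne (eq_of_behavioralCDF_eq hθ hθ₀ fun r => ?_)
  rw [← setIntegral_Iic_behavioralPDF hθ, ← setIntegral_Iic_behavioralPDF hθ₀]
  exact integral_congr_ae (ae_restrict_of_ae hpdf)

end Identification

/-! ### The score and the information equality -/

section ScoreFunction

open scoped ContDiff

lemma DerivBound.fderiv {E X F : Type*} [NormedAddCommGroup E] [NormedSpace ℝ E]
    [NormedAddCommGroup F] [NormedSpace ℝ F] {U : Set E} {ρ : X → ℝ} {w : E → X → ℝ}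
    {h : E → X → F} (hU : IsOpen U) (H : DerivBound U 1 ρ w h) :
    DerivBound U 0 ρ (fun θ x => ρ x * w θ x) (fun θ x => _root_.fderiv ℝ (fun θ => h θ x) θ) :=
  (H.fderivWithin hU).congr fun _ hθ _ => (fderivWithin_of_isOpen hU hθ).symm

/-- Differentiation under the integral sign, with locally uniform domination. -/
lemma hasFDerivAt_integral_of_locally_dominated {E X : Type*} [NormedAddCommGroup E]
    [NormedSpace ℝ E] [FiniteDimensional ℝ E] [MeasurableSpace X] {U : Set E} (hU : IsOpen U)
    {μ : Measure X} {h : E → X → ℝ} (hm : ∀ θ ∈ U, StronglyMeasurable (h θ))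
    (hi : ∀ θ ∈ U, Integrable (h θ) μ) (hd : ∀ x, DifferentiableOn ℝ (fun θ => h θ x) U)
    (hb : ∀ K ⊆ U, IsCompact K → ∃ b : X → ℝ, Integrable b μ ∧ ∀ θ ∈ K, ∀ x,
      ‖fderiv ℝ (fun θ => h θ x) θ‖ ≤ b x) {θ : E} (hθ : θ ∈ U) :
    Integrable (fun x => fderiv ℝ (fun θ => h θ x) θ) μ ∧
    HasFDerivAt (fun θ => ∫ x, h θ x ∂μ) (∫ x, fderiv ℝ (fun θ => h θ x) θ ∂μ) θ := by
  obtain ⟨ε, hε, hball⟩ := Metric.nhds_basis_closedBall.mem_iff.1 (hU.mem_nhds hθ)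
  obtain ⟨b, hbi, hb⟩ := hb _ hball (isCompact_closedBall θ ε)
  have hmeas : StronglyMeasurable fun x => fderiv ℝ (fun θ => h θ x) θ := by
    simpa only [fderivWithin_of_isOpen hU hθ] using stronglyMeasurable_fderivWithin_param hU hm hd hθ
  refine ⟨hbi.mono' hmeas.aestronglyMeasurable
    (ae_of_all _ (hb θ (Metric.mem_closedBall_self hε.le))), ?_⟩
  refine hasFDerivAt_integral_of_dominated_of_fderiv_le (bound := b)
    (F' := fun θ x => fderiv ℝ (fun θ => h θ x) θ) (s := Metric.ball θ ε)
    (Metric.ball_mem_nhds θ hε) ?_ (hi θ hθ) hmeas.aestronglyMeasurable ?_ hbi ?_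
  · filter_upwards [hU.mem_nhds hθ] with θ' hθ' using (hm θ' hθ').aestronglyMeasurable
  · exact ae_of_all _ fun x θ' hθ' => hb θ' (Metric.ball_subset_closedBall hθ') x
  · exact ae_of_all _ fun x θ' hθ' => ((hd x).differentiableAt
      (hU.mem_nhds (hball (Metric.ball_subset_closedBall hθ')))).hasFDerivAt

/-- The score of a single return: the derivative of the log-density in the parameters. -/
noncomputable def score (θ : ParamVec) (r : ℝ) : ParamVec →L[ℝ] ℝ :=
  fderiv ℝ (fun θ' => Real.log (behavioralPDF θ' r)) θ

/-- The second derivative of the log-density in the parameters. -/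
noncomputable def scoreDeriv (θ : ParamVec) (r : ℝ) : ParamVec →L[ℝ] ParamVec →L[ℝ] ℝ :=
  fderiv ℝ (fun θ' => score θ' r) θ

lemma derivBound_score :
    DerivBound admissibleParams 0 (fun r => logGrowth r ^ 3) (fun _ r => logGrowth r ^ 3) score := by
  have h := derivBound_log_behavioralPDF.fderiv isOpen_admissibleParams
  simp only [mul_one] at h
  exact h

lemma derivBound_scoreDeriv :
    DerivBound admissibleParams 0 (fun r => logGrowth r ^ 3)
      (fun _ r => logGrowth r ^ 3 * logGrowth r ^ 3) scoreDeriv :=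
  (derivBound_score.of_le zero_le_one).fderiv isOpen_admissibleParams

lemma stronglyMeasurable_fderiv_param {E X F : Type*} [NormedAddCommGroup E]
    [NormedSpace ℝ E] [FiniteDimensional ℝ E] [MeasurableSpace X] [NormedAddCommGroup F]
    [NormedSpace ℝ F] {U : Set E} (hU : IsOpen U)
    {h : E → X → F} (hm : ∀ θ ∈ U, StronglyMeasurable (h θ))
    (hd : ∀ x, DifferentiableOn ℝ (fun θ => h θ x) U) {θ : E} (hθ : θ ∈ U) :
    StronglyMeasurable (fun x => fderiv ℝ (fun θ => h θ x) θ) := by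
  simpa only [fderivWithin_of_isOpen hU hθ] using stronglyMeasurable_fderivWithin_param hU hm hd hθ

lemma stronglyMeasurable_clm_apply {E X F : Type*} [NormedAddCommGroup E]
    [NormedSpace ℝ E] [MeasurableSpace X] [NormedAddCommGroup F] [NormedSpace ℝ F]
    {f : X → E →L[ℝ] F} (hf : StronglyMeasurable f) (v : E) :
    StronglyMeasurable fun x => f x v :=
  (ContinuousLinearMap.apply ℝ F v).continuous.comp_stronglyMeasurable hf

lemma stronglyMeasurable_score {θ : ParamVec} (hθ : θ ∈ admissibleParams) :
    StronglyMeasurable (score θ) :=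
  stronglyMeasurable_fderiv_param isOpen_admissibleParams
    (fun θ' hθ' => ((continuous_behavioralPDF hθ').log
      fun r => (behavioralPDF_pos hθ' r).ne').stronglyMeasurable)
    (fun r => (derivBound_log_behavioralPDF.1 r).differentiableOn (by simp)) hθ

lemma stronglyMeasurable_scoreDeriv {θ : ParamVec} (hθ : θ ∈ admissibleParams) :
    StronglyMeasurable (scoreDeriv θ) :=
  stronglyMeasurable_fderiv_param isOpen_admissibleParams
    (fun _ hθ' => stronglyMeasurable_score hθ')
    (fun r => (derivBound_score.1 r).differentiableOn (by simp)) hθ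

lemma hasFDerivAt_log_behavioralPDF {θ : ParamVec} (hθ : θ ∈ admissibleParams) (r : ℝ) :
    HasFDerivAt (fun θ' => Real.log (behavioralPDF θ' r)) (score θ r) θ :=
  (((derivBound_log_behavioralPDF.1 r).differentiableOn (by simp)).differentiableAt
    (isOpen_admissibleParams.mem_nhds hθ)).hasFDerivAt

lemma hasFDerivAt_score {θ : ParamVec} (hθ : θ ∈ admissibleParams) (r : ℝ) :
    HasFDerivAt (fun θ' => score θ' r) (scoreDeriv θ r) θ :=
  (((derivBound_score.1 r).differentiableOn (by simp)).differentiableAt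
    (isOpen_admissibleParams.mem_nhds hθ)).hasFDerivAt

lemma hasFDerivAt_behavioralPDF {θ : ParamVec} (hθ : θ ∈ admissibleParams) (r : ℝ) :
    HasFDerivAt (fun θ' => behavioralPDF θ' r) (behavioralPDF θ r • score θ r) θ := by
  have h := (hasFDerivAt_log_behavioralPDF hθ r).exp
  rw [Real.exp_log (behavioralPDF_pos hθ r)] at h
  refine h.congr_of_eventuallyEq ?_
  filter_upwards [isOpen_admissibleParams.mem_nhds hθ] with θ' hθ'
  exact (Real.exp_log (behavioralPDF_pos hθ' r)).symm

lemma integrable_mul_behavioralPDF_of_le {θ : ParamVec} (hθ : θ ∈ admissibleParams) {φ : ℝ → ℝ}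
    (hφ : StronglyMeasurable φ) {C : ℝ} {n : ℕ} (hb : ∀ r, |φ r| ≤ C * logGrowth r ^ n) :
    Integrable fun r => φ r * behavioralPDF θ r := by
  refine ((integrable_logGrowth_pow_mul_behavioralPDF hθ n).const_mul C).mono'
    (hφ.mul (continuous_behavioralPDF hθ).stronglyMeasurable).aestronglyMeasurable
    (ae_of_all _ fun r => ?_)
  have := behavioralPDF_pos hθ r
  rw [norm_mul, Real.norm_eq_abs, Real.norm_of_nonneg this.le, ← mul_assoc]
  gcongr
  exact hb r

lemma exists_norm_score_le {θ : ParamVec} (hθ : θ ∈ admissibleParams) :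
    ∃ C, 0 ≤ C ∧ ∀ r, ‖score θ r‖ ≤ C * logGrowth r ^ 3 := by
  obtain ⟨C, hC, hb⟩ := derivBound_score.bound_zero (K := {θ}) (by simpa using hθ)
    isCompact_singleton
  exact ⟨C, hC, hb θ rfl⟩

lemma exists_norm_scoreDeriv_le {θ : ParamVec} (hθ : θ ∈ admissibleParams) :
    ∃ C, 0 ≤ C ∧ ∀ r, ‖scoreDeriv θ r‖ ≤ C * logGrowth r ^ 6 := by
  obtain ⟨C, hC, hb⟩ := derivBound_scoreDeriv.bound_zero (K := {θ}) (by simpa using hθ)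
    isCompact_singleton
  exact ⟨C, hC, fun r => (hb θ rfl r).trans_eq (by ring)⟩

lemma integrable_score_mul_score {θ : ParamVec} (hθ : θ ∈ admissibleParams) (v w : ParamVec) :
    Integrable fun r => score θ r v * score θ r w * behavioralPDF θ r := by
  obtain ⟨C, hC, hb⟩ := exists_norm_score_le hθ
  refine integrable_mul_behavioralPDF_of_le hθ (C := C * ‖v‖ * (C * ‖w‖)) (n := 6)
    (stronglyMeasurable_clm_apply (stronglyMeasurable_score hθ) v |>.mul
      (stronglyMeasurable_clm_apply (stronglyMeasurable_score hθ) w)) fun r => ?_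
  rw [abs_mul]
  have h1 := (score θ r).le_of_opNorm_le (hb r) v
  have h2 := (score θ r).le_of_opNorm_le (hb r) w
  calc _ ≤ (C * logGrowth r ^ 3 * ‖v‖) * (C * logGrowth r ^ 3 * ‖w‖) := by
        exact mul_le_mul h1 h2 (abs_nonneg _) ((norm_nonneg _).trans h1)
    _ = _ := by ring

lemma integrable_scoreDeriv_apply {θ : ParamVec} (hθ : θ ∈ admissibleParams) (v w : ParamVec) :
    Integrable fun r => scoreDeriv θ r v w * behavioralPDF θ r := by
  obtain ⟨C, hC, hb⟩ := exists_norm_scoreDeriv_le hθ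
  refine integrable_mul_behavioralPDF_of_le hθ (C := C * ‖v‖ * ‖w‖) (n := 6)
    (stronglyMeasurable_clm_apply (stronglyMeasurable_clm_apply (stronglyMeasurable_scoreDeriv hθ) v) w)
    fun r => ?_
  have h1 := (scoreDeriv θ r).le_of_opNorm_le (hb r) v
  have h2 := (scoreDeriv θ r v).le_of_opNorm_le h1 w
  exact h2.trans_eq (by ring)

/-- Differentiation of `∫ f_bw` over a set, in the parameters. -/
lemma hasFDerivAt_setIntegral_behavioralPDF {θ : ParamVec} (hθ : θ ∈ admissibleParams)
    (S : Set ℝ) :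
    Integrable (fun r => behavioralPDF θ r • score θ r) ∧
    HasFDerivAt (fun θ' => ∫ r in S, behavioralPDF θ' r)
      (∫ r in S, behavioralPDF θ r • score θ r) θ := by
  have hfd (θ' : ParamVec) (hθ' : θ' ∈ admissibleParams) (r : ℝ) :=
    (hasFDerivAt_behavioralPDF hθ' r).fderiv
  have key (S : Set ℝ) := hasFDerivAt_integral_of_locally_dominated (h := behavioralPDF)
    (μ := volume.restrict S) isOpen_admissibleParams
    (fun θ' hθ' => (continuous_behavioralPDF hθ').stronglyMeasurable)
    (fun θ' hθ' => (integrable_behavioralPDF hθ').integrableOn)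
    (fun r => (derivBound_behavioralPDF.1 r).differentiableOn (by simp))
    (fun K hK hKc => by
      obtain ⟨C, hC, hb⟩ := ((derivBound_behavioralPDF.of_le zero_le_one).fderiv
        isOpen_admissibleParams).bound_zero hK hKc
      obtain ⟨C', hC', hb'⟩ := exists_logGrowth_pow_mul_behavioralPDF_le hK hKc 3
      exact ⟨fun r => C * (C' * logEnvelope r), ((integrable_logEnvelope.const_mul C').const_mul
        C).integrableOn, fun θ' hθ' r => (hb θ' hθ' r).trans
        (mul_le_mul_of_nonneg_left (hb' θ' hθ' r) hC)⟩) hθ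
  simp only [hfd θ hθ] at key
  exact ⟨by simpa using (key Set.univ).1, (key S).2⟩

/-- Differentiate the constant total mass under the integral sign. -/
lemma integral_score_mul {θ : ParamVec} (hθ : θ ∈ admissibleParams) (v : ParamVec) :
    ∫ r, score θ r v * behavioralPDF θ r = 0 := by
  obtain ⟨hi, h⟩ := hasFDerivAt_setIntegral_behavioralPDF hθ Set.univ
  simp only [Measure.restrict_univ] at h
  have h0 : HasFDerivAt (fun θ' => ∫ r, behavioralPDF θ' r) (0 : ParamVec →L[ℝ] ℝ) θ := by
    refine (hasFDerivAt_const (1 : ℝ) θ).congr_of_eventuallyEq ?_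
    filter_upwards [isOpen_admissibleParams.mem_nhds hθ] with θ' hθ'
      using integral_behavioralPDF hθ'
  have := congrArg (fun L : ParamVec →L[ℝ] ℝ => L v) (h.unique h0)
  simp only [ContinuousLinearMap.integral_apply (𝕜 := ℝ) hi, smul_apply,
    smul_eq_mul, zero_apply] at this
  simpa only [mul_comm] using this

/-- Passing to the distribution function makes almost everywhere vanishing of the score in a
direction usable at every point `r`. -/
lemma fderiv_behavioralCDF_apply {θ : ParamVec} (hθ : θ ∈ admissibleParams) (v : ParamVec)
    (r : ℝ) : fderiv ℝ (fun θ' => behavioralCDF θ' r) θ v =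
      ∫ x in Set.Iic r, score θ x v * behavioralPDF θ x := by
  obtain ⟨hi, h⟩ := hasFDerivAt_setIntegral_behavioralPDF hθ (Set.Iic r)
  have h0 := h.congr_of_eventuallyEq (f₁ := fun θ' => behavioralCDF θ' r) <| by
    filter_upwards [isOpen_admissibleParams.mem_nhds hθ] with θ' hθ'
      using (setIntegral_Iic_behavioralPDF hθ' r).symm
  rw [h0.fderiv, ContinuousLinearMap.integral_apply (𝕜 := ℝ) hi.integrableOn]
  simp [mul_comm]

/-- The information equality. -/
lemma integral_neg_scoreDeriv {θ : ParamVec} (hθ : θ ∈ admissibleParams) (v w : ParamVec) :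
    ∫ r, -scoreDeriv θ r v w * behavioralPDF θ r =
      ∫ r, score θ r v * score θ r w * behavioralPDF θ r := by
  have hfd {θ' : ParamVec} (hθ' : θ' ∈ admissibleParams) (r : ℝ) :
      HasFDerivAt (fun θ => score θ r w * behavioralPDF θ r)
        (score θ' r w • (behavioralPDF θ' r • score θ' r) +
          behavioralPDF θ' r • (scoreDeriv θ' r).flip w) θ' :=
    ((hasFDerivAt_score hθ' r).clm_apply (hasFDerivAt_const w θ')).mul
      (hasFDerivAt_behavioralPDF hθ' r) |>.congr_fderiv (by ext; simp)
  have hint {θ' : ParamVec} (hθ' : θ' ∈ admissibleParams) :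
      Integrable fun r => score θ' r w * behavioralPDF θ' r := by
    obtain ⟨C, hC, hb⟩ := exists_norm_score_le hθ'
    refine integrable_mul_behavioralPDF_of_le hθ' (C := C * ‖w‖) (n := 3)
      (stronglyMeasurable_clm_apply (stronglyMeasurable_score hθ') w) fun r => ?_
    exact ((score θ' r).le_of_opNorm_le (hb r) w).trans_eq (by ring)
  obtain ⟨hi, h⟩ := hasFDerivAt_integral_of_locally_dominated
    (h := fun θ r => score θ r w * behavioralPDF θ r) (μ := volume) isOpen_admissibleParams
    (fun θ' hθ' => (stronglyMeasurable_clm_apply (stronglyMeasurable_score hθ') w).mul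
      (continuous_behavioralPDF hθ').stronglyMeasurable) (fun θ' hθ' => hint hθ')
    (fun r θ' hθ' => (hfd hθ' r).differentiableAt.differentiableWithinAt)
    (fun K hK hKc => by
      obtain ⟨C₁, hC₁, hb₁⟩ := derivBound_score.bound_zero hK hKc
      obtain ⟨C₂, hC₂, hb₂⟩ := derivBound_scoreDeriv.bound_zero hK hKc
      obtain ⟨C', hC', hb'⟩ := exists_logGrowth_pow_mul_behavioralPDF_le hK hKc 6
      refine ⟨fun r => (C₁ * ‖w‖ * C₁ + C₂ * ‖w‖) * (C' * logEnvelope r),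
        (integrable_logEnvelope.const_mul C').const_mul _, fun θ' hθ' r => ?_⟩
      rw [(hfd (hK hθ') r).fderiv]
      have hp := behavioralPDF_pos (hK hθ') r
      have h1 := hb₁ θ' hθ' r
      have h2 := (score θ' r).le_of_opNorm_le h1 w
      have h3 : ‖(scoreDeriv θ' r).flip w‖ ≤ C₂ * (logGrowth r ^ 3 * logGrowth r ^ 3) * ‖w‖ :=
        (scoreDeriv θ' r).flip.le_of_opNorm_le
          ((ContinuousLinearMap.opNorm_flip _).trans_le (hb₂ θ' hθ' r)) w
      have hM := logGrowth_nonneg r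
      calc _ ≤ ‖score θ' r w • (behavioralPDF θ' r • score θ' r)‖ +
            ‖behavioralPDF θ' r • (scoreDeriv θ' r).flip w‖ := norm_add_le _ _
        _ ≤ C₁ * logGrowth r ^ 3 * ‖w‖ * (behavioralPDF θ' r * (C₁ * logGrowth r ^ 3)) +
            behavioralPDF θ' r * (C₂ * (logGrowth r ^ 3 * logGrowth r ^ 3) * ‖w‖) := by
          rw [norm_smul, norm_smul, norm_smul, Real.norm_of_nonneg hp.le]
          gcongr
        _ = (C₁ * ‖w‖ * C₁ + C₂ * ‖w‖) * (logGrowth r ^ 6 * behavioralPDF θ' r) := by ring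
        _ ≤ _ := mul_le_mul_of_nonneg_left (hb' θ' hθ' r) (by positivity)) hθ
  -- The score has mean zero at every admissible parameter, not only at `θ`; differentiating this
  -- identity gives the information equality.
  have h0 : HasFDerivAt (fun θ' => ∫ r, score θ' r w * behavioralPDF θ' r) (0 : ParamVec →L[ℝ] ℝ) θ := by
    refine (hasFDerivAt_const (0 : ℝ) θ).congr_of_eventuallyEq ?_
    filter_upwards [isOpen_admissibleParams.mem_nhds hθ] with θ' hθ'
      using integral_score_mul hθ' w
  have e := congrArg (fun L : ParamVec →L[ℝ] ℝ => L v) (h.unique h0)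
  simp only [ContinuousLinearMap.integral_apply (𝕜 := ℝ) hi, zero_apply] at e
  simp only [(hfd hθ _).fderiv] at e
  have e2 : ∫ r, (score θ r v * score θ r w * behavioralPDF θ r +
      scoreDeriv θ r v w * behavioralPDF θ r) = 0 := by
    refine Eq.trans (integral_congr_ae (ae_of_all _ fun r => ?_)) e
    simp
    ring
  rw [integral_add (integrable_score_mul_score hθ v w) (integrable_scoreDeriv_apply hθ v w)] at e2
  simp only [neg_mul, integral_neg]
  linarith

end ScoreFunction

/-! ### Local identification and positivity of the information -/

section FisherPositive

open scoped ContDiff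

lemma hasFDerivAt_tLower {θ : ParamVec} (hθ : θ ∈ admissibleParams) (r : ℝ) :
    Integrable (fun x => fderiv ℝ (fun θ' => tDensity θ' x) θ) ∧
    HasFDerivAt (fun θ' => tLower θ' r)
      (∫ x in Set.Iic r, fderiv ℝ (fun θ' => tDensity θ' x) θ) θ := by
  have key (S : Set ℝ) := hasFDerivAt_integral_of_locally_dominated (h := tDensity)
    (μ := volume.restrict S) isOpen_admissibleParams
    (fun θ' hθ' => (continuous_tDensity hθ').stronglyMeasurable)
    (fun θ' hθ' => (integrable_tDensity hθ').integrableOn)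
    (fun r => (derivBound_tDensity.1 r).differentiableOn (by simp))
    (fun K hK hKc => by
      obtain ⟨C, hC, hb⟩ := ((derivBound_tDensity.of_le zero_le_one).fderiv
        isOpen_admissibleParams).bound_zero hK hKc
      obtain ⟨C', hC', hb'⟩ := exists_logGrowth_pow_mul_tDensity_le hK hKc 1
      refine ⟨fun x => C * (C' * (1 + |x|) ^ (-2 : ℝ)),
        ((integrable_one_add_abs_rpow_neg_two.const_mul C').const_mul C).integrableOn,
        fun θ' hθ' x => (hb θ' hθ' x).trans (mul_le_mul_of_nonneg_left ?_ hC)⟩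
      simpa using hb' θ' hθ' x) hθ
  exact ⟨by simpa using (key Set.univ).1, (key _).2⟩

/-- The directional derivative of the log-density of Student's t distribution. -/
lemma fderiv_log_tDensity_apply {θ : ParamVec} (hθ : θ ∈ admissibleParams) (v : ParamVec) (x : ℝ) :
    fderiv ℝ (fun θ' => Real.log (tDensity θ' x)) θ v = fderiv ℝ tLogConst θ v
      - v 2 / 2 * Real.log (1 + (x - θ 0) ^ 2 / (θ 2 * θ 1 ^ 2))
      + (θ 2 + 1) / 2 * ((2 * (x - θ 0) * v 0 * (θ 2 * θ 1 ^ 2) +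
        (x - θ 0) ^ 2 * (v 2 * θ 1 ^ 2 + 2 * θ 2 * θ 1 * v 1)) /
        (θ 2 * θ 1 ^ 2 * (θ 2 * θ 1 ^ 2 + (x - θ 0) ^ 2))) := by
  have hσ : 0 < θ 1 := hθ.1
  have hν : 0 < θ 2 := by linarith [hθ.2.1]
  have hs : 0 < θ 2 * θ 1 ^ 2 := by positivity
  have hc := ((contDiffOn_tLogConst.differentiableOn (by simp)).differentiableAt
    (isOpen_admissibleParams.mem_nhds hθ)).hasFDerivAt
  have p (i : Fin 4) : HasFDerivAt (fun θ' : ParamVec => θ' i)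
      (EuclideanSpace.proj (𝕜 := ℝ) i : ParamVec →L[ℝ] ℝ) θ :=
    (EuclideanSpace.proj (𝕜 := ℝ) i : ParamVec →L[ℝ] ℝ).hasFDerivAt
  have hk : 1 + (x - θ 0) ^ 2 / (θ 2 * θ 1 ^ 2) ≠ 0 := by positivity
  have hi := (hasDerivAt_inv hs.ne').comp_hasFDerivAt θ ((p 2).mul ((p 1).pow 2))
  have hK := ((((p 0).const_sub x).pow 2).mul hi).const_add 1
  have h := hc.sub ((((p 2).add_const 1).mul_const (2⁻¹ : ℝ)).mul
    (hK.log (by simpa [div_eq_mul_inv] using hk)))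
  have h' := h.congr_of_eventuallyEq (f₁ := fun θ' => Real.log (tDensity θ' x)) <| by
    filter_upwards [isOpen_admissibleParams.mem_nhds hθ] with θ' hθ'
    simp [log_tDensity hθ' x, tKernel, div_eq_mul_inv]
  rw [h'.fderiv]
  simp
  field_simp
  ring

/-- A direction in which the log-density of Student's t distribution does not vary has vanishing
location, scale and degrees-of-freedom components. -/
lemma eq_zero_of_fderiv_log_tDensity_eq_zero {θ : ParamVec} (hθ : θ ∈ admissibleParams)
    {v : ParamVec} (h : ∀ x, fderiv ℝ (fun θ' => Real.log (tDensity θ' x)) θ v = 0) :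
    v 0 = 0 ∧ v 1 = 0 ∧ v 2 = 0 := by
  have hσ : 0 < θ 1 := hθ.1
  have hν : 0 < θ 2 := by linarith [hθ.2.1]
  simp only [fderiv_log_tDensity_apply hθ] at h
  set s := θ 2 * θ 1 ^ 2 with hs_def
  have hs : 0 < s := by positivity
  set q := v 2 * θ 1 ^ 2 + 2 * θ 2 * θ 1 * v 1 with hq
  set c := fderiv ℝ tLogConst θ v
  replace h (y : ℝ) := h (θ 0 + y)
  simp only [add_sub_cancel_left] at h
  have hc : c = 0 := by simpa using h 0
  -- Only the location term is odd in `y`, so comparing `y = 1` with `y = -1` isolates it.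
  have h0 : v 0 = 0 := by
    have e1 := h 1
    have e2 := h (-1)
    norm_num at e1 e2
    have e3 : (θ 2 + 1) / 2 * ((2 * v 0 * s + q) / (s * (s + 1))) =
      (θ 2 + 1) / 2 * ((-(2 * v 0 * s) + q) / (s * (s + 1))) := by linarith
    have e4 := mul_left_cancel₀ (by positivity) e3
    rw [div_left_inj' (by positivity)] at e4
    have : v 0 * s = 0 := by linarith
    exact (mul_eq_zero.1 this).resolve_right hs.ne'
  -- At these two points the kernel equals $2$ and $4$. With $A=\frac{\nu+1}{2}\frac{q}{s}$ and
  -- $B=v_2\log 2$ the equations read $A=B$ and $\frac34A=B$, so both vanish.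
  have ha := h (√s)
  have hb := h (√(3 * s))
  rw [Real.sq_sqrt (by positivity), h0, hc] at ha hb
  have ea : 1 + s / s = 2 := by rw [div_self hs.ne']; norm_num
  have eb : 1 + 3 * s / s = 2 ^ 2 := by rw [mul_div_cancel_right₀ _ hs.ne']; norm_num
  have fa : (2 * √s * 0 * s + s * q) / (s * (s + s)) = q / s / 2 := by field_simp; ring
  have fb : (2 * √(3 * s) * 0 * s + 3 * s * q) / (s * (s + 3 * s)) = q / s * (3 / 4) := by
    field_simp; ring
  rw [ea, fa] at ha
  rw [eb, fb, Real.log_pow] at hb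
  push_cast at hb
  have hq0 : (θ 2 + 1) / 2 * (q / s) = 0 := by linarith
  have hl : v 2 * Real.log 2 = 0 := by linarith
  have hv2 : v 2 = 0 := (mul_eq_zero.1 hl).resolve_right (Real.log_pos (by norm_num)).ne'
  have hq1 : q = 0 := by
    have := (mul_eq_zero.1 hq0).resolve_left (by positivity)
    exact (div_eq_zero_iff.1 this).resolve_right hs.ne'
  refine ⟨h0, ?_, hv2⟩
  rw [hq, hv2] at hq1
  have : 2 * θ 2 * θ 1 * v 1 = 0 := by linarith
  exact (mul_eq_zero.1 this).resolve_left (by positivity)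

lemma hasFDerivAt_log_tNegLog {θ : ParamVec} (hθ : θ ∈ admissibleParams) (r : ℝ) :
    HasFDerivAt (fun θ' => Real.log (tNegLog θ' r))
      ((tNegLog θ r)⁻¹ • -((tLower θ r)⁻¹ • fderiv ℝ (fun θ' => tLower θ' r) θ)) θ :=
  (((hasFDerivAt_tLower hθ r).2.differentiableAt.hasFDerivAt.log
    (tLower_pos hθ r).ne').neg).log (tNegLog_pos hθ r).ne'

/-- Local identifiability: the behavioral CDF has no stationary direction. -/
lemma eq_zero_of_fderiv_behavioralCDF_eq_zero {θ : ParamVec} (hθ : θ ∈ admissibleParams)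
    {v : ParamVec} (h : ∀ r, fderiv ℝ (fun θ' => behavioralCDF θ' r) θ v = 0) : v = 0 := by
  have hα : 0 < θ 3 := hθ.2.2.1
  have p : HasFDerivAt (fun θ' : ParamVec => θ' 3)
      (EuclideanSpace.proj (𝕜 := ℝ) 3 : ParamVec →L[ℝ] ℝ) θ :=
    (EuclideanSpace.proj (𝕜 := ℝ) 3 : ParamVec →L[ℝ] ℝ).hasFDerivAt
  -- The vanishing derivative of $\alpha\log L$ along `v`, after the nonzero exponential factors are
  -- divided out.
  have key (r : ℝ) : v 3 * Real.log (tNegLog θ r) =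
      θ 3 * ((tNegLog θ r)⁻¹ * ((tLower θ r)⁻¹ * fderiv ℝ (fun θ' => tLower θ' r) θ v)) := by
    have hd := ((p.mul (hasFDerivAt_log_tNegLog hθ r)).exp.neg).exp
    have hd' := hd.congr_of_eventuallyEq (f₁ := fun θ' => behavioralCDF θ' r) <| by
      filter_upwards [isOpen_admissibleParams.mem_nhds hθ] with θ' hθ'
        using behavioralCDF_eq hθ' r
    have e := h r
    rw [hd'.fderiv] at e
    have e' : Real.exp (-Real.exp (θ 3 * Real.log (tNegLog θ r))) *
        (Real.exp (θ 3 * Real.log (tNegLog θ r)) * (v 3 * Real.log (tNegLog θ r) -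
        θ 3 * ((tNegLog θ r)⁻¹ *
          ((tLower θ r)⁻¹ * fderiv ℝ (fun θ' => tLower θ' r) θ v)))) = 0 := by
      simp at e
      linarith
    simp only [mul_eq_zero, Real.exp_ne_zero, false_or] at e'
    linarith
  -- On the left the right side of `key` is bounded, because the derivative of $F$ is at most a
  -- multiple of `logGrowth` times $F$ and `logGrowth` is at most a multiple of $L$; yet $\log L$ is
  -- unbounded.
  have hv3 : v 3 = 0 := by
    obtain ⟨C₁, hC₁, h₁⟩ := exists_tNegLog_left (K := {θ}) (by simpa using hθ)
      isCompact_singleton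
    obtain ⟨C₂, hC₂, h₂⟩ := ((derivBound_tLower.of_le zero_le_one).fderiv
      isOpen_admissibleParams).bound_zero (K := {θ}) (by simpa using hθ) isCompact_singleton
    have ht : Tendsto (fun r => Real.log (logGrowth r)) atBot atTop :=
      Real.tendsto_log_atTop.comp tendsto_logGrowth_atBot
    have hbd : ∀ᶠ r in atBot, |v 3| * Real.log (logGrowth r) ≤
        θ 3 * (C₁ * C₂ * ‖v‖) + |v 3| * Real.log C₁ := by
      filter_upwards [eventually_le_atBot 0] with r hr
      obtain ⟨-, a2⟩ := h₁ θ rfl r hr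
      have hM := one_le_logGrowth r
      have hL := tNegLog_pos hθ r
      have hF := tLower_pos hθ r
      have b1 := (fderiv ℝ (fun θ' => tLower θ' r) θ).le_of_opNorm_le (h₂ θ rfl r) v
      have b2 : |(tNegLog θ r)⁻¹ * ((tLower θ r)⁻¹ * fderiv ℝ (fun θ' => tLower θ' r) θ v)| ≤
          C₁ * C₂ * ‖v‖ := by
        rw [abs_mul, abs_mul, abs_of_pos (inv_pos.2 hL), abs_of_pos (inv_pos.2 hF),
          inv_mul_le_iff₀ hL, inv_mul_le_iff₀ hF]
        calc _ ≤ C₂ * (logGrowth r * tLower θ r) * ‖v‖ := b1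
          _ ≤ C₂ * (C₁ * tNegLog θ r * tLower θ r) * ‖v‖ := by gcongr
          _ = _ := by ring
      have e1 := Real.log_le_log (by linarith) a2
      rw [Real.log_mul (by linarith) hL.ne'] at e1
      have e2 : |v 3| * Real.log (tNegLog θ r) ≤ θ 3 * (C₁ * C₂ * ‖v‖) := by
        calc |v 3| * Real.log (tNegLog θ r) ≤ |v 3| * |Real.log (tNegLog θ r)| := by
              gcongr; exact le_abs_self _
          _ = |v 3 * Real.log (tNegLog θ r)| := (abs_mul _ _).symm
          _ ≤ _ := by rw [key r, abs_mul, abs_of_pos hα]; gcongr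
      nlinarith [abs_nonneg (v 3)]
    exact abs_nonpos_iff.1 (nonpos_of_mul_le_of_tendsto ht hbd)
  have hF0 (r : ℝ) : fderiv ℝ (fun θ' => tLower θ' r) θ v = 0 := by
    have e := key r
    rw [hv3, zero_mul] at e
    simpa [hα.ne', (tNegLog_pos hθ r).ne', (tLower_pos hθ r).ne'] using e.symm
  have hlog (x : ℝ) : HasFDerivAt (fun θ' => Real.log (tDensity θ' x))
      (fderiv ℝ (fun θ' => Real.log (tDensity θ' x)) θ) θ :=
    (((derivBound_log_tDensity.1 x).differentiableOn (by simp)).differentiableAt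
      (isOpen_admissibleParams.mem_nhds hθ)).hasFDerivAt
  set φ : ℝ → ℝ := fun x => tDensity θ x * fderiv ℝ (fun θ' => Real.log (tDensity θ' x)) θ v
    with hφ
  have hφeq (x : ℝ) : fderiv ℝ (fun θ' => tDensity θ' x) θ v = φ x := by
    have h1 := (hlog x).exp
    rw [Real.exp_log (tDensity_pos hθ x)] at h1
    have h2 := h1.congr_of_eventuallyEq (f₁ := fun θ' => tDensity θ' x) <| by
      filter_upwards [isOpen_admissibleParams.mem_nhds hθ] with θ' hθ'
        using (Real.exp_log (tDensity_pos hθ' x)).symm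
    rw [h2.fderiv, hφ]
    simp
  have hφc : Continuous φ := by
    refine (continuous_tDensity hθ).mul ?_
    simp only [fderiv_log_tDensity_apply hθ]
    have hσ : 0 < θ 1 := hθ.1
    have hν : 0 < θ 2 := by linarith [hθ.2.1]
    have h1 (x : ℝ) : 1 + (x - θ 0) ^ 2 / (θ 2 * θ 1 ^ 2) ≠ 0 := by positivity
    have h2 (x : ℝ) : θ 2 * θ 1 ^ 2 * (θ 2 * θ 1 ^ 2 + (x - θ 0) ^ 2) ≠ 0 := by positivity
    exact (continuous_const.sub (continuous_const.mul (Continuous.log (by fun_prop) h1))).add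
      (continuous_const.mul (Continuous.div (by fun_prop) (by fun_prop) h2))
  have hφi : Integrable φ := by
    have := (hasFDerivAt_tLower hθ 0).1.apply_continuousLinearMap v
    simpa only [hφeq] using this
  have hint (r : ℝ) : ∫ x in Set.Iic r, φ x = 0 := by
    have hi := (hasFDerivAt_tLower hθ r).1
    have e := hF0 r
    rw [(hasFDerivAt_tLower hθ r).2.fderiv, ContinuousLinearMap.integral_apply (𝕜 := ℝ)
      hi.integrableOn] at e
    simpa only [hφeq] using e
  -- All integrals of the continuous function `φ` over left half-lines vanish, so the fundamental
  -- theorem of calculus gives zero at every point.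
  have hφ0 (x : ℝ) : φ x = 0 := by
    have h1 := intervalIntegral.integral_hasDerivAt_right (a := 0) (b := x) hφi.intervalIntegrable
      (hφc.stronglyMeasurableAtFilter _ _) hφc.continuousAt
    refine h1.unique ((hasDerivAt_const x (0 : ℝ)).congr_of_eventuallyEq
      (Eventually.of_forall fun u => ?_))
    change ∫ y in (0 : ℝ)..u, φ y = 0
    rw [← intervalIntegral.integral_Iic_sub_Iic hφi.integrableOn hφi.integrableOn, hint, hint,
      sub_zero]
  obtain ⟨v0, v1, v2⟩ := eq_zero_of_fderiv_log_tDensity_eq_zero hθ fun x =>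
    (mul_eq_zero.1 (hφ0 x)).resolve_left (tDensity_pos hθ x).ne'
  ext i
  fin_cases i <;> assumption

/-- If the integral vanished, the score along `v` would vanish almost everywhere, hence so would the
derivative of the behavioral distribution function along `v`, contradicting local identification. -/
lemma integral_score_sq_pos {θ : ParamVec} (hθ : θ ∈ admissibleParams) {v : ParamVec}
    (hv : v ≠ 0) : 0 < ∫ r, score θ r v * score θ r v * behavioralPDF θ r := by
  have h0 (r : ℝ) : 0 ≤ score θ r v * score θ r v * behavioralPDF θ r :=
    mul_nonneg (mul_self_nonneg _) (behavioralPDF_pos hθ r).le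
  refine (integral_nonneg h0).lt_of_ne fun h => hv ?_
  have hae := (integral_eq_zero_iff_of_nonneg h0 (integrable_score_mul_score hθ v v)).1 h.symm
  refine eq_zero_of_fderiv_behavioralCDF_eq_zero hθ fun r => ?_
  rw [fderiv_behavioralCDF_apply hθ]
  refine integral_eq_zero_of_ae (ae_restrict_of_ae (hae.mono fun x hx => ?_))
  have hp := (behavioralPDF_pos hθ x).ne'
  simpa [hp] using hx

lemma fisherInformation_apply {θ : ParamVec} (hθ : θ ∈ admissibleParams) (i j : Fin 4) :
    fisherInformation θ i j = ∫ r, score θ r (EuclideanSpace.single i 1) *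
      score θ r (EuclideanSpace.single j 1) * behavioralPDF θ r := by
  rw [← integral_neg_scoreDeriv hθ]
  rfl

open scoped Matrix in
/-- The quadratic form of the Fisher information matrix. -/
lemma dotProduct_fisherInformation_mulVec {θ : ParamVec} (hθ : θ ∈ admissibleParams)
    (v w : ParamVec) : v ⬝ᵥ fisherInformation θ *ᵥ w =
      ∫ r, score θ r v * score θ r w * behavioralPDF θ r := by
  have hv (L : ParamVec →L[ℝ] ℝ) (v : ParamVec) :
      L v = ∑ i, v i * L (EuclideanSpace.single i 1) := by
    conv_lhs => rw [← (EuclideanSpace.basisFun (Fin 4) ℝ).sum_repr v]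
    simp
  have e (r : ℝ) : score θ r v * score θ r w * behavioralPDF θ r =
      ∑ i, ∑ j, v i * (w j * (score θ r (EuclideanSpace.single i 1) *
        score θ r (EuclideanSpace.single j 1) * behavioralPDF θ r)) := by
    rw [hv _ v, hv _ w, Finset.sum_mul_sum, Finset.sum_mul]
    refine Finset.sum_congr rfl fun i _ => ?_
    rw [Finset.sum_mul]
    exact Finset.sum_congr rfl fun j _ => by ring
  have hi (i j : Fin 4) := integrable_score_mul_score hθ (EuclideanSpace.single i 1)
    (EuclideanSpace.single j 1)
  simp only [e]
  rw [integral_finsetSum _ fun i _ => integrable_finsetSum _ fun j _ =>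
    ((hi i j).const_mul _).const_mul _]
  simp only [dotProduct, Matrix.mulVec, Finset.mul_sum]
  refine Finset.sum_congr rfl fun i _ => ?_
  rw [integral_finsetSum _ fun j _ => ((hi i j).const_mul _).const_mul _]
  refine Finset.sum_congr rfl fun j _ => ?_
  rw [integral_const_mul, integral_const_mul, fisherInformation_apply hθ]
  ring

lemma posDef_fisherInformation {θ : ParamVec} (hθ : θ ∈ admissibleParams) :
    (fisherInformation θ).PosDef := by
  refine Matrix.PosDef.of_dotProduct_mulVec_pos ?_ fun x hx => ?_
  · ext i j
    simp only [Matrix.conjTranspose_apply, star_trivial, fisherInformation_apply hθ]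
    exact integral_congr_ae (ae_of_all _ fun r => by ring)
  · have := integral_score_sq_pos hθ (v := WithLp.toLp 2 x) (by simpa using hx)
    rw [← dotProduct_fisherInformation_mulVec hθ] at this
    simpa using this

end FisherPositive

/-! ### Large-sample theory for i.i.d. sequences -/

section LargeSample

variable {Ω X : Type*} [MeasurableSpace Ω] [MeasurableSpace X] {P : Measure Ω} {ν : Measure X} {R : ℕ → Ω → X}

/-- The strong law of large numbers for functions of an i.i.d. sequence. -/
lemma ae_tendsto_average_comp [IsProbabilityMeasure P] {G : Type*} [NormedAddCommGroup G] [NormedSpace ℝ G]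
    [CompleteSpace G] (hR : ∀ t, Measurable (R t)) (hind : iIndepFun R P)
    (hlaw : ∀ t, P.map (R t) = ν) {φ : X → G} (hφ : StronglyMeasurable φ) (hi : Integrable φ ν) :
    ∀ᵐ ω ∂P, Tendsto (fun n : ℕ => (n : ℝ)⁻¹ • ∑ t ∈ Finset.range n, φ (R t ω)) atTop
      (𝓝 (∫ x, φ x ∂ν)) := by
  borelize G
  have hident (t : ℕ) : IdentDistrib (R t) (R 0) P P :=
    ⟨(hR t).aemeasurable, (hR 0).aemeasurable, by rw [hlaw, hlaw]⟩
  have h := strong_law_ae (fun t ω => φ (R t ω)) (μ := P)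
    ((integrable_map_measure (hlaw 0 ▸ hi.aestronglyMeasurable) (hR 0).aemeasurable).1
      (hlaw 0 ▸ hi))
    (fun i j hij => (hind.indepFun hij).comp hφ.measurable hφ.measurable)
    (fun t => (hident t).comp hφ.measurable)
  rwa [← integral_map (hR 0).aemeasurable (hlaw 0 ▸ hi.aestronglyMeasurable), hlaw 0] at h

/-- Strong consistency of maximum likelihood (M-)estimators over a compact parameter space. -/
theorem ae_tendsto_of_maximizes [IsProbabilityMeasure P] {E : Type*}
    [PseudoMetricSpace E] (hR : ∀ t, Measurable (R t))
    (hind : iIndepFun R P) (hlaw : ∀ t, P.map (R t) = ν) {Θ : Set E} (hΘ : IsCompact Θ)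
    {g : E → X → ℝ} (hgm : ∀ θ ∈ Θ, StronglyMeasurable (g θ)) (hgi : ∀ θ ∈ Θ, Integrable (g θ) ν)
    (hlip : ∀ θ ∈ Θ, ∃ (B : X → ℝ) (δ : ℝ), StronglyMeasurable B ∧ Integrable B ν ∧ 0 < δ ∧
      ∀ θ' ∈ Metric.ball θ δ, ∀ x, g θ' x ≤ g θ x + dist θ' θ * B x)
    {θ₀ : E} (hθ₀ : θ₀ ∈ Θ)
    (hmax : ∀ θ ∈ Θ, 0 < dist θ θ₀ → ∫ x, g θ x ∂ν < ∫ x, g θ₀ x ∂ν) {θhat : ℕ → Ω → E}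
    (hθhat : ∀ᵐ ω ∂P, ∀ᶠ T in atTop, θhat T ω ∈ Θ ∧ ∑ t ∈ Finset.range T, g θ₀ (R t ω) ≤
      ∑ t ∈ Finset.range T, g (θhat T ω) (R t ω)) :
    ∀ᵐ ω ∂P, Tendsto (fun T => θhat T ω) atTop (𝓝 θ₀) := by
  have key (ε : ℝ) (hε : 0 < ε) : ∀ᵐ ω ∂P, ∀ᶠ T in atTop, dist (θhat T ω) θ₀ < ε := by
    choose! B δ hBm hBi hδ hBb using hlip
    have hK : IsCompact (Θ \ Metric.ball θ₀ ε) := hΘ.diff Metric.isOpen_ball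
    -- Wald's device: on a small enough ball the majorant $g_\theta+\rho|B_\theta|$ still has mean
    -- strictly below the maximal one. Finitely many such balls cover the parameters away from `θ₀`,
    -- so the strong law is needed for finitely many functions only.
    have hrad (θ : E) (hθ : θ ∈ Θ \ Metric.ball θ₀ ε) : ∃ ρ, 0 < ρ ∧ ρ ≤ δ θ ∧
        ∫ x, g θ x ∂ν + ρ * ∫ x, |B θ x| ∂ν < ∫ x, g θ₀ x ∂ν := by
      have hlt := hmax θ hθ.1 (hε.trans_le (by simpa using hθ.2))
      have ht : Tendsto (fun ρ : ℝ => ∫ x, g θ x ∂ν + ρ * ∫ x, |B θ x| ∂ν) (𝓝[>] 0)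
          (𝓝 (∫ x, g θ x ∂ν + 0 * ∫ x, |B θ x| ∂ν)) :=
        Tendsto.mono_left (Continuous.tendsto (by fun_prop) 0) nhdsWithin_le_nhds
      rw [zero_mul, add_zero] at ht
      obtain ⟨ρ, h1, h2, h3⟩ := ((ht.eventually_lt_const hlt).and
        (eventually_mem_nhdsWithin.and
          (nhdsWithin_le_nhds (eventually_le_nhds (hδ θ hθ.1))))).exists
      exact ⟨ρ, h2, h3, h1⟩
    choose! ρ hρ hρδ hρlt using hrad
    obtain ⟨t, htK, htcov⟩ := hK.elim_nhds_subcover (fun θ => Metric.ball θ (ρ θ))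
      fun θ hθ => Metric.ball_mem_nhds θ (hρ θ hθ)
    have hB_abs (θ : E) (hθ : θ ∈ Θ) := ae_tendsto_average_comp hR hind hlaw
      (φ := fun x => |B θ x|) (hBm θ hθ).norm (hBi θ hθ).abs
    have hall : ∀ᵐ ω ∂P, ∀ θ ∈ t, Tendsto (fun n : ℕ => (n : ℝ)⁻¹ • ∑ i ∈ Finset.range n,
        g θ (R i ω) + ρ θ * ((n : ℝ)⁻¹ • ∑ i ∈ Finset.range n, |B θ (R i ω)|)) atTop
        (𝓝 (∫ x, g θ x ∂ν + ρ θ * ∫ x, |B θ x| ∂ν)) := by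
      refine (ae_ball_iff t.countable_toSet).2 fun θ hθ => ?_
      have hθK := (htK θ hθ).1
      filter_upwards [ae_tendsto_average_comp hR hind hlaw (hgm θ hθK) (hgi θ hθK),
        hB_abs θ hθK] with ω h1 h2 using h1.add (h2.const_mul _)
    filter_upwards [hall, ae_tendsto_average_comp hR hind hlaw (hgm θ₀ hθ₀) (hgi θ₀ hθ₀),
      hθhat] with ω h1 h2 h3
    filter_upwards [(Finset.eventually_all t).2 fun θ hθ =>
      (h1 θ hθ).eventually_lt h2 (hρlt θ (htK θ hθ)), h3, eventually_ge_atTop 1]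
      with T h4 ⟨hmem, hle⟩ hT
    by_contra! hcon
    obtain ⟨θ, hθ, hball⟩ := Set.mem_iUnion₂.1 (htcov ⟨hmem, by simpa using hcon⟩)
    have hball' : dist (θhat T ω) θ < ρ θ := hball
    have h5 : ∑ i ∈ Finset.range T, g (θhat T ω) (R i ω) ≤ ∑ i ∈ Finset.range T, g θ (R i ω) +
        ρ θ * ∑ i ∈ Finset.range T, |B θ (R i ω)| := by
      rw [Finset.mul_sum, ← Finset.sum_add_distrib]
      refine Finset.sum_le_sum fun i _ => (hBb θ (htK θ hθ).1 _
        (Metric.ball_subset_ball (hρδ θ (htK θ hθ)) hball) (R i ω)).trans ?_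
      refine add_le_add le_rfl ?_
      exact (mul_le_mul_of_nonneg_left (le_abs_self _) dist_nonneg).trans
        (mul_le_mul_of_nonneg_right hball'.le (abs_nonneg _))
    have h6 := h4 θ hθ
    have hT0 : (0 : ℝ) < (T : ℝ)⁻¹ := inv_pos.2 (by exact_mod_cast hT)
    simp only [smul_eq_mul] at h6
    nlinarith [mul_le_mul_of_nonneg_left (hle.trans h5) hT0.le]
  -- The exceptional null set depends on `ε`; countably many values suffice.
  filter_upwards [ae_all_iff.2 fun k : ℕ => key (1 / (k + 1)) Nat.one_div_pos_of_nat] with ω hω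
  refine Metric.tendsto_nhds.2 fun ε hε => ?_
  obtain ⟨k, hk⟩ := exists_nat_one_div_lt hε
  exact (hω k).mono fun T hT => hT.trans hk

/-- Asymptotic distribution of Z-estimators, normalised so that the mean derivative of the
estimating function is `-id`. -/
theorem tendstoInDistribution_of_estimating_equation [IsProbabilityMeasure P] {Ω' E : Type*} [MeasurableSpace Ω']
    {P' : Measure Ω'} [IsProbabilityMeasure P'] [NormedAddCommGroup E] [InnerProductSpace ℝ E]
    [FiniteDimensional ℝ E] [MeasurableSpace E] [BorelSpace E] (hR : ∀ t, Measurable (R t))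
    (hind : iIndepFun R P) (hlaw : ∀ t, P.map (R t) = ν) {ψ : E → X → E} {H : X → E →L[ℝ] E}
    {B : X → ℝ} {θ₀ : E} {ε : ℝ} (hε : 0 < ε) (hHm : StronglyMeasurable H) (hHi : Integrable H ν)
    (hH : ∫ x, H x ∂ν = -ContinuousLinearMap.id ℝ E) (hBm : StronglyMeasurable B)
    (hBi : Integrable B ν) (hexp : ∀ x, ∀ θ ∈ Metric.ball θ₀ ε,
      ‖ψ θ x - ψ θ₀ x - H x (θ - θ₀)‖ ≤ B x * ‖θ - θ₀‖ ^ 2) {Z : Ω' → E}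
    (hclt : TendstoInDistribution
      (fun (T : ℕ) ω => (√(T : ℝ))⁻¹ • ∑ t ∈ Finset.range T, ψ θ₀ (R t ω)) atTop Z
      (fun _ => P) P') {θhat : ℕ → Ω → E} (hθm : ∀ T, AEMeasurable (θhat T) P)
    (hcons : ∀ᵐ ω ∂P, Tendsto (fun T => θhat T ω) atTop (𝓝 θ₀))
    (hzero : ∀ᵐ ω ∂P, ∀ᶠ T in atTop, ∑ t ∈ Finset.range T, ψ (θhat T ω) (R t ω) = 0) :
    TendstoInDistribution (fun (T : ℕ) ω => √(T : ℝ) • (θhat T ω - θ₀)) atTop Z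
      (fun _ => P) P' := by
  set S : ℕ → Ω → E := fun T ω => (√(T : ℝ))⁻¹ • ∑ t ∈ Finset.range T, ψ θ₀ (R t ω) with hS
  set Y : ℕ → Ω → E := fun T ω => √(T : ℝ) • (θhat T ω - θ₀) with hY
  -- Dividing by $1+\|S_T\|$ makes the remainder tend to zero almost surely, so tightness of $S_T$
  -- need not be proved separately; Slutsky's theorem later multiplies the factor back.
  set D : ℕ → Ω → E := fun T ω => (1 + ‖S T ω‖)⁻¹ • (Y T ω - S T ω) with hD
  have hSm := hclt.forall_aemeasurable
  have hYm (T : ℕ) : AEMeasurable (Y T) P := ((hθm T).sub_const θ₀).const_smul (√(T : ℝ))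
  have hDm (T : ℕ) : AEMeasurable (D T) P :=
    ((hSm T).norm.const_add 1).inv.smul ((hYm T).sub (hSm T))
  have hD0 : ∀ᵐ ω ∂P, Tendsto (fun T => D T ω) atTop (𝓝 0) := by
    filter_upwards [hcons, hzero, ae_tendsto_average_comp hR hind hlaw hHm hHi,
      ae_tendsto_average_comp hR hind hlaw hBm hBi] with ω h1 h2 h3 h4
    set A : ℕ → E →L[ℝ] E := fun n => (n : ℝ)⁻¹ • ∑ t ∈ Finset.range n, H (R t ω) with hA
    set b : ℕ → ℝ := fun n => (n : ℝ)⁻¹ • ∑ t ∈ Finset.range n, B (R t ω) with hb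
    set η : ℕ → ℝ := fun n => ‖ContinuousLinearMap.id ℝ E + A n‖ + |b n| * ‖θhat n ω - θ₀‖ with hη
    have hη0 : Tendsto η atTop (𝓝 0) := by
      have e1 : Tendsto (fun n => ‖ContinuousLinearMap.id ℝ E + A n‖) atTop (𝓝 0) := by
        have := (h3.const_add (ContinuousLinearMap.id ℝ E)).norm
        rwa [hH, add_neg_cancel, norm_zero] at this
      have e2 : Tendsto (fun n => ‖θhat n ω - θ₀‖) atTop (𝓝 0) := by
        have := (h1.sub_const θ₀).norm
        rwa [sub_self, norm_zero] at this
      simpa using e1.add (h4.abs.mul e2)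
    -- Taylor expansion of the estimating equation: $Y-S=(\mathrm{id}+A)Y-(S+AY)$. The first
    -- operator tends to zero by the strong law, and the second bracket is the quadratic remainder,
    -- of size $|b|\,\|\hat\theta-\theta_0\|\,\|Y\|$.
    have hmain : ∀ᶠ T in atTop, ‖Y T ω - S T ω‖ ≤ η T * ‖Y T ω‖ := by
      filter_upwards [h2, h1 (Metric.ball_mem_nhds θ₀ hε), eventually_ge_atTop 1] with T hz hball hT
      have hT0 : (0 : ℝ) < T := by exact_mod_cast hT
      have hsq : √(T : ℝ) * (T : ℝ)⁻¹ = (√(T : ℝ))⁻¹ := by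
        rw [← Real.sqrt_inv, ← div_eq_mul_inv, Real.sqrt_div_self', Real.sqrt_inv, one_div]
      have hsum : ∑ t ∈ Finset.range T, (ψ (θhat T ω) (R t ω) - ψ θ₀ (R t ω) -
          H (R t ω) (θhat T ω - θ₀)) = -∑ t ∈ Finset.range T, ψ θ₀ (R t ω) -
          (∑ t ∈ Finset.range T, H (R t ω)) (θhat T ω - θ₀) := by
        rw [Finset.sum_sub_distrib, Finset.sum_sub_distrib, hz, zero_sub,
          sum_apply]
      have hnorm := norm_sum_le_of_le (Finset.range T) fun t _ => hexp (R t ω) _ hball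
      rw [hsum, ← Finset.sum_mul] at hnorm
      have e : S T ω + A T (Y T ω) = -((√(T : ℝ))⁻¹ • (-∑ t ∈ Finset.range T, ψ θ₀ (R t ω) -
          (∑ t ∈ Finset.range T, H (R t ω)) (θhat T ω - θ₀))) := by
        simp only [hS, hA, hY, map_smul, smul_apply, smul_smul, hsq]
        rw [smul_sub, smul_neg]
        abel
      have h5 : ‖S T ω + A T (Y T ω)‖ ≤ |b T| * ‖θhat T ω - θ₀‖ * ‖Y T ω‖ := by
        refine le_trans ?_ (by gcongr; exact le_abs_self (b T) :
          b T * ‖θhat T ω - θ₀‖ * ‖Y T ω‖ ≤ _)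
        rw [e, norm_neg, norm_smul, norm_inv, Real.norm_of_nonneg (Real.sqrt_nonneg _)]
        calc _ ≤ (√(T : ℝ))⁻¹ * ((∑ t ∈ Finset.range T, B (R t ω)) * ‖θhat T ω - θ₀‖ ^ 2) := by
              gcongr
          _ = _ := by
              rw [← hsq]
              simp only [hY, hb, norm_smul, Real.norm_of_nonneg (Real.sqrt_nonneg _), smul_eq_mul]
              ring
      have e6 : Y T ω - S T ω = (ContinuousLinearMap.id ℝ E + A T) (Y T ω) -
          (S T ω + A T (Y T ω)) := by
        simp only [add_apply, ContinuousLinearMap.id_apply]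
        abel
      rw [e6]
      refine (norm_sub_le _ _).trans ?_
      rw [hη, add_mul]
      exact add_le_add (ContinuousLinearMap.le_opNorm _ _) h5
    refine squeeze_zero_norm' ?_ (by simpa using hη0.const_mul 2)
    -- Once $\eta<1/2$, $\|Y\|\le 2\|S\|$, so $\|Y-S\|\le 2\eta\|S\|\le 2\eta(1+\|S\|)$.
    filter_upwards [hmain, hη0.eventually_lt_const (by norm_num : (0 : ℝ) < 1 / 2)] with T h5 h6
    have h7 : ‖Y T ω‖ ≤ ‖S T ω‖ + ‖Y T ω - S T ω‖ := by
      simpa using norm_add_le (S T ω) (Y T ω - S T ω)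
    have h8 : 0 ≤ η T * ‖Y T ω‖ := (norm_nonneg _).trans h5
    have h9 : ‖Y T ω‖ ≤ 2 * ‖S T ω‖ := by nlinarith [norm_nonneg (Y T ω)]
    have hs := norm_nonneg (S T ω)
    rw [hD, norm_smul, norm_inv, Real.norm_of_nonneg (by positivity),
      inv_mul_le_iff₀ (by positivity)]
    have hη' : 0 ≤ η T := by positivity
    nlinarith
  have hlim := hclt.continuous_comp_prodMk_of_tendstoInMeasure_const (c := (0 : E))
    (g := fun p : E × E => p.1 + (1 + ‖p.1‖) • p.2) (by fun_prop)
    (tendstoInMeasure_of_tendsto_ae (fun T => (hDm T).aestronglyMeasurable) hD0) hDm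
  refine hlim.congr (fun T => ae_of_all _ fun ω => ?_) (ae_of_all _ fun ω => by simp)
  have : 1 + ‖S T ω‖ ≠ 0 := by positivity
  change S T ω + (1 + ‖S T ω‖) • D T ω = Y T ω
  rw [hD]
  simp only [smul_smul, mul_inv_cancel₀ this, one_smul]
  abel

open scoped RealInnerProductSpace Matrix in
/-- The multivariate central limit theorem for functions of an i.i.d. sequence. -/
theorem tendstoInDistribution_inv_sqrt_smul_sum [IsProbabilityMeasure P] {ι : Type*} [Fintype ι]
    [DecidableEq ι] (hR : ∀ t, Measurable (R t)) (hind : iIndepFun R P)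
    (hlaw : ∀ t, P.map (R t) = ν) {φ : X → EuclideanSpace ℝ ι} (hφ : Measurable φ)
    {S : Matrix ι ι ℝ} (hS : S.PosSemidef) (hsq : ∀ v, Integrable (fun x => ⟪φ x, v⟫ ^ 2) ν)
    (hmean : ∀ v, ∫ x, ⟪φ x, v⟫ ∂ν = 0)
    (hcov : ∀ v : EuclideanSpace ℝ ι, ∫ x, ⟪φ x, v⟫ ^ 2 ∂ν = v ⬝ᵥ S *ᵥ v) :
    TendstoInDistribution (fun (T : ℕ) ω => (√(T : ℝ))⁻¹ • ∑ t ∈ Finset.range T, φ (R t ω)) atTop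
      id (fun _ => P) (multivariateGaussian 0 S) := by
  have hmeas (T : ℕ) :
      Measurable fun ω => (√(T : ℝ))⁻¹ • ∑ t ∈ Finset.range T, φ (R t ω) := by
    have h := Finset.measurable_fun_sum (Finset.range T) fun t _ => hφ.comp (hR t)
    exact h.const_smul (√(T : ℝ))⁻¹
  refine ⟨fun T => (hmeas T).aemeasurable, aemeasurable_id,
    ProbabilityMeasure.tendsto_iff_tendsto_charFun.2 fun v => ?_⟩
  have hφv : Measurable fun x => ⟪φ x, v⟫ := hφ.inner_const
  have hident (t : ℕ) : IdentDistrib (R t) (R 0) P P :=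
    ⟨(hR t).aemeasurable, (hR 0).aemeasurable, by rw [hlaw, hlaw]⟩
  have hm0 : ∫ ω, ⟪φ (R 0 ω), v⟫ ∂P = 0 := by
    rw [← integral_map (hR 0).aemeasurable hφv.aestronglyMeasurable (f := fun x => ⟪φ x, v⟫),
      hlaw, hmean]
  have hvar : Var[fun ω => ⟪φ (R 0 ω), v⟫; P] = v ⬝ᵥ S *ᵥ v := by
    rw [variance_of_integral_eq_zero (X := fun ω => ⟪φ (R 0 ω), v⟫)
      (hφv.comp (hR 0)).aemeasurable hm0, ← hcov,
      ← hlaw 0, integral_map (hR 0).aemeasurable (hφv.pow_const 2).aestronglyMeasurable]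
  have hL2 : MemLp (fun ω => ⟪φ (R 0 ω), v⟫) 2 P := by
    refine (memLp_two_iff_integrable_sq (hφv.comp (hR 0)).aestronglyMeasurable).2 ?_
    exact (integrable_map_measure (hφv.pow_const 2).aestronglyMeasurable
      (hR 0).aemeasurable).1 (hlaw 0 ▸ hsq v)
  -- Cramér–Wold: the characteristic function of the vector sum at `v` is that of the scalar sum of
  -- the inner products with `v`, evaluated at `1`.
  have hclt := tendstoInDistribution_inv_sqrt_mul_sum_sub (P := P)
    (X := fun t ω => ⟪φ (R t ω), v⟫)
    (HasLaw.id (μ := gaussianReal 0 (Var[fun ω => ⟪φ (R 0 ω), v⟫; P]).toNNReal)) hL2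
    (hind.comp (fun _ x => ⟪φ x, v⟫) fun _ => hφv) fun t => (hident t).comp hφv
  have hlim := ProbabilityMeasure.tendsto_iff_tendsto_charFun.1 hclt.tendsto 1
  have hvS : 0 ≤ v ⬝ᵥ S *ᵥ v := hvar ▸ variance_nonneg _ _
  simp only [ProbabilityMeasure.coe_mk, Measure.map_id] at hlim ⊢
  rw [charFun_gaussianReal, hvar, Real.coe_toNNReal _ hvS] at hlim
  rw [charFun_multivariateGaussian hS]
  convert! hlim using 2
  · rw [charFun_apply, charFun_apply_real, integral_map (hmeas _).aemeasurable
      (by fun_prop), integral_map (hclt.forall_aemeasurable _) (by fun_prop)]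
    simp [sum_inner, real_inner_smul_left, hm0]
  · simp

end LargeSample

/-! ### The law of the returns and its regularity -/

section BehavioralLaw

open scoped ContDiff RealInnerProductSpace Matrix

/-- The law on `ℝ` with density `f_bw(·; θ)`. -/
noncomputable def behavioralLaw (θ : ParamVec) : Measure ℝ :=
  volume.withDensity fun r => ENNReal.ofReal (behavioralPDF θ r)

lemma measurable_ofReal_behavioralPDF {θ : ParamVec} (hθ : θ ∈ admissibleParams) :
    Measurable fun r => ENNReal.ofReal (behavioralPDF θ r) :=
  (continuous_behavioralPDF hθ).measurable.ennreal_ofReal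

lemma integral_behavioralLaw {G : Type*} [NormedAddCommGroup G] [NormedSpace ℝ G] {θ : ParamVec}
    (hθ : θ ∈ admissibleParams) (φ : ℝ → G) :
    ∫ r, φ r ∂behavioralLaw θ = ∫ r, behavioralPDF θ r • φ r := by
  rw [behavioralLaw, integral_withDensity_eq_integral_toReal_smul
    (measurable_ofReal_behavioralPDF hθ) (by simp)]
  simp only [ENNReal.toReal_ofReal (behavioralPDF_pos hθ _).le]

lemma integrable_behavioralLaw_iff {G : Type*} [NormedAddCommGroup G] [NormedSpace ℝ G]
    {θ : ParamVec} (hθ : θ ∈ admissibleParams) {φ : ℝ → G} :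
    Integrable φ (behavioralLaw θ) ↔ Integrable fun r => behavioralPDF θ r • φ r := by
  rw [behavioralLaw, integrable_withDensity_iff_integrable_smul'
    (measurable_ofReal_behavioralPDF hθ) (by simp)]
  simp only [ENNReal.toReal_ofReal (behavioralPDF_pos hθ _).le]

lemma integrable_behavioralLaw_of_norm_le {G : Type*} [NormedAddCommGroup G] [NormedSpace ℝ G]
    {θ : ParamVec} (hθ : θ ∈ admissibleParams) {φ : ℝ → G} (hφ : StronglyMeasurable φ) {C : ℝ}
    {n : ℕ} (hb : ∀ r, ‖φ r‖ ≤ C * logGrowth r ^ n) : Integrable φ (behavioralLaw θ) := by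
  rw [integrable_behavioralLaw_iff hθ]
  refine ((integrable_logGrowth_pow_mul_behavioralPDF hθ n).const_mul C).mono'
    ((continuous_behavioralPDF hθ).stronglyMeasurable.smul hφ).aestronglyMeasurable
    (ae_of_all _ fun r => ?_)
  have := behavioralPDF_pos hθ r
  rw [norm_smul, Real.norm_of_nonneg this.le, mul_comm, ← mul_assoc]
  gcongr
  exact hb r

lemma eq_behavioralLaw {θ : ParamVec} (hθ : θ ∈ admissibleParams) {μ : Measure ℝ}
    [IsProbabilityMeasure μ] (h : ∀ r, μ.real (Set.Iic r) = behavioralCDF θ r) :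
    μ = behavioralLaw θ := by
  refine Measure.ext_of_Iic _ _ fun r => ?_
  rw [behavioralLaw, withDensity_apply _ measurableSet_Iic,
    ← ofReal_integral_eq_lintegral_ofReal (integrable_behavioralPDF hθ).integrableOn
      (ae_of_all _ fun r => (behavioralPDF_pos hθ r).le), setIntegral_Iic_behavioralPDF hθ, ← h,
    ofReal_measureReal]

lemma exists_closedBall_subset_admissibleParams {θ : ParamVec} (hθ : θ ∈ admissibleParams) :
    ∃ ε, 0 < ε ∧ Metric.closedBall θ ε ⊆ admissibleParams :=
  Metric.nhds_basis_closedBall.mem_iff.1 (isOpen_admissibleParams.mem_nhds hθ)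

/-- The log-density is locally Lipschitz in the parameters, with constant of logarithmic growth. -/
lemma exists_log_behavioralPDF_le_add {θ : ParamVec} (hθ : θ ∈ admissibleParams) :
    ∃ C δ : ℝ, 0 < δ ∧ ∀ θ' ∈ Metric.ball θ δ, ∀ r, Real.log (behavioralPDF θ' r) ≤
      Real.log (behavioralPDF θ r) + dist θ' θ * (C * logGrowth r ^ 3) := by
  obtain ⟨δ, hδ, hball⟩ := exists_closedBall_subset_admissibleParams hθ
  obtain ⟨C, hC, hb⟩ := derivBound_score.bound_zero hball (isCompact_closedBall θ δ)
  refine ⟨C, δ, hδ, fun θ' hθ' r => ?_⟩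
  have h := (convex_closedBall θ δ).norm_image_sub_le_of_norm_hasFDerivWithin_le
    (fun x hx => (hasFDerivAt_log_behavioralPDF (hball hx) r).hasFDerivWithinAt)
    (fun x hx => hb x hx r) (Metric.mem_closedBall_self hδ.le) (Metric.ball_subset_closedBall hθ')
  rw [Real.norm_eq_abs, ← dist_eq_norm] at h
  linarith [le_abs_self (Real.log (behavioralPDF θ' r) - Real.log (behavioralPDF θ r))]

/-- First order expansion of the score, with quadratic remainder. -/
lemma exists_norm_score_sub_le {θ : ParamVec} (hθ : θ ∈ admissibleParams) :
    ∃ C ε : ℝ, 0 ≤ C ∧ 0 < ε ∧ ∀ r, ∀ θ' ∈ Metric.ball θ ε,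
      ‖score θ' r - score θ r - scoreDeriv θ r (θ' - θ)‖ ≤
        C * logGrowth r ^ 9 * ‖θ' - θ‖ ^ 2 := by
  obtain ⟨ε, hε, hball⟩ := exists_closedBall_subset_admissibleParams hθ
  obtain ⟨C, hC, hb⟩ := ((derivBound_scoreDeriv.of_le zero_le_one).fderiv
    isOpen_admissibleParams).bound_zero hball (isCompact_closedBall θ ε)
  refine ⟨C, ε, hC, hε, fun r θ' hθ' => ?_⟩
  have hθ'' : dist θ' θ ≤ ε := (Metric.mem_ball.1 hθ').le
  have hM := logGrowth_nonneg r
  have hlip (x : ParamVec) (hx : x ∈ Metric.closedBall θ ε) :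
      ‖scoreDeriv x r - scoreDeriv θ r‖ ≤ C * logGrowth r ^ 9 * ‖x - θ‖ :=
    (convex_closedBall θ ε).norm_image_sub_le_of_norm_fderiv_le (𝕜 := ℝ)
      (f := fun x => scoreDeriv x r)
      (fun y hy => ((derivBound_scoreDeriv.1 r).differentiableOn (by simp)).differentiableAt
        (isOpen_admissibleParams.mem_nhds (hball hy)))
      (fun y hy => (hb y hy r).trans_eq (by ring)) (Metric.mem_closedBall_self hε.le) hx
  -- The mean value inequality is applied on the ball reaching just to `θ'`: there the derivative
  -- differs from that at `θ` by at most a multiple of $\|\theta'-\theta\|$, which makes the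
  -- remainder quadratic.
  have hsub : Metric.closedBall θ (dist θ' θ) ⊆ Metric.closedBall θ ε :=
    Metric.closedBall_subset_closedBall hθ''
  have h := (convex_closedBall θ (dist θ' θ)).norm_image_sub_le_of_norm_hasFDerivWithin_le'
    (φ := scoreDeriv θ r) (C := C * logGrowth r ^ 9 * ‖θ' - θ‖)
    (fun x hx => (hasFDerivAt_score (hball (hsub hx)) r).hasFDerivWithinAt)
    (fun x hx => (hlip x (hsub hx)).trans (by
      have : ‖x - θ‖ ≤ ‖θ' - θ‖ := by
        rw [← dist_eq_norm, ← dist_eq_norm]; exact hx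
      gcongr)) (Metric.mem_closedBall_self dist_nonneg) (Metric.mem_closedBall.2 le_rfl)
  exact h.trans_eq (by ring)

/-- The inverse Fisher information, as a map from covectors to vectors. -/
noncomputable def inverseFisher (θ : ParamVec) : (ParamVec →L[ℝ] ℝ) →L[ℝ] ParamVec :=
  ∑ i, (ContinuousLinearMap.apply ℝ ℝ (Matrix.toEuclideanCLM (𝕜 := ℝ) (fisherInformation θ)⁻¹
    (EuclideanSpace.single i 1))).smulRight (EuclideanSpace.single i 1)

/-- Pairing with `v` evaluates the covector at $I^{-1}v$, so moments of the normalised score reduce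
to the quadratic form of $I$. -/
lemma inner_inverseFisher (θ : ParamVec) (L : ParamVec →L[ℝ] ℝ) (v : ParamVec) :
    ⟪inverseFisher θ L, v⟫ =
      L (Matrix.toEuclideanCLM (𝕜 := ℝ) (fisherInformation θ)⁻¹ v) := by
  conv_rhs => rw [← (EuclideanSpace.basisFun (Fin 4) ℝ).sum_repr v]
  simp [inverseFisher, sum_inner, real_inner_smul_left, mul_comm, EuclideanSpace.inner_single_left]

lemma fisherInformation_mulVec_inv {θ : ParamVec} (hθ : θ ∈ admissibleParams) (v : ParamVec) :
    fisherInformation θ *ᵥ (Matrix.toEuclideanCLM (𝕜 := ℝ) (fisherInformation θ)⁻¹ v) = v := by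
  rw [Matrix.ofLp_toEuclideanCLM, Matrix.mulVec_mulVec, Matrix.mul_nonsing_inv _
    ((Matrix.isUnit_iff_isUnit_det _).1 (posDef_fisherInformation hθ).isUnit), Matrix.one_mulVec]

lemma stronglyMeasurable_inverseFisher_score {θ : ParamVec} (hθ : θ ∈ admissibleParams) :
    StronglyMeasurable fun r => inverseFisher θ (score θ r) :=
  (inverseFisher θ).continuous.comp_stronglyMeasurable (stronglyMeasurable_score hθ)

lemma integral_inner_inverseFisher_score {θ : ParamVec} (hθ : θ ∈ admissibleParams)
    (v : ParamVec) : ∫ r, ⟪inverseFisher θ (score θ r), v⟫ ∂behavioralLaw θ = 0 := by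
  rw [integral_behavioralLaw hθ]
  simp only [inner_inverseFisher, smul_eq_mul, mul_comm (behavioralPDF θ _)]
  exact integral_score_mul hθ _

lemma integrable_inner_inverseFisher_score_sq {θ : ParamVec} (hθ : θ ∈ admissibleParams)
    (v : ParamVec) :
    Integrable (fun r => ⟪inverseFisher θ (score θ r), v⟫ ^ 2) (behavioralLaw θ) := by
  rw [integrable_behavioralLaw_iff hθ]
  simp only [inner_inverseFisher, smul_eq_mul, mul_comm (behavioralPDF θ _), sq]
  exact integrable_score_mul_score hθ _ _

lemma integral_inner_inverseFisher_score_sq {θ : ParamVec} (hθ : θ ∈ admissibleParams)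
    (v : ParamVec) : ∫ r, ⟪inverseFisher θ (score θ r), v⟫ ^ 2 ∂behavioralLaw θ =
      v ⬝ᵥ (fisherInformation θ)⁻¹ *ᵥ v := by
  rw [integral_behavioralLaw hθ]
  simp only [inner_inverseFisher, smul_eq_mul, mul_comm (behavioralPDF θ _), sq]
  rw [← dotProduct_fisherInformation_mulVec hθ, fisherInformation_mulVec_inv hθ, dotProduct_comm,
    Matrix.ofLp_toEuclideanCLM]

lemma stronglyMeasurable_inverseFisher_scoreDeriv {θ : ParamVec} (hθ : θ ∈ admissibleParams) :
    StronglyMeasurable fun r => (inverseFisher θ).comp (scoreDeriv θ r) :=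
  ((ContinuousLinearMap.compL ℝ ParamVec (ParamVec →L[ℝ] ℝ) ParamVec
    (inverseFisher θ)).continuous).comp_stronglyMeasurable (stronglyMeasurable_scoreDeriv hθ)

lemma integrable_inverseFisher_scoreDeriv {θ : ParamVec} (hθ : θ ∈ admissibleParams) :
    Integrable (fun r => (inverseFisher θ).comp (scoreDeriv θ r)) (behavioralLaw θ) := by
  obtain ⟨C, hC, hb⟩ := exists_norm_scoreDeriv_le hθ
  refine integrable_behavioralLaw_of_norm_le hθ (stronglyMeasurable_inverseFisher_scoreDeriv hθ)
    (C := ‖inverseFisher θ‖ * C) (n := 6) fun r =>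
    ((inverseFisher θ).opNorm_comp_le _).trans ?_
  rw [mul_assoc]
  exact mul_le_mul_of_nonneg_left (hb r) (norm_nonneg _)

/-- By the information equality the mean second derivative is $-I$, so the factor $I^{-1}$
normalises it to $-\mathrm{id}$. -/
lemma integral_inverseFisher_scoreDeriv {θ : ParamVec} (hθ : θ ∈ admissibleParams) :
    ∫ r, (inverseFisher θ).comp (scoreDeriv θ r) ∂behavioralLaw θ =
      -ContinuousLinearMap.id ℝ ParamVec := by
  have hi := integrable_inverseFisher_scoreDeriv hθ
  ext1 w
  refine ext_inner_left ℝ fun v => ?_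
  rw [ContinuousLinearMap.integral_apply (𝕜 := ℝ) hi, ← integral_inner (𝕜 := ℝ)
    (hi.apply_continuousLinearMap w), integral_behavioralLaw hθ]
  have e (r : ℝ) : behavioralPDF θ r • ⟪v, (inverseFisher θ).comp (scoreDeriv θ r) w⟫ =
      -(-scoreDeriv θ r w (Matrix.toEuclideanCLM (𝕜 := ℝ) (fisherInformation θ)⁻¹ v) *
        behavioralPDF θ r) := by
    rw [real_inner_comm, ContinuousLinearMap.comp_apply, inner_inverseFisher, smul_eq_mul]
    ring
  simp only [e]
  rw [integral_neg, integral_neg_scoreDeriv hθ, ← dotProduct_fisherInformation_mulVec hθ,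
    fisherInformation_mulVec_inv hθ]
  simp [PiLp.inner_apply, dotProduct]

lemma sum_score_eq_zero_of_isMLE {Θ : Set ParamVec} (hΘ : Θ ⊆ admissibleParams) {x : ℕ → ℝ}
    {T : ℕ} {θ : ParamVec} (hθ : θ ∈ interior Θ) (h : IsMLE Θ x T θ) :
    ∑ t ∈ Finset.range T, score θ (x t) = 0 := by
  have hmax : IsLocalMax (logLikelihood x T) θ := by
    filter_upwards [mem_interior_iff_mem_nhds.1 hθ] with θ' hθ' using h.2 θ' hθ'
  exact hmax.hasFDerivAt_eq_zero (HasFDerivAt.fun_sum fun t _ =>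
    hasFDerivAt_log_behavioralPDF (hΘ (interior_subset hθ)) (x t))

end BehavioralLaw

/-! ### Consistency and asymptotic normality -/

theorem theorem3
    {Ω : Type*} [MeasurableSpace Ω] (P : Measure Ω) [IsProbabilityMeasure P]
    (Θ : Set ParamVec) (hΘ : IsCompact Θ) (hΘ_adm : Θ ⊆ admissibleParams)
    (θ₀ : ParamVec) (hθ₀ : θ₀ ∈ Θ)
    (R : ℕ → Ω → ℝ) (hR_meas : ∀ t, Measurable (R t)) (hR_indep : iIndepFun R P)
    (hR_law : ∀ t r, P.real {ω | R t ω ≤ r} = behavioralCDF θ₀ r)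
    (θhat : ℕ → Ω → ParamVec) (hθhat_meas : ∀ T, AEMeasurable (θhat T) P)
    (hθhat : ∀ T, 1 ≤ T → ∀ᵐ ω ∂P, IsMLE Θ (fun t => R t ω) T (θhat T ω)) :
    TendstoInMeasure P θhat atTop (fun _ => θ₀) ∧
    (θ₀ ∈ interior Θ →
      (∀ r, ContDiffAt ℝ 2 (fun θ => Real.log (behavioralPDF θ r)) θ₀) ∧
      (∀ i j, Integrable (fun r => logDensityHessian θ₀ r i j * behavioralPDF θ₀ r)) ∧
      (fisherInformation θ₀).PosDef ∧
      TendstoInDistribution (fun (T : ℕ) ω => √(T : ℝ) • (θhat T ω - θ₀)) atTop id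
        (fun _ => P) (multivariateGaussian 0 (fisherInformation θ₀)⁻¹)) := by
  have hadm := hΘ_adm hθ₀
  have hlaw (t : ℕ) : P.map (R t) = behavioralLaw θ₀ := by
    have := Measure.isProbabilityMeasure_map (μ := P) (hR_meas t).aemeasurable
    refine eq_behavioralLaw hadm fun r => ?_
    rw [map_measureReal_apply (hR_meas t) measurableSet_Iic]
    exact hR_law t r
  -- The null set may depend on `T`; there are countably many. The shift by one is there because
  -- nothing is assumed at `T = 0`.
  have hMLE : ∀ᵐ ω ∂P, ∀ᶠ T in atTop, IsMLE Θ (fun t => R t ω) T (θhat T ω) := by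
    filter_upwards [ae_all_iff.2 fun T : ℕ => hθhat (T + 1) (by omega)] with ω hω
    filter_upwards [eventually_ge_atTop 1] with T hT
    simpa [Nat.sub_add_cancel hT] using hω (T - 1)
  have hlogm (θ : ParamVec) (hθ : θ ∈ admissibleParams) :
      StronglyMeasurable fun r => Real.log (behavioralPDF θ r) :=
    ((continuous_behavioralPDF hθ).log fun r => (behavioralPDF_pos hθ r).ne').stronglyMeasurable
  have hcons : ∀ᵐ ω ∂P, Tendsto (fun T => θhat T ω) atTop (𝓝 θ₀) := by
    refine ae_tendsto_of_maximizes hR_meas hR_indep hlaw hΘ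
      (g := fun θ r => Real.log (behavioralPDF θ r)) (fun θ hθ => hlogm θ (hΘ_adm hθ))
      (fun θ hθ => ?_) (fun θ hθ => ?_) hθ₀ (fun θ hθ hne => ?_)
      (hMLE.mono fun ω hω => hω.mono fun T hT => ⟨hT.1, hT.2 θ₀ hθ₀⟩)
    · obtain ⟨C, -, hb⟩ := exists_abs_log_behavioralPDF_le hΘ_adm hΘ
      exact integrable_behavioralLaw_of_norm_le hadm (hlogm θ (hΘ_adm hθ)) (C := C) (n := 1)
        fun r => by simpa using hb θ hθ r
    · obtain ⟨C, δ, hδ, hb⟩ := exists_log_behavioralPDF_le_add (hΘ_adm hθ)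
      have hm : StronglyMeasurable fun r => C * logGrowth r ^ 3 :=
        (continuous_const.mul (continuous_logGrowth.pow 3)).stronglyMeasurable
      refine ⟨fun r => C * logGrowth r ^ 3, δ, hm, integrable_behavioralLaw_of_norm_le hadm hm
        (C := |C|) (n := 3) fun r => ?_, hδ, hb⟩
      rw [norm_mul, Real.norm_eq_abs, Real.norm_of_nonneg (pow_nonneg (logGrowth_nonneg r) 3)]
    · simpa only [integral_behavioralLaw hadm, smul_eq_mul, mul_comm (behavioralPDF θ₀ _)] using
        integral_log_behavioralPDF_lt (hΘ_adm hθ) hadm (dist_pos.1 hne)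
  refine ⟨tendstoInMeasure_of_tendsto_ae (fun T => (hθhat_meas T).aestronglyMeasurable) hcons,
    fun hint => ⟨fun r => ?_, fun i j => ?_, posDef_fisherInformation hadm, ?_⟩⟩
  · exact ((derivBound_log_behavioralPDF.1 r).contDiffAt
      (isOpen_admissibleParams.mem_nhds hadm)).of_le ENat.LEInfty.out
  · exact integrable_scoreDeriv_apply hadm _ _
  obtain ⟨C, ε, hC, hε, hexp⟩ := exists_norm_score_sub_le hadm
  have hBm : StronglyMeasurable fun r => ‖inverseFisher θ₀‖ * (C * logGrowth r ^ 9) :=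
    (continuous_const.mul (continuous_const.mul (continuous_logGrowth.pow 9))).stronglyMeasurable
  refine tendstoInDistribution_of_estimating_equation hR_meas hR_indep hlaw
    (ψ := fun θ r => inverseFisher θ₀ (score θ r)) hε
    (stronglyMeasurable_inverseFisher_scoreDeriv hadm) (integrable_inverseFisher_scoreDeriv hadm)
    (integral_inverseFisher_scoreDeriv hadm) hBm
    (integrable_behavioralLaw_of_norm_le hadm hBm (C := ‖inverseFisher θ₀‖ * C) (n := 9)
      fun r => ?_) (fun r θ hθ => ?_)
    (tendstoInDistribution_inv_sqrt_smul_sum hR_meas hR_indep hlaw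
      (stronglyMeasurable_inverseFisher_score hadm).measurable
      (posDef_fisherInformation hadm).inv.posSemidef
      (integrable_inner_inverseFisher_score_sq hadm) (integral_inner_inverseFisher_score hadm)
      (integral_inner_inverseFisher_score_sq hadm)) hθhat_meas hcons ?_
  · have := logGrowth_nonneg r
    rw [Real.norm_of_nonneg (by positivity), mul_assoc]
  · rw [← map_sub, ContinuousLinearMap.comp_apply, ← map_sub, mul_assoc]
    exact (ContinuousLinearMap.le_opNorm _ _).trans
      (mul_le_mul_of_nonneg_left (hexp r θ hθ) (norm_nonneg _))
  -- By strong consistency the estimator eventually lies in the interior, where a maximiser solves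
  -- the score equation exactly.
  · filter_upwards [hMLE, hcons] with ω h1 h2
    filter_upwards [h1, h2 (isOpen_interior.mem_nhds hint)] with T h3 h4
    rw [← map_sum, sum_score_eq_zero_of_isMLE hΘ_adm h4 h3, map_zero]
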